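/- Let $z=re^{i\theta}$ with $r=|z|>0$ and $\theta=\arg z\in\mathbb R$ arbitrary (so $z$ runs over the Riemann surface of the logarithm), and put $\ln z=\ln r+i\theta$; all other complex logarithms written below are principal. Put $F(z)=(z-\tfrac12)\ln z-z+\tfrac12\ln(2\pi)$. Let $c_k=2(1-2^{1-2k})\zeta(2k)/\pi^{2k}$ be the cosecant numbers and $c_k(x)=\sum_{j=0}^{k}\frac{(-1)^j}{(2j)!}\,c_{k-j}\,x^j$ the cosecant polynomials. A *determination* of the multivalued function $\ln\Gamma$ is a function $L(r,\theta)$ which (i) for $-\pi<\theta\le\pi$ is the principal branch of $\ln\Gamma(z)$ (real for $z>0$, analytic off $(-\infty,0]$, continuous from above on the negative axis); (ii) satisfies $e^{L(r,\theta)}=\Gamma(z)$ for all $\theta\notin(\mathbb Z+\tfrac12)\pi$; here in (i) and (ii) the poles $z=0,-1,-2,\dots$ are excluded; and (iii) on each ray $\theta\in(\mathbb Z+\tfrac12)\pi$ (a Stokes line), where $L$ may be discontinuous in $\theta$, is the mean of its one-sided limits in $\theta$ (with $r$ fixed), which exist. **Theorem.** There is a determination $\ln\Gamma$ such that for all integers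 $N\ge1$ and $M\ge0$ and all $r>0$ the following hold. (a) (Stokes sectors.) Let $(M-\tfrac12)\pi<\theta<(M+\tfrac12)\pi$ (upper signs) or $-(M+\tfrac12)\pi<\theta<-(M-\tfrac12)\pi$ (lower signs). Then the sum and the integral in $$R_N^{SS}(z)=\frac{2(-1)^{N+1}z}{(2\pi z)^{2N}}\int_0^\infty y^{2N-2}e^{-y}\sum_{n=1}^\infty\frac{1}{n^{2N-2}\left((y/2\pi z)^2+n^2\right)}\,dy$$ converge absolutely, and, if $z\notin\{0,-1,-2,\dots\}$, $$\ln\Gamma(z)=F(z)+z\sum_{k=1}^{N-1}\frac{(-1)^k}{(2z)^{2k}}\,\Gamma(2k-1)\,c_k(1)+R_N^{SS}(z)+SD_M^{SS}(z),$$ where $$SD_M^{SS}(z)=-\lfloor M/2\rfloor\ln\left(-e^{\pm2i\pi z}\right)-\frac{1-(-1)^M}{2}\ln\left(1-e^{\pm2i\pi z}\right).$$ (b) (Stokes lines.) Let $\theta=\pm(M+\tfrac12)\pi$. Then the sum in $$R_N^{SL}(z)=\frac{2z}{(2\pi|z|)^{2N-2}}\;P\!\!\int_0^\infty y^{2N-2}e^{-y}\sum_{n=1}^\infty\frac{1}{n^{2N-2}\left(y^2-4n^2\pi^2|z|^2\right)}\,dy$$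 converges absolutely for $y\ne2n\pi|z|$, the Cauchy principal value (symmetric $\varepsilon$-neighbourhoods of all the points $2n\pi|z|$, $n\ge1$, removed, $\varepsilon\to0^+$) exists, and $$\ln\Gamma(z)=F(z)+z\sum_{k=1}^{N-1}\frac{(-1)^k}{(2z)^{2k}}\,\Gamma(2k-1)\,c_k(1)+R_N^{SL}(z)+SD_M^{SL}(z),$$ where $$SD_M^{SL}(z)=(-1)^M\left(\lfloor M/2\rfloor+\frac{1-(-1)^M}{2}\right)2\pi|z|-\frac12\ln\left(1-e^{-2\pi|z|}\right).$$ -/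

import Mathlib

open Filter Topology MeasureTheory

noncomputable section

namespace StirlingExact

/-! ### The Riemann surface of the logarithm

A point of the surface is a pair `(r, θ)` with `r > 0` and an arbitrary real argument `θ`. -/

/-- The complex number `z = r e^{iθ}` below the point `(r, θ)` of the surface. -/
def pt (r θ : ℝ) : ℂ := (r : ℂ) * Complex.exp ((θ : ℂ) * Complex.I)

/-- The logarithm `ln z = ln r + iθ` on the surface. -/
def lnPt (r θ : ℝ) : ℂ := (Real.log r : ℂ) + (θ : ℂ) * Complex.I

/-- `z` is not one of the poles `0, -1, -2, …` of the gamma function. -/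
def NotPole (z : ℂ) : Prop := ∀ n : ℕ, z ≠ -(n : ℂ)

/-! ### The logarithm of the gamma function -/

/-- The principal branch of `ln Γ`, that is, the termwise logarithm of the Weierstrass product
`Γ(z) = e^{-γz} z⁻¹ ∏_{n ≥ 1} e^{z/n} (1 + z/n)⁻¹`. It is analytic off `(-∞, 0]`, real on the
positive axis and, because of the choice `arg = π` in `Complex.log`, continuous from above
on the negative axis (off the poles). The series converges for every `z`. -/
def logGamma (z : ℂ) : ℂ :=
  -(Real.eulerMascheroniConstant : ℂ) * z - Complex.log z
    + ∑' n : ℕ, (z / ((n : ℂ) + 1) - Complex.log (1 + z / ((n : ℂ) + 1)))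

/-- `L` is a determination of the multivalued function `ln Γ` on the Riemann surface of the
logarithm: on the sheet `-π < θ ≤ π` it is the principal branch; off the Stokes lines
`θ = (k + 1/2) π` it is a logarithm of `Γ(z)`; and on a Stokes line, where it may jump, it is
the mean of its two one-sided limits in `θ`. -/
structure IsLogGammaDetermination (L : ℝ → ℝ → ℂ) : Prop where
  principal : ∀ r θ : ℝ, 0 < r → -Real.pi < θ → θ ≤ Real.pi → NotPole (pt r θ) →
    L r θ = logGamma (pt r θ)
  exp_eq : ∀ r θ : ℝ, 0 < r → (∀ k : ℤ, θ ≠ ((k : ℝ) + 1 / 2) * Real.pi) → NotPole (pt r θ) →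
    Complex.exp (L r θ) = Complex.Gamma (pt r θ)
  mean : ∀ (r : ℝ) (k : ℤ), 0 < r → ∃ a b : ℂ,
    Tendsto (fun t => L r t) (𝓝[<] (((k : ℝ) + 1 / 2) * Real.pi)) (𝓝 a) ∧
    Tendsto (fun t => L r t) (𝓝[>] (((k : ℝ) + 1 / 2) * Real.pi)) (𝓝 b) ∧
    L r (((k : ℝ) + 1 / 2) * Real.pi) = (a + b) / 2

/-! ### Leading terms and truncated series -/

/-- The leading terms `F(z) = (z - 1/2) ln z - z + (1/2) ln (2π)`. -/
def leading (r θ : ℝ) : ℂ :=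
  (pt r θ - 1 / 2) * lnPt r θ - pt r θ + 1 / 2 * (Real.log (2 * Real.pi) : ℂ)

/-- The cosecant numbers `c_k = 2 (1 - 2^{1-2k}) ζ(2k) / π^{2k}` (so `c_0 = 1`, `c_1 = 1/6`). -/
def cosecantNumber (k : ℕ) : ℂ :=
  2 * (1 - (2 : ℂ) ^ (1 - 2 * (k : ℤ))) * riemannZeta (2 * (k : ℂ)) / (Real.pi : ℂ) ^ (2 * k)

/-- The cosecant polynomials `c_k(x) = ∑_{j=0}^k (-1)^j / (2j)! c_{k-j} x^j`. -/
def cosecantPoly (k : ℕ) (x : ℂ) : ℂ :=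
  ∑ j ∈ Finset.range (k + 1),
    (-1) ^ j / (Nat.factorial (2 * j) : ℂ) * cosecantNumber (k - j) * x ^ j

/-- The truncated series `z ∑_{k=1}^{N-1} (-1)^k / (2z)^{2k} Γ(2k-1) c_k(1)`. -/
def truncatedSeries (N : ℕ) (z : ℂ) : ℂ :=
  z * ∑ k ∈ Finset.Ico 1 N,
    (-1) ^ k / (2 * z) ^ (2 * k) * Complex.Gamma (2 * (k : ℂ) - 1) * cosecantPoly k 1

/-! ### Stokes sectors -/

/-- The `n`-th term (`n ≥ 1` is written `n + 1`) of the inner series of the sector remainder. -/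
def sectorTerm (N : ℕ) (z : ℂ) (y : ℝ) (n : ℕ) : ℂ :=
  1 / (((n : ℂ) + 1) ^ (2 * N - 2) *
    (((y : ℂ) / (2 * (Real.pi : ℂ) * z)) ^ 2 + ((n : ℂ) + 1) ^ 2))

/-- The integrand `y^{2N-2} e^{-y} ∑_n …` of the sector remainder. -/
def sectorIntegrand (N : ℕ) (z : ℂ) (y : ℝ) : ℂ :=
  (y : ℂ) ^ (2 * N - 2) * Complex.exp (-(y : ℂ)) * ∑' n : ℕ, sectorTerm N z y n

/-- The remainder `R_N^{SS}(z)` in the Stokes sectors. -/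
def sectorRemainder (N : ℕ) (z : ℂ) : ℂ :=
  2 * (-1) ^ (N + 1) * z / (2 * (Real.pi : ℂ) * z) ^ (2 * N) *
    ∫ y in Set.Ioi (0 : ℝ), sectorIntegrand N z y

/-- The Stokes discontinuity term `SD_M^{SS}(z)`, with `σ = 1` for the upper and `σ = -1` for the
lower sign; the logarithms are principal. -/
def sectorDisc (M : ℕ) (σ : ℝ) (z : ℂ) : ℂ :=
  -((M / 2 : ℕ) : ℂ) * Complex.log (-Complex.exp ((σ : ℂ) * (2 * Complex.I * Real.pi * z)))
    - (1 - (-1) ^ M) / 2 *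
      Complex.log (1 - Complex.exp ((σ : ℂ) * (2 * Complex.I * Real.pi * z)))

/-! ### Stokes lines -/

/-- `v` is the Cauchy principal value `P ∫_0^∞ f(y) dy` with respect to the set `S` of
singularities: symmetric `ε`-neighbourhoods of all points of `S` are cut out, and `ε → 0+`. -/
def HasPrincipalValue (f : ℝ → ℝ) (S : Set ℝ) (v : ℝ) : Prop :=
  (∀ ε : ℝ, 0 < ε → IntegrableOn f {y : ℝ | 0 < y ∧ ∀ s ∈ S, ε < |y - s|}) ∧
  Tendsto (fun ε : ℝ => ∫ y in {y : ℝ | 0 < y ∧ ∀ s ∈ S, ε < |y - s|}, f y) (𝓝[>] 0) (𝓝 v)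

/-- The singularities `2nπr`, `n ≥ 1`, on a Stokes line with `|z| = r`. -/
def linePoles (r : ℝ) : Set ℝ := {s : ℝ | ∃ n : ℕ, s = 2 * ((n : ℝ) + 1) * Real.pi * r}

/-- The `n`-th term (`n ≥ 1` is written `n + 1`) of the inner series of the line remainder. -/
def lineTerm (N : ℕ) (r y : ℝ) (n : ℕ) : ℝ :=
  1 / (((n : ℝ) + 1) ^ (2 * N - 2) * (y ^ 2 - 4 * ((n : ℝ) + 1) ^ 2 * Real.pi ^ 2 * r ^ 2))

/-- The integrand `y^{2N-2} e^{-y} ∑_n …` of the line remainder. -/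
def lineIntegrand (N : ℕ) (r y : ℝ) : ℝ :=
  y ^ (2 * N - 2) * Real.exp (-y) * ∑' n : ℕ, lineTerm N r y n

/-- The Stokes discontinuity term `SD_M^{SL}(z)`, which depends on `r = |z|` only. -/
def lineDisc (M : ℕ) (r : ℝ) : ℝ :=
  (-1) ^ M * (((M / 2 : ℕ) : ℝ) + (1 - (-1) ^ M) / 2) * (2 * Real.pi * r)
    - 1 / 2 * Real.log (1 - Real.exp (-(2 * Real.pi * r)))

end StirlingExact

end

noncomputable section

namespace StirlingExact

/-! The dependence on N is only apparent. One step of the geometric expansion 1/(w+n²) = 1/n² −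
(w/n²)/(w+n²) splits off from the remainder exactly the next term of the truncated series, because
c_k(1) = −2ζ(2k)/π^{2k} (`cosecantPoly_one`) and ∫ y^{2k−2} e^{−y} dy = Γ(2k−1). Hence series plus
remainder equals the remainder for N = 1 (`truncatedSeries_add_sectorRemainder`), and y = 2πnt turns
the latter into Binet's integral `binet z`, with its logarithm expanded in powers of e^{−2πt}
(`sectorRemainder_one`). It depends on the complex number z only, not on the sheet; it makes sense
off the imaginary axis, and it is odd.

For Re z > 0 one has ln Γ = F + binet (`logGamma_eq_binetLogGamma`): there Binet's integral is a
Laplace transform, from which F + binet solves f(z+1) = f(z) + ln z, while binet(z+n) → 0; Gauss'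
limit and Stirling's formula for n! then identify the solution. In the left half-plane, oddness and
the reflection formula of Γ produce the term −ln(1 − e^{±2πiz}) (`logGamma_second_quadrant`).
Raising θ by 2π fixes z and binet and adds (z − 1/2)·2πi to F, whose exponential is −e^{2πiz}; this
accounts for the term with ⌊M/2⌋. So the determination is defined sector by sector by its closed
form, and `exp_sectorValue` shows that it is a logarithm of Γ.

At a Stokes line the pole t = ±iz of Binet's integrand reaches the path of integration. Subtracting
the value of the exponential at t = r leaves a kernel dominated uniformly on the circle |z| = r, and
the subtracted part integrates exactly to a half residue. So binet has the one-sided limits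
2z₀·`linePV r` ∓ ½ ln(1 − e^{−2πr}) (`tendsto_binet_right`, `tendsto_binet_left`). Together with the
limits of the discontinuity terms only a jump in 2πiℤ survives, and the mean of the two sides is the
closed form on the line (`exists_mean`).

Finally `linePV` has to be the true principal value (`hasPrincipalValue_one`): near each pole the
singular part is odd about the pole and drops out of every symmetrically cut integral, and what is
left of 1/(y² − Y²) has integral 0. The geometric step again reaches every N
(`exists_hasPrincipalValue`). -/

/-! ### Cosecant polynomials at 1 and the values ζ(2k) -/

open PowerSeries in
/-- The power series of `t / sinh t = 2 b(t) - b(2t)`, with `b(t) = t / (e^t - 1)`, times `cosh t`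
is the one of `t coth t = b(2t) + t`. -/
theorem cosech_mul_cosh_powerSeries :
    (2 * bernoulliPowerSeries ℂ - rescale (2 : ℂ) (bernoulliPowerSeries ℂ)) *
      (exp ℂ + evalNegHom (exp ℂ)) =
      2 * (rescale (2 : ℂ) (bernoulliPowerSeries ℂ) + X) := by
  have hB : bernoulliPowerSeries ℂ * (exp ℂ - 1) = X := bernoulliPowerSeries_mul_exp_sub_one ℂ
  have he : rescale (2 : ℂ) (exp ℂ) = exp ℂ ^ 2 := by
    have := exp_pow_eq_rescale_exp (A := ℂ) 2
    rw [this]; norm_num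
  have hB2 : rescale (2 : ℂ) (bernoulliPowerSeries ℂ) * (exp ℂ ^ 2 - 1) = 2 * X := by
    have := congrArg (rescale (2 : ℂ)) hB
    rw [map_mul, map_sub, he, map_one, rescale_X] at this
    simpa [map_ofNat] using this
  have hn : exp ℂ * evalNegHom (exp ℂ) = 1 := exp_mul_exp_neg_eq_one
  have hne : (exp ℂ ^ 2 - 1 : PowerSeries ℂ) ≠ 0 := by
    intro h0
    have := congrArg (coeff 1) h0
    rw [← he] at this
    simp [coeff_one] at this
  -- After multiplication by e^{2t} − 1, which is not a zero divisor, the claim is a polynomial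
  -- consequence of the defining relations of b(t) and b(2t) and of e^t·e^{−t} = 1.
  apply mul_right_cancel₀ hne
  linear_combination (2 * (exp ℂ + 1) * (exp ℂ + evalNegHom (exp ℂ))) * hB
    - (exp ℂ + evalNegHom (exp ℂ) + 2) * hB2 + 2 * X * hn

/-- Euler's evaluation of ζ(2k). The sign (−1)^k is the passage from t/sinh t to t/sin t, so that
the identity of power series above can be applied. -/
theorem cosecantNumber_eq (k : ℕ) :
    cosecantNumber k =
      (-1) ^ k * ((2 - 2 ^ (2 * k)) * (bernoulli (2 * k) : ℂ) / (Nat.factorial (2 * k) : ℂ)) := by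
  have hpi : (Real.pi : ℂ) ^ (2 * k) ≠ 0 := by
    exact pow_ne_zero _ (by exact_mod_cast Real.pi_ne_zero)
  have hf : (Nat.factorial (2 * k) : ℂ) ≠ 0 := by exact_mod_cast Nat.factorial_ne_zero _
  have h1 : (2 : ℂ) ^ (1 - 2 * (k : ℤ)) = 2 / 2 ^ (2 * k) := by
    rw [zpow_sub₀ two_ne_zero, zpow_one]; norm_cast
  have h2 : (2 : ℂ) ^ (2 * (k : ℤ) - 1) = 2 ^ (2 * k) / 2 := by
    rw [zpow_sub₀ two_ne_zero, zpow_one]; norm_cast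
  have h3 : (2 : ℂ) ^ (2 * k) ≠ 0 := pow_ne_zero _ two_ne_zero
  rw [cosecantNumber, riemannZeta_two_mul_nat', h1, h2, pow_succ]
  field_simp
  ring

/-- The cosecant polynomials at `1` are the Taylor coefficients of `t cot t`. -/
theorem cosecantPoly_one (k : ℕ) :
    cosecantPoly k 1 = -2 * riemannZeta (2 * (k : ℂ)) / (Real.pi : ℂ) ^ (2 * k) := by
  have hpi : (Real.pi : ℂ) ^ (2 * k) ≠ 0 :=
    pow_ne_zero _ (by exact_mod_cast Real.pi_ne_zero)
  have key := congrArg (PowerSeries.coeff (2 * k)) cosech_mul_cosh_powerSeries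
  set S := 2 * bernoulliPowerSeries ℂ - PowerSeries.rescale (2 : ℂ) (bernoulliPowerSeries ℂ)
    with hS
  have hSc : ∀ n, PowerSeries.coeff n S
      = (2 - 2 ^ n) * (bernoulli n : ℂ) / (Nat.factorial n : ℂ) := by
    intro n
    have : (2 : PowerSeries ℂ) * bernoulliPowerSeries ℂ
      = bernoulliPowerSeries ℂ + bernoulliPowerSeries ℂ := two_mul _
    rw [hS, this]
    simp [bernoulliPowerSeries, PowerSeries.coeff_rescale]
    ring
  have hSodd : ∀ n, Odd n → PowerSeries.coeff n S = 0 := by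
    intro n hn
    rw [hSc]
    -- The only nonzero odd Bernoulli number is the one of index 1, and there the factor 2 − 2^n
    -- vanishes.
    rcases eq_or_ne n 1 with rfl | h1
    · norm_num
    · have : 1 < n := by obtain ⟨m, rfl⟩ := hn; omega
      simp [bernoulli_eq_zero_of_odd hn this]
  have hC : ∀ n, PowerSeries.coeff (2 * n)
      (PowerSeries.exp ℂ + PowerSeries.evalNegHom (PowerSeries.exp ℂ))
      = 2 / (Nat.factorial (2 * n) : ℂ) := by
    intro n
    simp [PowerSeries.evalNegHom, PowerSeries.coeff_rescale, PowerSeries.coeff_exp]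
    ring
  have hrhs : PowerSeries.coeff (2 * k)
      (2 * (PowerSeries.rescale (2 : ℂ) (bernoulliPowerSeries ℂ) + PowerSeries.X))
      = 2 * (2 ^ (2 * k) * (bernoulli (2 * k) : ℂ) / (Nat.factorial (2 * k) : ℂ)) := by
    rw [two_mul (_ + _), two_mul (2 ^ _ * _ / _)]
    have : 2 * k ≠ 1 := by omega
    simp [bernoulliPowerSeries, PowerSeries.coeff_rescale, PowerSeries.coeff_X, this]
    ring
  rw [hrhs, PowerSeries.coeff_mul] at key
  have hsum : ∑ j ∈ Finset.range (k + 1), (PowerSeries.coeff (2 * (k - j)) S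
      * (2 / (Nat.factorial (2 * j) : ℂ)))
      = ∑ p ∈ Finset.HasAntidiagonal.antidiagonal (2 * k), PowerSeries.coeff p.1 S * PowerSeries.coeff p.2
        (PowerSeries.exp ℂ + PowerSeries.evalNegHom (PowerSeries.exp ℂ)) := by
    -- Since t/sinh t is even, only pairs of even indices contribute to the coefficient of degree
    -- 2k.
    apply Finset.sum_of_injOn (fun j => (2 * (k - j), 2 * j))
    · intro a _ b _ h
      simp only [Prod.mk.injEq] at h
      omega
    · intro a ha
      simp only [Finset.coe_range, Set.mem_Iio, Finset.mem_coe,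
        Finset.HasAntidiagonal.mem_antidiagonal] at ha ⊢
      omega
    · rintro ⟨a, b⟩ hab hn
      rw [Finset.HasAntidiagonal.mem_antidiagonal] at hab
      rcases Nat.even_or_odd a with ⟨c, hc⟩ | ho
      · exfalso
        apply hn
        refine ⟨k - c, ?_, ?_⟩
        · simp
        · simp only [Prod.mk.injEq]; simp only at hab; omega
      · rw [hSodd _ ho, zero_mul]
    · intro j _
      rw [hC]
  rw [← hsum] at key
  have hcp : cosecantPoly k 1 = (-1) ^ k / 2 * ∑ j ∈ Finset.range (k + 1),
      (PowerSeries.coeff (2 * (k - j)) S * (2 / (Nat.factorial (2 * j) : ℂ))) := by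
    rw [cosecantPoly, Finset.mul_sum]
    refine Finset.sum_congr rfl fun j hj => ?_
    have hjk : j ≤ k := by simpa [Nat.lt_succ_iff] using hj
    rw [cosecantNumber_eq, hSc]
    have : (-1 : ℂ) ^ k = (-1) ^ j * (-1) ^ (k - j) := by
      rw [← pow_add]; congr 1; omega
    rw [this, one_pow]
    ring
  have h2 : (2 : ℂ) ^ (2 * (k : ℤ) - 1) = 2 ^ (2 * k) / 2 := by
    rw [zpow_sub₀ two_ne_zero, zpow_one]; norm_cast
  rw [hcp, key, riemannZeta_two_mul_nat', h2]
  field_simp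
  ring

/-! ### Convergence of the series for ln Γ, and Gauss' limit -/

theorem norm_sub_log_one_add_le {w : ℂ} (hw : ‖w‖ ≤ 1 / 2) : ‖w - Complex.log (1 + w)‖ ≤ ‖w‖ ^ 2 := by
  rw [norm_sub_rev]
  refine (Complex.norm_log_one_add_sub_self_le (by linarith)).trans ?_
  have : (1 - ‖w‖)⁻¹ ≤ 2 := by
    rw [inv_le_comm₀ (by linarith) (by norm_num)]; linarith
  nlinarith [sq_nonneg ‖w‖]

theorem summable_inv_succ_sq : Summable fun n : ℕ => 1 / ((n : ℝ) + 1) ^ 2 := by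
  have := (summable_nat_add_iff 1).2 (Real.summable_one_div_nat_pow.2 (one_lt_two))
  simpa using this

theorem norm_div_succ (z : ℂ) (n : ℕ) : ‖z / ((n : ℂ) + 1)‖ = ‖z‖ / ((n : ℝ) + 1) := by
  rw [norm_div]
  congr 1
  have : ((n : ℂ) + 1) = (((n : ℝ) + 1 : ℝ) : ℂ) := by push_cast; rfl
  rw [this, Complex.norm_real, Real.norm_of_nonneg (by positivity)]

/-- The bound depends on z through R only, so it serves both for convergence at a point and for
uniform convergence on balls, which gives continuity. -/
theorem norm_logGamma_term_le {z : ℂ} {n : ℕ} {R : ℝ} (hz : ‖z‖ ≤ R) (hn : 2 * R ≤ n) :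
    ‖z / ((n : ℂ) + 1) - Complex.log (1 + z / ((n : ℂ) + 1))‖ ≤ R ^ 2 * (1 / ((n : ℝ) + 1) ^ 2) := by
  have h0 := norm_nonneg z
  have h1 : ‖z / ((n : ℂ) + 1)‖ ≤ R / ((n : ℝ) + 1) := by
    rw [norm_div_succ]; gcongr
  refine (norm_sub_log_one_add_le (h1.trans ?_)).trans ?_
  · rw [div_le_div_iff₀ (by positivity) (by norm_num)]; linarith
  · calc _ ≤ (R / ((n : ℝ) + 1)) ^ 2 := by gcongr
      _ = _ := by rw [div_pow]; ring

theorem summable_logGamma_term (z : ℂ) :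
    Summable fun n : ℕ => z / ((n : ℂ) + 1) - Complex.log (1 + z / ((n : ℂ) + 1)) := by
  refine Summable.of_norm_bounded_eventually_nat (summable_inv_succ_sq.mul_left (‖z‖ ^ 2)) ?_
  filter_upwards [eventually_ge_atTop ⌈2 * ‖z‖⌉₊] with n hn
  exact norm_logGamma_term_le le_rfl (Nat.ceil_le.1 hn)

theorem one_add_div_succ_ne_zero {z : ℂ} (hz : NotPole z) (n : ℕ) : 1 + z / ((n : ℂ) + 1) ≠ 0 := by
  have hn : ((n : ℂ) + 1) ≠ 0 := by exact_mod_cast Nat.succ_ne_zero n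
  intro h
  apply hz (n + 1)
  field_simp at h
  push_cast
  linear_combination h

theorem NotPole.ne_zero {z : ℂ} (hz : NotPole z) : z ≠ 0 := by
  simpa using hz 0

/-- A positive real factor leaves the principal logarithm without any 2πi correction. -/
theorem log_add_succ {z : ℂ} (hz : NotPole z) (n : ℕ) :
    Complex.log (z + ((n + 1 : ℕ) : ℂ))
      = Complex.log (1 + z / ((n : ℂ) + 1)) + (Real.log ((n : ℝ) + 1) : ℂ) := by
  have hn : ((n : ℂ) + 1) ≠ 0 := by exact_mod_cast Nat.succ_ne_zero n
  have h : z + ((n + 1 : ℕ) : ℂ) = (((n : ℝ) + 1 : ℝ) : ℂ) * (1 + z / ((n : ℂ) + 1)) := by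
    push_cast; field_simp; ring
  rw [h, Complex.log_ofReal_mul (by positivity) (one_add_div_succ_ne_zero hz n), add_comm]

theorem sum_log_succ (n : ℕ) :
    ∑ k ∈ Finset.range n, Real.log ((k : ℝ) + 1) = Real.log (Nat.factorial n) := by
  induction n with
  | zero => simp
  | succ n ih =>
    rw [Finset.sum_range_succ, ih, Nat.factorial_succ]
    push_cast
    rw [Real.log_mul (by positivity) (by positivity), add_comm]

/-- Gauss' limit for the principal branch of `ln Γ`. -/
theorem tendsto_logGamma {z : ℂ} (hz : NotPole z) :
    Tendsto (fun n : ℕ => z * (Real.log n : ℂ) + (Real.log (Nat.factorial n) : ℂ)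
      - ∑ k ∈ Finset.range (n + 1), Complex.log (z + (k : ℂ))) atTop (𝓝 (logGamma z)) := by
  have h1 := (summable_logGamma_term z).hasSum.tendsto_sum_nat
  have h2 : Tendsto (fun n : ℕ => (((harmonic n : ℝ) - Real.log n : ℝ) : ℂ)) atTop
      (𝓝 (Real.eulerMascheroniConstant : ℂ)) :=
    (Complex.continuous_ofReal.tendsto _).comp Real.tendsto_harmonic_sub_log
  have h3 := ((h2.const_mul (-z)).sub (tendsto_const_nhds (x := Complex.log z))).add h1
  rw [logGamma]
  convert h3 using 2 with n
  -- The harmonic sum z·H_n in the partial sum of the series cancels the one in −z(H_n − ln n).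
  · rw [Finset.sum_range_succ', Finset.sum_congr rfl fun k _ => log_add_succ hz k,
      Finset.sum_add_distrib, ← sum_log_succ, Finset.sum_sub_distrib]
    have : ∑ i ∈ Finset.range n, z / ((i : ℂ) + 1) = z * (((harmonic n : ℚ) : ℝ) : ℂ) := by
      rw [harmonic, Rat.cast_sum]
      push_cast
      rw [Finset.mul_sum]
      exact Finset.sum_congr rfl fun k _ => div_eq_mul_inv _ _
    rw [this]
    push_cast
    simp only [add_zero]
    ring
  · ring

theorem exp_logGamma {z : ℂ} (hz : NotPole z) : Complex.exp (logGamma z) = Complex.Gamma z := by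
  have h1 := (Complex.continuous_exp.tendsto _).comp (tendsto_logGamma hz)
  refine tendsto_nhds_unique h1 ((Complex.GammaSeq_tendsto_Gamma z).congr' ?_)
  filter_upwards [eventually_ge_atTop 1] with n hn
  have hn0 : (n : ℂ) ≠ 0 := by exact_mod_cast (by omega : n ≠ 0)
  have hne : ∀ k : ℕ, z + (k : ℂ) ≠ 0 := fun k h => hz k (by linear_combination h)
  rw [Function.comp_apply, Complex.exp_sub, Complex.exp_add, Complex.exp_sum, Complex.GammaSeq,
    Complex.cpow_def_of_ne_zero hn0]
  congr 1
  · congr 1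
    · rw [mul_comm, Complex.natCast_log]
    · rw [← Complex.ofReal_exp, Real.exp_log (by positivity)]
      simp
  · exact Finset.prod_congr rfl fun k _ => (Complex.exp_log (hne k)).symm

/-! ### The Stokes sectors -/

/-- The segment from 1 to a misses 0 because a is not in (−∞, 0]. Compactness gives it a positive
distance c from 0, and homogeneity extends the bound to the whole cone. -/
theorem exists_mul_add_le_norm {a : ℂ} (ha : a ∈ Complex.slitPlane) :
    ∃ c : ℝ, 0 < c ∧ ∀ x y : ℝ, 0 ≤ x → 0 ≤ y → c * (x + y) ≤ ‖(x : ℂ) * a + y‖ := by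
  have hcont : ContinuousOn (fun x : ℝ => ‖(x : ℂ) * a + ((1 - x : ℝ) : ℂ)‖) (Set.Icc 0 1) := by
    fun_prop
  obtain ⟨x₀, hx₀, hmin⟩ := isCompact_Icc.exists_isMinOn ⟨0, by simp⟩ hcont
  refine ⟨_, norm_pos_iff.2 (?_ : (x₀ : ℂ) * a + ((1 - x₀ : ℝ) : ℂ) ≠ 0), ?_⟩
  · intro h
    have hre := congrArg Complex.re h
    have him := congrArg Complex.im h
    simp only [Complex.add_re, Complex.add_im, Complex.re_ofReal_mul, Complex.im_ofReal_mul,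
      Complex.ofReal_re, Complex.ofReal_im, Complex.zero_re, Complex.zero_im, add_zero,
      mul_eq_zero] at hre him
    rcases him with h0 | h0
    · rw [h0] at hre; norm_num at hre
    · rw [Complex.mem_slitPlane_iff] at ha
      rcases ha with ha | ha
      · have h1 : 0 ≤ x₀ * a.re := mul_nonneg hx₀.1 ha.le
        have h2 : x₀ = 1 := by linarith [hx₀.2]
        rw [h2] at hre
        linarith
      · exact ha h0
  · intro x y hx hy
    rcases (add_nonneg hx hy).eq_or_lt with h | h
    · rw [← h, mul_zero]; positivity
    · have hle := hmin (show x / (x + y) ∈ Set.Icc (0 : ℝ) 1 from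
        ⟨by positivity, (div_le_one h).2 (by linarith)⟩)
      simp only [Set.mem_ofPred_eq] at hle
      have hxy : ((x : ℂ) + y) ≠ 0 := by exact_mod_cast h.ne'
      have hsplit : (x : ℂ) * a + y = ((x + y : ℝ) : ℂ) *
          (((x / (x + y) : ℝ) : ℂ) * a + ((1 - x / (x + y) : ℝ) : ℂ)) := by
        push_cast
        field_simp
        ring
      rw [hsplit, norm_mul, Complex.norm_real, Real.norm_of_nonneg h.le, mul_comm]
      gcongr

theorem sq_mem_slitPlane {z : ℂ} (hz : z.re ≠ 0) : z ^ 2 ∈ Complex.slitPlane := by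
  rw [Complex.mem_slitPlane_iff]
  by_cases h : z.im = 0
  · left
    rw [sq, Complex.mul_re, h]
    have := mul_self_pos.2 hz
    linarith
  · right
    rw [sq, Complex.mul_im]
    have := mul_ne_zero hz h
    intro h'
    apply this
    linarith

theorem exists_mul_one_add_sq_le_norm {z : ℂ} (hz : z.re ≠ 0) :
    ∃ c : ℝ, 0 < c ∧ ∀ t : ℝ, c * (1 + t ^ 2) ≤ ‖(t : ℂ) ^ 2 + z ^ 2‖ := by
  obtain ⟨c, hc, h⟩ := exists_mul_add_le_norm (sq_mem_slitPlane hz)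
  refine ⟨c, hc, fun t => ?_⟩
  have := h 1 (t ^ 2) zero_le_one (sq_nonneg t)
  rwa [Complex.ofReal_one, one_mul, Complex.ofReal_pow, add_comm (z ^ 2)] at this

theorem sq_add_sq_ne_zero {z : ℂ} (hz : z.re ≠ 0) (t : ℝ) : (t : ℂ) ^ 2 + z ^ 2 ≠ 0 := by
  obtain ⟨c, hc, h⟩ := exists_mul_one_add_sq_le_norm hz
  rw [← norm_pos_iff]
  exact lt_of_lt_of_le (by positivity) (h t)

theorem two_pi_mul_re_ne_zero {z : ℂ} (hz : z.re ≠ 0) : (2 * (Real.pi : ℂ) * z).re ≠ 0 := by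
  have : 2 * (Real.pi : ℂ) * z = ((2 * Real.pi : ℝ) : ℂ) * z := by push_cast; ring
  rw [this, Complex.re_ofReal_mul]
  exact mul_ne_zero (by positivity) hz

/-- The constant is uniform in y: off the imaginary axis (2πz)^{−2} lies in the slit plane, so y²
and (n+1)² cannot cancel each other. -/
theorem exists_sector_lower_bound {z : ℂ} (hz : z.re ≠ 0) :
    ∃ c : ℝ, 0 < c ∧ ∀ (y : ℝ) (n : ℕ), c * ((n : ℝ) + 1) ^ 2 ≤
      ‖((y : ℂ) / (2 * (Real.pi : ℂ) * z)) ^ 2 + ((n : ℂ) + 1) ^ 2‖ := by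
  have ha : ((2 * (Real.pi : ℂ) * z) ^ 2)⁻¹ ∈ Complex.slitPlane := by
    rw [← inv_pow]
    refine sq_mem_slitPlane ?_
    have h := two_pi_mul_re_ne_zero hz
    rw [Complex.inv_re]
    exact div_ne_zero h (Complex.normSq_pos.2 fun h0 => h (by rw [h0]; rfl)).ne'
  obtain ⟨c, hc, h⟩ := exists_mul_add_le_norm ha
  refine ⟨c, hc, fun y n => ?_⟩
  have := h (y ^ 2) (((n : ℝ) + 1) ^ 2) (sq_nonneg _) (sq_nonneg _)
  refine le_trans ?_ (this.trans (le_of_eq ?_))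
  · gcongr; nlinarith [sq_nonneg y]
  · congr 1; push_cast; rw [div_pow, div_eq_mul_inv]

theorem sector_denom_ne_zero {z : ℂ} (hz : z.re ≠ 0) (y : ℝ) (n : ℕ) :
    ((y : ℂ) / (2 * (Real.pi : ℂ) * z)) ^ 2 + ((n : ℂ) + 1) ^ 2 ≠ 0 := by
  obtain ⟨c, hc, h⟩ := exists_sector_lower_bound hz
  rw [← norm_pos_iff]
  exact lt_of_lt_of_le (by positivity) (h y n)

theorem norm_succ (n : ℕ) : ‖((n : ℂ) + 1)‖ = (n : ℝ) + 1 := by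
  have : ((n : ℂ) + 1) = (((n : ℝ) + 1 : ℝ) : ℂ) := by push_cast; rfl
  rw [this, Complex.norm_real, Real.norm_of_nonneg (by positivity)]

theorem exists_norm_sectorTerm_le (N : ℕ) {z : ℂ} (hz : z.re ≠ 0) :
    ∃ C : ℝ, 0 < C ∧ ∀ (y : ℝ) (n : ℕ), ‖sectorTerm N z y n‖ ≤ C * (1 / ((n : ℝ) + 1) ^ 2) := by
  obtain ⟨c, hc, h⟩ := exists_sector_lower_bound hz
  refine ⟨1 / c, by positivity, fun y n => ?_⟩
  rw [sectorTerm, norm_div, norm_one, norm_mul, norm_pow, norm_succ, div_mul_div_comm, one_mul]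
  have h1 : (1 : ℝ) ≤ ((n : ℝ) + 1) ^ (2 * N - 2) := one_le_pow₀ (by linarith [n.cast_nonneg (α := ℝ)])
  have h2 := h y n
  refine one_div_le_one_div_of_le (by positivity) ?_
  calc c * ((n : ℝ) + 1) ^ 2 ≤ _ := h2
    _ ≤ _ := le_mul_of_one_le_left (norm_nonneg _) h1

theorem summable_sectorTerm (N : ℕ) {z : ℂ} (hz : z.re ≠ 0) (y : ℝ) :
    Summable (sectorTerm N z y) := by
  obtain ⟨C, _, h⟩ := exists_norm_sectorTerm_le N hz
  exact Summable.of_norm_bounded (summable_inv_succ_sq.mul_left C) (h y)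

theorem measurable_sectorTerm (N : ℕ) (z : ℂ) (n : ℕ) : Measurable fun y => sectorTerm N z y n := by
  unfold sectorTerm
  fun_prop

theorem integrableOn_pow_mul_exp_neg (k : ℕ) :
    IntegrableOn (fun y : ℝ => y ^ k * Real.exp (-y)) (Set.Ioi 0) := by
  have := Real.GammaIntegral_convergent (s := (k : ℝ) + 1) (by positivity)
  refine this.congr_fun (fun y _ => ?_) measurableSet_Ioi
  simp only [add_sub_cancel_right, Real.rpow_natCast]
  ring

theorem integral_pow_mul_exp_neg (k : ℕ) :
    ∫ y in Set.Ioi (0 : ℝ), y ^ k * Real.exp (-y) = (Nat.factorial k : ℝ) := by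
  rw [← Real.Gamma_nat_eq_factorial, Real.Gamma_eq_integral (by positivity)]
  refine setIntegral_congr_fun measurableSet_Ioi (fun y _ => ?_)
  simp only [add_sub_cancel_right, Real.rpow_natCast]
  ring

theorem integrableOn_cpow_mul_exp_neg (k : ℕ) :
    IntegrableOn (fun y : ℝ => (y : ℂ) ^ k * Complex.exp (-(y : ℂ))) (Set.Ioi 0) := by
  have : IntegrableOn (fun y : ℝ => ((y ^ k * Real.exp (-y) : ℝ) : ℂ)) (Set.Ioi 0) :=
    (integrableOn_pow_mul_exp_neg k).ofReal
  simpa using this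

theorem integral_cpow_mul_exp_neg (k : ℕ) :
    ∫ y in Set.Ioi (0 : ℝ), (y : ℂ) ^ k * Complex.exp (-(y : ℂ)) = (Nat.factorial k : ℂ) := by
  have := congrArg (fun x : ℝ => (x : ℂ)) (integral_pow_mul_exp_neg k)
  rw [← integral_complex_ofReal] at this
  rw [Complex.ofReal_natCast] at this
  rw [← this]
  refine setIntegral_congr_fun measurableSet_Ioi (fun y _ => ?_)
  simp

theorem integrableOn_sectorIntegrand (N : ℕ) {z : ℂ} (hz : z.re ≠ 0) :
    IntegrableOn (sectorIntegrand N z) (Set.Ioi 0) := by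
  obtain ⟨C, _, h⟩ := exists_norm_sectorTerm_le N hz
  have hb := (integrableOn_pow_mul_exp_neg (2 * N - 2)).mul_const
    (∑' n : ℕ, C * (1 / ((n : ℝ) + 1) ^ 2))
  refine Integrable.mono' hb ?_ ?_
  · have := Measurable.tsum (L := SummationFilter.unconditional ℕ)
      (fun n => measurable_sectorTerm N z n)
    refine Measurable.aestronglyMeasurable ?_
    unfold sectorIntegrand
    fun_prop
  · refine (ae_restrict_iff' measurableSet_Ioi).2 (ae_of_all _ fun y (hy : 0 < y) => ?_)
    rw [sectorIntegrand, norm_mul, norm_mul, norm_pow, Complex.norm_real, Real.norm_of_nonneg hy.le,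
      ← Complex.ofReal_neg, ← Complex.ofReal_exp, Complex.norm_real,
      Real.norm_of_nonneg (Real.exp_nonneg _)]
    gcongr
    exact tsum_of_norm_bounded (summable_inv_succ_sq.mul_left C).hasSum (h y)

/-! ### Recursion in the truncation index, in a sector -/

theorem tsum_one_div_succ_pow {k : ℕ} (hk : 1 < k) :
    ∑' n : ℕ, 1 / ((n : ℂ) + 1) ^ k = riemannZeta k := by
  rw [zeta_nat_eq_tsum_of_gt_one hk]
  have hs : Summable fun n : ℕ => 1 / (n : ℂ) ^ k := by
    refine Summable.of_norm ?_
    simpa using Real.summable_one_div_nat_pow.2 hk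
  rw [hs.tsum_eq_zero_add]
  simp [show k ≠ 0 by omega]

theorem summable_one_div_succ_pow {k : ℕ} (hk : 1 < k) :
    Summable fun n : ℕ => 1 / ((n : ℂ) + 1) ^ k := by
  have hs : Summable fun n : ℕ => 1 / (n : ℂ) ^ k := by
    refine Summable.of_norm ?_
    simpa using Real.summable_one_div_nat_pow.2 hk
  simpa using (summable_nat_add_iff 1).2 hs

/-- One step of the geometric expansion of 1/(w + n²), with w = (y/2πz)². Writing N = m + 1 keeps
the exponent 2N − 2 free of truncated subtraction. -/
theorem sectorTerm_succ (m : ℕ) {z : ℂ} (hz : z.re ≠ 0) (y : ℝ) (n : ℕ) :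
    sectorTerm (m + 1) z y n = 1 / ((n : ℂ) + 1) ^ (2 * (m + 1))
      - ((y : ℂ) / (2 * (Real.pi : ℂ) * z)) ^ 2 * sectorTerm (m + 2) z y n := by
  have h1 := sector_denom_ne_zero hz y n
  have h2 : ((n : ℂ) + 1) ≠ 0 := by exact_mod_cast Nat.succ_ne_zero n
  rw [sectorTerm, sectorTerm, show 2 * (m + 1) - 2 = 2 * m by omega,
    show 2 * (m + 2) - 2 = 2 * (m + 1) by omega]
  set w := ((y : ℂ) / (2 * (Real.pi : ℂ) * z)) ^ 2
  field_simp
  ring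

theorem sectorIntegrand_succ (m : ℕ) {z : ℂ} (hz : z.re ≠ 0) (y : ℝ) :
    sectorIntegrand (m + 1) z y =
      (y : ℂ) ^ (2 * m) * Complex.exp (-(y : ℂ)) * riemannZeta (2 * ((m + 1 : ℕ) : ℂ))
        - 1 / (2 * (Real.pi : ℂ) * z) ^ 2 * sectorIntegrand (m + 2) z y := by
  have hk : 1 < 2 * (m + 1) := by omega
  rw [sectorIntegrand, sectorIntegrand, tsum_congr (sectorTerm_succ m hz y),
    (summable_one_div_succ_pow hk).tsum_sub ((summable_sectorTerm (m + 2) hz y).mul_left _),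
    tsum_one_div_succ_pow hk, tsum_mul_left, show 2 * (m + 1) - 2 = 2 * m by omega,
    show 2 * (m + 2) - 2 = 2 * m + 2 by omega]
  push_cast
  ring

/-- The split-off part of the integrand integrates to (2m)!·ζ(2m+2). Here (2m)! = Γ(2k−1) for k = m
+ 1, and `cosecantPoly_one` converts the zeta value into c_k(1). -/
theorem sectorRemainder_succ (m : ℕ) {z : ℂ} (hz : z.re ≠ 0) :
    sectorRemainder (m + 1) z = z * ((-1) ^ (m + 1) / (2 * z) ^ (2 * (m + 1)) *
      Complex.Gamma (2 * ((m + 1 : ℕ) : ℂ) - 1) * cosecantPoly (m + 1) 1)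
        + sectorRemainder (m + 2) z := by
  have hz0 : z ≠ 0 := fun h => hz (by rw [h]; rfl)
  have hpi : (Real.pi : ℂ) ≠ 0 := by exact_mod_cast Real.pi_ne_zero
  have hG : Complex.Gamma (2 * ((m + 1 : ℕ) : ℂ) - 1) = (Nat.factorial (2 * m) : ℂ) := by
    rw [← Complex.Gamma_nat_eq_factorial]
    congr 1
    push_cast
    ring
  have hint : ∫ y in Set.Ioi (0 : ℝ), sectorIntegrand (m + 1) z y =
      (Nat.factorial (2 * m) : ℂ) * riemannZeta (2 * ((m + 1 : ℕ) : ℂ))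
        - 1 / (2 * (Real.pi : ℂ) * z) ^ 2 * ∫ y in Set.Ioi (0 : ℝ), sectorIntegrand (m + 2) z y := by
    rw [setIntegral_congr_fun measurableSet_Ioi (fun y _ => sectorIntegrand_succ m hz y),
      integral_sub ((integrableOn_cpow_mul_exp_neg _).mul_const _)
        ((integrableOn_sectorIntegrand _ hz).const_mul _), integral_mul_const,
      integral_cpow_mul_exp_neg, integral_const_mul]
  rw [sectorRemainder, sectorRemainder, hint, hG, cosecantPoly_one,
    show 2 * (m + 2) = 2 * (m + 1) + 2 by omega, pow_add _ (2 * (m + 1)) 2]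
  set I := ∫ y in Set.Ioi (0 : ℝ), sectorIntegrand (m + 2) z y
  set ζ := riemannZeta (2 * ((m + 1 : ℕ) : ℂ))
  rw [mul_pow, mul_pow, mul_pow (2 : ℂ) z, show m + 2 + 1 = (m + 1 + 1) + 1 by omega,
    pow_succ (-1 : ℂ) (m + 1 + 1), pow_succ (-1 : ℂ) (m + 1)]
  field_simp
  ring

theorem truncatedSeries_one (z : ℂ) : truncatedSeries 1 z = 0 := by
  simp [truncatedSeries]

theorem truncatedSeries_succ (m : ℕ) (z : ℂ) :
    truncatedSeries (m + 2) z = truncatedSeries (m + 1) z +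
      z * ((-1) ^ (m + 1) / (2 * z) ^ (2 * (m + 1)) *
      Complex.Gamma (2 * ((m + 1 : ℕ) : ℂ) - 1) * cosecantPoly (m + 1) 1) := by
  rw [truncatedSeries, truncatedSeries, Finset.sum_Ico_succ_top (by omega), mul_add]

/-- Truncating later only moves terms from the remainder to the series. -/
theorem truncatedSeries_add_sectorRemainder (m : ℕ) {z : ℂ} (hz : z.re ≠ 0) :
    truncatedSeries (m + 1) z + sectorRemainder (m + 1) z = sectorRemainder 1 z := by
  induction m with
  | zero => rw [truncatedSeries_one, zero_add]
  | succ m ih =>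
    rw [← ih, truncatedSeries_succ, sectorRemainder_succ m hz]
    ring

/-! ### Binet's integral as a series -/

/-- The `n`-th term of Binet's integral `-(1/π) ∫ z / (t² + z²) ln (1 - e^{-2πt}) dt`, up to the
factor `1 / (π (n + 1))`. -/
def binetTerm (z : ℂ) (n : ℕ) : ℂ :=
  ∫ t in Set.Ioi (0 : ℝ),
    (Real.exp (-(2 * Real.pi * ((n : ℝ) + 1)) * t) : ℂ) * (z / ((t : ℂ) ^ 2 + z ^ 2))

/-- Binet's integral, as a series. -/
def binet (z : ℂ) : ℂ := ∑' n : ℕ, 1 / ((Real.pi : ℂ) * ((n : ℂ) + 1)) * binetTerm z n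

theorem binetTerm_neg (z : ℂ) (n : ℕ) : binetTerm (-z) n = -binetTerm z n := by
  rw [binetTerm, binetTerm, ← integral_neg]
  congr 1 with t
  rw [neg_sq, neg_div, mul_neg]

/-- Oddness carries every result about the right half-plane over to the left one. -/
theorem binet_neg (z : ℂ) : binet (-z) = -binet z := by
  rw [binet, binet, ← tsum_neg]
  exact tsum_congr fun n => by rw [binetTerm_neg, mul_neg]

/-- Substitution y = 2π(n+1)t, after which the denominator is (n+1)²(t² + z²)/z². -/
theorem integral_exp_mul_sectorTerm_one {z : ℂ} (hz : z.re ≠ 0) (n : ℕ) :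
    ∫ y in Set.Ioi (0 : ℝ), Complex.exp (-(y : ℂ)) * sectorTerm 1 z y n =
      2 * (Real.pi : ℂ) * z / ((n : ℂ) + 1) * binetTerm z n := by
  have hz0 : z ≠ 0 := fun h => hz (by rw [h]; rfl)
  have hpi : (Real.pi : ℂ) ≠ 0 := by exact_mod_cast Real.pi_ne_zero
  have hb : 0 < 2 * Real.pi * ((n : ℝ) + 1) := by positivity
  have h2 : ((n : ℂ) + 1) ≠ 0 := by exact_mod_cast Nat.succ_ne_zero n
  have := integral_comp_mul_left_Ioi'
    (fun y : ℝ => Complex.exp (-(y : ℂ)) * sectorTerm 1 z y n) 0 hb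
  rw [mul_zero] at this
  rw [← this, binetTerm, ← integral_const_mul, ← integral_smul]
  refine setIntegral_congr_fun measurableSet_Ioi (fun t _ => ?_)
  have h3 := sq_add_sq_ne_zero hz t
  have h4 := sector_denom_ne_zero hz (2 * Real.pi * ((n : ℝ) + 1) * t) n
  simp only [sectorTerm, Complex.real_smul]
  have h5 : ((2 * Real.pi * ((n : ℝ) + 1) * t : ℝ) : ℂ) / (2 * (Real.pi : ℂ) * z)
      = ((n : ℂ) + 1) * t / z := by
    push_cast
    field_simp
  have h6 : (((n : ℂ) + 1) * t / z) ^ 2 + ((n : ℂ) + 1) ^ 2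
      = ((n : ℂ) + 1) ^ 2 * ((t : ℂ) ^ 2 + z ^ 2) / z ^ 2 := by
    field_simp
  rw [h5, h6]
  push_cast
  rw [neg_mul]
  norm_num
  field_simp

/-- Termwise integration, justified by the majorant C e^{−y}/(n+1)². -/
theorem sectorRemainder_one {z : ℂ} (hz : z.re ≠ 0) : sectorRemainder 1 z = binet z := by
  have hz0 : z ≠ 0 := fun h => hz (by rw [h]; rfl)
  have hpi : (Real.pi : ℂ) ≠ 0 := by exact_mod_cast Real.pi_ne_zero
  obtain ⟨C, hC, h⟩ := exists_norm_sectorTerm_le 1 hz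
  have hexp := integrableOn_pow_mul_exp_neg 0
  simp only [pow_zero, one_mul] at hexp
  have hbound : ∀ n : ℕ, ∀ᵐ y : ℝ ∂(volume.restrict (Set.Ioi (0 : ℝ))),
      ‖Complex.exp (-(y : ℂ)) * sectorTerm 1 z y n‖
        ≤ Real.exp (-y) * (C * (1 / ((n : ℝ) + 1) ^ 2)) := by
    intro n
    refine ae_of_all _ fun y => ?_
    rw [norm_mul, ← Complex.ofReal_neg, ← Complex.ofReal_exp, Complex.norm_real,
      Real.norm_of_nonneg (Real.exp_nonneg _)]
    gcongr
    exact h y n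
  have hint : ∀ n : ℕ, IntegrableOn (fun y : ℝ => Complex.exp (-(y : ℂ)) * sectorTerm 1 z y n)
      (Set.Ioi 0) := by
    intro n
    refine Integrable.mono' (hexp.mul_const _) ?_ (hbound n)
    refine Measurable.aestronglyMeasurable ?_
    have := measurable_sectorTerm 1 z n
    fun_prop
  have hsum : Summable fun n : ℕ => ∫ y in Set.Ioi (0 : ℝ),
      ‖Complex.exp (-(y : ℂ)) * sectorTerm 1 z y n‖ := by
    refine Summable.of_nonneg_of_le (fun n => integral_nonneg fun y => norm_nonneg _)
      (fun n => ?_) (summable_inv_succ_sq.mul_left C)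
    refine (integral_mono_ae (hint n).norm (hexp.mul_const _) (hbound n)).trans ?_
    rw [integral_mul_const]
    have := integral_pow_mul_exp_neg 0
    simp only [pow_zero, one_mul, Nat.factorial_zero, Nat.cast_one] at this
    rw [this, one_mul]
  have key := integral_tsum_of_summable_integral_norm hint hsum
  have h1 : ∫ y in Set.Ioi (0 : ℝ), sectorIntegrand 1 z y
      = ∑' n : ℕ, 2 * (Real.pi : ℂ) * z / ((n : ℂ) + 1) * binetTerm z n := by
    rw [← tsum_congr (integral_exp_mul_sectorTerm_one hz), key]
    refine setIntegral_congr_fun measurableSet_Ioi (fun y _ => ?_)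
    simp [sectorIntegrand, tsum_mul_left]
  rw [sectorRemainder, h1, binet, ← tsum_mul_left]
  refine tsum_congr fun n => ?_
  have h2 : ((n : ℂ) + 1) ≠ 0 := by exact_mod_cast Nat.succ_ne_zero n
  field_simp
  ring

/-! ### Binet's formula in the right half-plane -/

theorem integral_exp_mul_cos {w : ℂ} (hw : 0 < w.re) (t : ℝ) :
    ∫ s in Set.Ioi (0 : ℝ), Complex.exp (-w * s) * Complex.cos (t * s) = w / ((t : ℂ) ^ 2 + w ^ 2) := by
  have h1 : (-w + t * Complex.I).re < 0 := by simpa using hw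
  have h2 : (-w - t * Complex.I).re < 0 := by simpa using hw
  have hne1 : -w + t * Complex.I ≠ 0 := fun h => by rw [h] at h1; simp at h1
  have hne2 : -w - t * Complex.I ≠ 0 := fun h => by rw [h] at h2; simp at h2
  have heq : ∀ s : ℝ, Complex.exp (-w * s) * Complex.cos (t * s) =
      1 / 2 * Complex.exp ((-w + t * Complex.I) * s)
        + 1 / 2 * Complex.exp ((-w - t * Complex.I) * s) := by
    intro s
    rw [Complex.cos, add_mul, sub_mul, sub_eq_add_neg, Complex.exp_add, Complex.exp_add]
    rw [show (t : ℂ) * Complex.I * s = t * s * Complex.I by ring, neg_mul (_ * _) Complex.I]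
    ring
  simp_rw [heq]
  rw [integral_add ((integrableOn_exp_mul_complex_Ioi h1 0).const_mul _)
    ((integrableOn_exp_mul_complex_Ioi h2 0).const_mul _), integral_const_mul, integral_const_mul,
    integral_exp_mul_complex_Ioi h1, integral_exp_mul_complex_Ioi h2]
  have h3 := sq_add_sq_ne_zero hw.ne' t
  simp only [Complex.ofReal_zero, mul_zero, Complex.exp_zero]
  have h4 : (t : ℂ) ^ 2 + w ^ 2 = (-w + t * Complex.I) * (-w - t * Complex.I) := by
    linear_combination (t : ℂ) ^ 2 * Complex.I_sq
  rw [h4]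
  field_simp
  ring

theorem integrableOn_exp_neg_mul {b : ℝ} (hb : 0 < b) :
    IntegrableOn (fun s : ℝ => Real.exp (-b * s)) (Set.Ioi 0) :=
  integrableOn_exp_mul_Ioi (by linarith) 0

theorem integral_exp_neg_mul {b : ℝ} (hb : 0 < b) :
    ∫ s in Set.Ioi (0 : ℝ), Real.exp (-b * s) = 1 / b := by
  rw [integral_exp_mul_Ioi (by linarith)]
  simp

theorem norm_exp_neg_mul (z : ℂ) (s : ℝ) : ‖Complex.exp (-z * s)‖ = Real.exp (-z.re * s) := by
  rw [Complex.norm_exp]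
  simp

/-- The terms of Binet's series as Laplace transforms. -/
theorem binetTerm_eq_laplace {z : ℂ} (hz : 0 < z.re) (n : ℕ) :
    binetTerm z n = ∫ s in Set.Ioi (0 : ℝ), Complex.exp (-z * s) *
      ((2 * Real.pi * ((n : ℝ) + 1) / (s ^ 2 + (2 * Real.pi * ((n : ℝ) + 1)) ^ 2) : ℝ) : ℂ) := by
  set a : ℝ := 2 * Real.pi * ((n : ℝ) + 1) with ha
  have ha0 : 0 < a := by positivity
  -- Writing z/(t² + z²) as the Laplace transform of cos(ts) makes the double integral symmetric:
  -- done in the other order, the integral over t is the same formula with a in place of z.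
  have h1 : binetTerm z n = ∫ t in Set.Ioi (0 : ℝ), ∫ s in Set.Ioi (0 : ℝ),
      Complex.exp (-(a : ℂ) * t) * (Complex.exp (-z * s) * Complex.cos (t * s)) := by
    rw [binetTerm]
    refine setIntegral_congr_fun measurableSet_Ioi (fun t _ => ?_)
    rw [integral_const_mul, integral_exp_mul_cos hz]
    simp [ha]
  rw [h1, integral_integral_swap]
  · refine setIntegral_congr_fun measurableSet_Ioi (fun s _ => ?_)
    have := integral_exp_mul_cos (w := (a : ℂ)) (by simpa using ha0) s
    calc _ = ∫ t in Set.Ioi (0 : ℝ), Complex.exp (-z * s) *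
          (Complex.exp (-(a : ℂ) * t) * Complex.cos (s * t)) := by
          congr 1 with t
          rw [mul_comm (t : ℂ) s]; ring
      _ = _ := by rw [integral_const_mul, this]; push_cast; rfl
  · have hi : Integrable (fun p : ℝ × ℝ => Real.exp (-a * p.1) * (2 * Real.exp (-z.re * p.2)))
        ((volume.restrict (Set.Ioi 0)).prod (volume.restrict (Set.Ioi 0))) :=
      Integrable.mul_prod (integrableOn_exp_neg_mul ha0) ((integrableOn_exp_neg_mul hz).const_mul 2)
    refine hi.mono' ?_ (ae_of_all _ ?_)
    · refine Continuous.aestronglyMeasurable ?_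
      unfold Function.uncurry
      fun_prop
    · rintro ⟨t, s⟩
      simp only [Function.uncurry]
      rw [norm_mul, norm_mul, norm_exp_neg_mul, norm_exp_neg_mul, Complex.ofReal_re,
        mul_comm 2 (Real.exp _)]
      gcongr
      rw [← Complex.ofReal_mul, ← Complex.ofReal_cos, Complex.norm_real, Real.norm_eq_abs]
      exact (Real.abs_cos_le_one _).trans (by norm_num)

/-- The kernel `∑ 2 / (s² + 4π²n²)` of Binet's first formula. -/
def binetKernel (s : ℝ) : ℝ := ∑' n : ℕ, 2 / (s ^ 2 + (2 * Real.pi * ((n : ℝ) + 1)) ^ 2)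

theorem binetKernel_term_le (s : ℝ) (n : ℕ) :
    2 / (s ^ 2 + (2 * Real.pi * ((n : ℝ) + 1)) ^ 2) ≤ 1 / ((n : ℝ) + 1) ^ 2 := by
  have hpi := Real.pi_gt_three
  rw [div_le_div_iff₀ (by positivity) (by positivity)]
  have : (2 : ℝ) ≤ (2 * Real.pi) ^ 2 := by nlinarith
  nlinarith [sq_nonneg s, mul_le_mul_of_nonneg_right this (sq_nonneg ((n : ℝ) + 1))]

theorem binetKernel_term_nonneg (s : ℝ) (n : ℕ) :
    0 ≤ 2 / (s ^ 2 + (2 * Real.pi * ((n : ℝ) + 1)) ^ 2) := by positivity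

theorem summable_binetKernel (s : ℝ) :
    Summable fun n : ℕ => 2 / (s ^ 2 + (2 * Real.pi * ((n : ℝ) + 1)) ^ 2) :=
  Summable.of_nonneg_of_le (binetKernel_term_nonneg s) (binetKernel_term_le s) summable_inv_succ_sq

theorem binetKernel_nonneg (s : ℝ) : 0 ≤ binetKernel s := tsum_nonneg (binetKernel_term_nonneg s)

theorem binetKernel_le (s : ℝ) : binetKernel s ≤ ∑' n : ℕ, 1 / ((n : ℝ) + 1) ^ 2 :=
  (summable_binetKernel s).tsum_le_tsum (binetKernel_term_le s) summable_inv_succ_sq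

theorem measurable_binetKernel : Measurable binetKernel :=
  Measurable.tsum (L := SummationFilter.unconditional ℕ) (fun n => by fun_prop)

theorem integrableOn_laplace {z : ℂ} (hz : 0 < z.re) {f : ℝ → ℝ} (hf : Measurable f) {C : ℝ}
    (h : ∀ s, |f s| ≤ C) :
    IntegrableOn (fun s : ℝ => Complex.exp (-z * s) * (f s : ℂ)) (Set.Ioi 0) := by
  refine ((integrableOn_exp_neg_mul hz).mul_const C).mono' ?_ (ae_of_all _ fun s => ?_)
  · refine Measurable.aestronglyMeasurable ?_
    fun_prop
  · rw [norm_mul, norm_exp_neg_mul, Complex.norm_real, Real.norm_eq_abs]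
    gcongr
    exact h s

theorem norm_integral_laplace_le {z : ℂ} (hz : 0 < z.re) {f : ℝ → ℝ} {C : ℝ}
    (h : ∀ s, |f s| ≤ C) :
    ‖∫ s in Set.Ioi (0 : ℝ), Complex.exp (-z * s) * (f s : ℂ)‖ ≤ C / z.re := by
  refine (norm_integral_le_of_norm_le ((integrableOn_exp_neg_mul hz).mul_const C)
    (ae_of_all _ fun s => ?_)).trans (le_of_eq ?_)
  · rw [norm_mul, norm_exp_neg_mul, Complex.norm_real, Real.norm_eq_abs]
    gcongr
    exact h s
  · rw [integral_mul_const, integral_exp_neg_mul hz]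
    ring

/-- In this form, available for Re z > 0 only, the shift z ↦ z + 1 multiplies the integrand by
e^{−s}. -/
theorem binet_eq_laplace {z : ℂ} (hz : 0 < z.re) :
    binet z = ∫ s in Set.Ioi (0 : ℝ), Complex.exp (-z * s) * (binetKernel s : ℂ) := by
  have hpi : (Real.pi : ℂ) ≠ 0 := by exact_mod_cast Real.pi_ne_zero
  have habs : ∀ (n : ℕ) (s : ℝ), |2 / (s ^ 2 + (2 * Real.pi * ((n : ℝ) + 1)) ^ 2)|
      ≤ 1 / ((n : ℝ) + 1) ^ 2 := fun n s => by
    rw [abs_of_nonneg (binetKernel_term_nonneg s n)]; exact binetKernel_term_le s n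
  have hint : ∀ n : ℕ, IntegrableOn (fun s : ℝ => Complex.exp (-z * s) *
      ((2 / (s ^ 2 + (2 * Real.pi * ((n : ℝ) + 1)) ^ 2) : ℝ) : ℂ)) (Set.Ioi 0) := fun n =>
    integrableOn_laplace hz (by fun_prop) (habs n)
  have key := integral_tsum_of_summable_integral_norm hint
    (Summable.of_nonneg_of_le (fun n => integral_nonneg fun y => norm_nonneg _) (fun n => ?_)
      (summable_inv_succ_sq.mul_left (1 / z.re)))
  · have hterm : ∀ n : ℕ, 1 / ((Real.pi : ℂ) * ((n : ℂ) + 1)) * binetTerm z n =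
        ∫ s in Set.Ioi (0 : ℝ), Complex.exp (-z * s) *
          ((2 / (s ^ 2 + (2 * Real.pi * ((n : ℝ) + 1)) ^ 2) : ℝ) : ℂ) := by
      intro n
      have h2 : ((n : ℂ) + 1) ≠ 0 := by exact_mod_cast Nat.succ_ne_zero n
      rw [binetTerm_eq_laplace hz, ← integral_const_mul]
      congr 1 with s
      push_cast
      field_simp
    rw [binet, tsum_congr hterm, key]
    congr 1 with s
    rw [tsum_mul_left, binetKernel, Complex.ofReal_tsum]
  · refine (integral_mono_ae (hint n).norm
      ((integrableOn_exp_neg_mul hz).mul_const (1 / ((n : ℝ) + 1) ^ 2))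
      (ae_of_all _ fun s => ?_)).trans (le_of_eq ?_)
    · simp only
      rw [norm_mul, norm_exp_neg_mul, Complex.norm_real, Real.norm_eq_abs]
      gcongr
      exact habs n s
    · rw [integral_mul_const, integral_exp_neg_mul hz]

/-- The partial fraction expansion of π cot πx on the imaginary axis. The factor 1 − e^{−s} is the
one produced by the shift z ↦ z + 1. -/
theorem binetKernel_mul {s : ℝ} (hs : 0 < s) :
    (1 - Real.exp (-s)) * binetKernel s
      = (1 + Real.exp (-s)) / (2 * s) - (1 - Real.exp (-s)) / s ^ 2 := by
  have hpi : (Real.pi : ℂ) ≠ 0 := by exact_mod_cast Real.pi_ne_zero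
  have hs0 : (s : ℂ) ≠ 0 := by exact_mod_cast hs.ne'
  -- At x = is/2π the denominators become x² − n² = −(s² + 4π²n²)/4π².
  set x : ℂ := (s : ℂ) / (2 * Real.pi) * Complex.I with hx
  have him : x.im = s / (2 * Real.pi) := by
    have : x = ((s / (2 * Real.pi) : ℝ) : ℂ) * Complex.I := by rw [hx]; push_cast; rfl
    rw [this, Complex.im_ofReal_mul, Complex.I_im, mul_one]
  have hxZ : x ∈ Complex.integerComplement := by
    rintro ⟨m, hm⟩
    have h0 : x.im ≠ 0 := by rw [him]; positivity
    exact h0 (by rw [← hm]; simp)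
  clear_value x
  have key := cot_series_rep' hxZ
  have hterm : ∀ n : ℕ, 1 / (x - ((n : ℂ) + 1)) + 1 / (x + ((n : ℂ) + 1)) =
      -(2 * Real.pi * s * Complex.I) *
        ((2 / (s ^ 2 + (2 * Real.pi * ((n : ℝ) + 1)) ^ 2) : ℝ) : ℂ) := by
    intro n
    have h1 : x - ((n : ℂ) + 1) ≠ 0 := fun h => hxZ ⟨(n + 1 : ℤ), by push_cast; linear_combination -h⟩
    have h2 : x + ((n : ℂ) + 1) ≠ 0 := fun h => hxZ ⟨-(n + 1 : ℤ), by push_cast; linear_combination -h⟩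
    have h3 : ((s : ℂ) ^ 2 + (2 * Real.pi * ((n : ℂ) + 1)) ^ 2) ≠ 0 := by
      have : (0 : ℝ) < s ^ 2 + (2 * Real.pi * ((n : ℝ) + 1)) ^ 2 := by positivity
      exact_mod_cast this.ne'
    have h4 : (x - ((n : ℂ) + 1)) * (x + ((n : ℂ) + 1)) * (4 * Real.pi ^ 2)
        = -((s : ℂ) ^ 2 + (2 * Real.pi * ((n : ℂ) + 1)) ^ 2) := by
      rw [hx]
      field_simp
      linear_combination 4 * (s : ℂ) ^ 2 * Complex.I_sq
    push_cast
    rw [div_add_div _ _ h1 h2, mul_div_assoc', div_eq_div_iff (mul_ne_zero h1 h2) h3]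
    have h5 : x * (2 * Real.pi) = s * Complex.I := by rw [hx]; field_simp
    linear_combination (2 * x) * h4 - (4 * Real.pi) *
      ((x - ((n : ℂ) + 1)) * (x + ((n : ℂ) + 1))) * h5
  rw [tsum_congr hterm, tsum_mul_left, ← Complex.ofReal_tsum] at key
  change _ = _ * (binetKernel s : ℂ) at key
  have hE : Complex.exp (-(s : ℂ)) - 1 ≠ 0 := by
    have : Real.exp (-s) < 1 := by rw [Real.exp_lt_one_iff]; linarith
    have h : Real.exp (-s) - 1 ≠ 0 := by linarith
    rw [← Complex.ofReal_neg, ← Complex.ofReal_exp]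
    exact_mod_cast h
  have hcot : Complex.cot (Real.pi * x) =
      Complex.I * (Complex.exp (-(s : ℂ)) + 1) / (Complex.exp (-(s : ℂ)) - 1) := by
    rw [Complex.cot_eq_exp_ratio]
    have : 2 * Complex.I * (Real.pi * x) = -(s : ℂ) := by
      rw [hx]; field_simp; linear_combination Complex.I_sq
    rw [this, div_eq_div_iff]
    · linear_combination (-(Complex.exp (-(s : ℂ)) + 1) * (1 - Complex.exp (-(s : ℂ)))) * Complex.I_sq
    · refine mul_ne_zero Complex.I_ne_zero ?_
      rw [← neg_ne_zero, neg_sub]; exact hE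
    · exact hE
  rw [hcot] at key
  have hfin : (1 - Complex.exp (-(s : ℂ))) * (binetKernel s : ℂ)
      = (1 + Complex.exp (-(s : ℂ))) / (2 * s) - (1 - Complex.exp (-(s : ℂ))) / s ^ 2 := by
    have hI := Complex.I_ne_zero
    have hxI : 1 / x = -(2 * Real.pi / s) * Complex.I := by
      rw [hx]; field_simp; linear_combination Complex.I_sq
    rw [hxI] at key
    have h6 : (2 * Real.pi * s * Complex.I) ≠ 0 := by
      simp [hpi, hs0]
    apply mul_left_cancel₀ h6
    have := congrArg (fun w => (Complex.exp (-(s : ℂ)) - 1) * w) key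
    field_simp at this ⊢
    linear_combination -this
  have := hfin
  rw [← Complex.ofReal_neg, ← Complex.ofReal_exp] at this
  exact_mod_cast this

/-- The right-hand side is that of `binetKernel_mul`: the kernel times 1 − e^{−s} is the Laplace
transform of one period of the sawtooth 1/2 − u. -/
theorem integral_sawtooth_mul_exp {s : ℝ} (hs : 0 < s) :
    ∫ u in (0 : ℝ)..1, (1 / 2 - u) * Real.exp (-s * u)
      = (1 + Real.exp (-s)) / (2 * s) - (1 - Real.exp (-s)) / s ^ 2 := by
  have hd : ∀ u ∈ Set.uIcc (0 : ℝ) 1, HasDerivAt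
      (fun u => (-(1 / 2 - u) / s + 1 / s ^ 2) * Real.exp (-s * u))
      ((1 / 2 - u) * Real.exp (-s * u)) u := by
    intro u _
    have h1 : HasDerivAt (fun u : ℝ => -(1 / 2 - u) / s + 1 / s ^ 2) (1 / s) u := by
      have := ((((hasDerivAt_id u).const_sub (1 / 2)).neg).div_const s).add_const (1 / s ^ 2)
      simpa using this
    have h2 : HasDerivAt (fun u : ℝ => Real.exp (-s * u)) (Real.exp (-s * u) * (-s)) u := by
      have := ((hasDerivAt_id u).const_mul (-s)).exp
      simpa using this
    refine (h1.mul h2).congr_deriv ?_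
    field_simp
    ring
  rw [intervalIntegral.integral_eq_sub_of_hasDerivAt hd (Continuous.intervalIntegrable (by fun_prop) _ _)]
  simp only [mul_one, mul_zero, Real.exp_zero]
  field_simp
  ring

theorem integral_sawtooth_div {z : ℂ} (hz : 0 < z.re) :
    ∫ u in (0 : ℝ)..1, ((1 / 2 - u : ℝ) : ℂ) * (1 / (z + u))
      = (z + 1 / 2) * (Complex.log (z + 1) - Complex.log z) - 1 := by
  have hre : ∀ u ∈ Set.uIcc (0 : ℝ) 1, 0 < (z + (u : ℂ)).re := by
    intro u hu
    rw [Set.uIcc_of_le zero_le_one] at hu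
    simp only [Complex.add_re, Complex.ofReal_re]
    linarith [hu.1]
  have hne : ∀ u ∈ Set.uIcc (0 : ℝ) 1, z + (u : ℂ) ≠ 0 := fun u hu h => by
    have := hre u hu
    rw [h] at this
    simp at this
  have hd : ∀ u ∈ Set.uIcc (0 : ℝ) 1, HasDerivAt
      (fun u : ℝ => (z + 1 / 2) * Complex.log (z + u) - u)
      (((1 / 2 - u : ℝ) : ℂ) * (1 / (z + u))) u := by
    intro u hu
    have h1 : HasDerivAt (fun u : ℝ => z + (u : ℂ)) 1 u := by
      simpa using (Complex.ofRealCLM.hasDerivAt (x := u)).const_add z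
    have h2 := (h1.clog_real (Or.inl (hre u hu))).const_mul (z + 1 / 2)
    have h3 : HasDerivAt (fun u : ℝ => (u : ℂ)) 1 u := by
      exact Complex.ofRealCLM.hasDerivAt (x := u)
    refine (h2.sub h3).congr_deriv ?_
    have := hne u hu
    push_cast
    field_simp
    ring
  have hc : ContinuousOn (fun u : ℝ => ((1 / 2 - u : ℝ) : ℂ) * (1 / (z + u))) (Set.uIcc 0 1) := by
    refine ContinuousOn.mul (by fun_prop) (ContinuousOn.div (by fun_prop) (by fun_prop) hne)
  rw [intervalIntegral.integral_eq_sub_of_hasDerivAt hd hc.intervalIntegrable]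
  simp
  ring

/-- The difference is a double integral of (1/2 − u)e^{−(z+u)s}. Integrating over s first leaves ∫
(1/2 − u)/(z + u) du, which is elementary. -/
theorem binet_sub_binet_add_one {z : ℂ} (hz : 0 < z.re) :
    binet z - binet (z + 1) = (z + 1 / 2) * (Complex.log (z + 1) - Complex.log z) - 1 := by
  have hz1 : 0 < (z + 1).re := by simp; linarith
  have hK : ∀ s, |binetKernel s| ≤ ∑' n : ℕ, 1 / ((n : ℝ) + 1) ^ 2 := fun s => by
    rw [abs_of_nonneg (binetKernel_nonneg s)]; exact binetKernel_le s
  rw [binet_eq_laplace hz, binet_eq_laplace hz1,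
    ← integral_sub (integrableOn_laplace hz measurable_binetKernel hK)
      (integrableOn_laplace hz1 measurable_binetKernel hK)]
  have h1 : ∀ s ∈ Set.Ioi (0 : ℝ), Complex.exp (-z * s) * (binetKernel s : ℂ)
      - Complex.exp (-(z + 1) * s) * (binetKernel s : ℂ)
      = ∫ u in Set.Ioc (0 : ℝ) 1, Complex.exp (-z * s) * (((1 / 2 - u) * Real.exp (-s * u) : ℝ) : ℂ) := by
    intro s hs
    have h2 := binetKernel_mul hs
    rw [← integral_sawtooth_mul_exp hs, intervalIntegral.integral_of_le zero_le_one] at h2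
    rw [integral_const_mul, integral_complex_ofReal, ← h2, neg_add, add_mul, Complex.exp_add]
    push_cast
    ring_nf
  rw [setIntegral_congr_fun measurableSet_Ioi h1, integral_integral_swap]
  · rw [← integral_sawtooth_div hz, intervalIntegral.integral_of_le zero_le_one]
    refine setIntegral_congr_fun measurableSet_Ioc (fun u hu => ?_)
    have hre : (-(z + u)).re < 0 := by
      simp only [Complex.neg_re, Complex.add_re, Complex.ofReal_re]
      linarith [hu.1]
    have := integral_exp_mul_complex_Ioi hre 0
    calc _ = ∫ s in Set.Ioi (0 : ℝ), ((1 / 2 - u : ℝ) : ℂ) * Complex.exp (-(z + u) * s) := by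
          congr 1 with s
          rw [neg_add, add_mul, Complex.exp_add]
          push_cast
          rw [show -(s : ℂ) * u = -u * s by ring]
          ring
      _ = _ := by
          rw [integral_const_mul, this]
          rw [Complex.ofReal_zero, mul_zero, Complex.exp_zero, neg_div_neg_eq]
  · have hi : Integrable (fun p : ℝ × ℝ => Real.exp (-z.re * p.1) * (1 : ℝ))
        ((volume.restrict (Set.Ioi 0)).prod (volume.restrict (Set.Ioc 0 1))) :=
      Integrable.mul_prod (integrableOn_exp_neg_mul hz) (integrable_const 1)
    refine hi.mono' ?_ ?_
    · refine Continuous.aestronglyMeasurable ?_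
      unfold Function.uncurry
      fun_prop
    · rw [Measure.prod_restrict]
      refine (ae_restrict_iff' (measurableSet_Ioi.prod measurableSet_Ioc)).2 (ae_of_all _ ?_)
      rintro ⟨s, u⟩ ⟨hs, hu⟩
      simp only [Set.mem_Ioi, Set.mem_Ioc] at hs hu
      simp only [Function.uncurry]
      rw [norm_mul, norm_exp_neg_mul, Complex.norm_real, Real.norm_eq_abs, abs_mul, Real.abs_exp]
      gcongr
      have h3 : |1 / 2 - u| ≤ 1 := by rw [abs_le]; constructor <;> linarith [hu.1, hu.2]
      have h4 : Real.exp (-s * u) ≤ 1 := by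
        rw [Real.exp_le_one_iff]; nlinarith [mul_pos hs hu.1]
      exact mul_le_one₀ h3 (Real.exp_nonneg _) h4

/-- The kernel is bounded, so its Laplace transform is O(1/Re z). -/
theorem tendsto_binet_add_nat {z : ℂ} (hz : 0 < z.re) :
    Tendsto (fun n : ℕ => binet (z + n + 1)) atTop (𝓝 0) := by
  have hK : ∀ s, |binetKernel s| ≤ ∑' n : ℕ, 1 / ((n : ℝ) + 1) ^ 2 := fun s => by
    rw [abs_of_nonneg (binetKernel_nonneg s)]; exact binetKernel_le s
  refine squeeze_zero_norm (a := fun n : ℕ => (∑' n : ℕ, 1 / ((n : ℝ) + 1) ^ 2) / (z.re + n + 1))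
    (fun n => ?_) ?_
  · have h : (z + n + 1).re = z.re + n + 1 := by simp
    have hpos : 0 < (z + n + 1).re := by rw [h]; positivity
    rw [binet_eq_laplace hpos, ← h]
    exact norm_integral_laplace_le hpos hK
  · refine Tendsto.const_div_atTop ?_ _
    exact tendsto_atTop_add_const_right _ _
      (tendsto_atTop_add_const_left _ _ tendsto_natCast_atTop_atTop)

/-- The right-hand side of Binet's formula. -/
def binetLogGamma (z : ℂ) : ℂ :=
  (z - 1 / 2) * Complex.log z - z + 1 / 2 * (Real.log (2 * Real.pi) : ℂ) + binet z

theorem binetLogGamma_add_one {z : ℂ} (hz : 0 < z.re) :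
    binetLogGamma (z + 1) = binetLogGamma z + Complex.log z := by
  have := binet_sub_binet_add_one hz
  rw [binetLogGamma, binetLogGamma]
  linear_combination -this

theorem sum_log_add {z : ℂ} (hz : 0 < z.re) (n : ℕ) :
    ∑ k ∈ Finset.range n, Complex.log (z + (k : ℂ)) = binetLogGamma (z + n) - binetLogGamma z := by
  induction n with
  | zero => simp
  | succ n ih =>
    have h : 0 < (z + n).re := by simp; positivity
    rw [Finset.sum_range_succ, ih]
    have := binetLogGamma_add_one h
    push_cast
    rw [← add_assoc, this]
    ring

/-- Stirling's formula for n!; it fixes the constant ½ ln(2π), which the difference equation leaves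
open. -/
theorem tendsto_log_factorial_sub :
    Tendsto (fun n : ℕ => Real.log (Nat.factorial n) - ((n + 1 / 2) * Real.log n - n
      + 1 / 2 * Real.log (2 * Real.pi))) atTop (𝓝 0) := by
  have hpi : (0 : ℝ) < √Real.pi := Real.sqrt_pos.2 Real.pi_pos
  have h := (Real.continuousAt_log hpi.ne').tendsto.comp Stirling.tendsto_stirlingSeq_sqrt_pi
  have h' := h.sub_const (Real.log √Real.pi)
  rw [sub_self] at h'
  refine h'.congr' ?_
  filter_upwards [eventually_ge_atTop 1] with n hn
  have hn0 : (0 : ℝ) < n := by exact_mod_cast hn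
  rw [Function.comp_apply, Stirling.log_stirlingSeq_formula, Real.log_sqrt Real.pi_pos.le,
    Real.log_mul two_ne_zero hn0.ne', Real.log_div hn0.ne' (Real.exp_ne_zero _), Real.log_exp,
    Real.log_mul two_ne_zero Real.pi_ne_zero]
  ring

theorem tendsto_nat_mul_log_one_add (w : ℂ) :
    Tendsto (fun n : ℕ => (n : ℂ) * Complex.log (1 + w / n)) atTop (𝓝 w) := by
  have h : Tendsto (fun x : ℝ => (x : ℂ) * (w / x)) atTop (𝓝 w) := by
    refine tendsto_const_nhds.congr' ?_
    filter_upwards [eventually_ne_atTop 0] with x hx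
    have : (x : ℂ) ≠ 0 := by exact_mod_cast hx
    field_simp
  have := (Complex.tendsto_mul_log_one_add_of_tendsto h).comp (tendsto_natCast_atTop_atTop (R := ℝ))
  simpa [Function.comp_def] using this

theorem tendsto_log_one_add_div_nat (w : ℂ) :
    Tendsto (fun n : ℕ => Complex.log (1 + w / n)) atTop (𝓝 0) := by
  have h1 : Tendsto (fun n : ℕ => ((n : ℂ))⁻¹) atTop (𝓝 0) := tendsto_inv_atTop_nhds_zero_nat
  have := (tendsto_nat_mul_log_one_add w).mul h1
  rw [mul_zero] at this
  refine this.congr' ?_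
  filter_upwards [eventually_ne_atTop 0] with n hn
  have : (n : ℂ) ≠ 0 := by exact_mod_cast hn
  field_simp

theorem notPole_of_re_pos {z : ℂ} (hz : 0 < z.re) : NotPole z := by
  intro n h
  rw [h] at hz
  simp at hz
  linarith [n.cast_nonneg (α := ℝ)]

/-- **Binet's formula** for the principal branch of `ln Γ` in the right half-plane. -/
theorem logGamma_eq_binetLogGamma {z : ℂ} (hz : 0 < z.re) : logGamma z = binetLogGamma z := by
  have hnp := notPole_of_re_pos hz
  refine tendsto_nhds_unique (tendsto_logGamma hnp) ?_
  have h1 : Tendsto (fun n : ℕ => ((Real.log (Nat.factorial n) - ((n + 1 / 2) * Real.log n - n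
      + 1 / 2 * Real.log (2 * Real.pi)) : ℝ) : ℂ)) atTop (𝓝 0) :=
    (Complex.continuous_ofReal.tendsto' 0 0 (by simp)).comp tendsto_log_factorial_sub
  have h2 := tendsto_nat_mul_log_one_add (z + 1)
  have h3 := (tendsto_log_one_add_div_nat (z + 1)).const_mul (z + 1 / 2)
  have h4 := tendsto_binet_add_nat hz
  -- The sum of logarithms telescopes. With ln(z+n+1) = ln n + ln(1 + (z+1)/n), Gauss' expression
  -- becomes a constant plus Stirling's error, −n ln(1 + (z+1)/n) → −(z+1), and two terms that tend
  -- to 0.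
  have h5 := ((((h1.sub h2).sub h3).sub h4).const_add (z + 1 + binetLogGamma z))
  have hlim : z + 1 + binetLogGamma z + (0 - (z + 1) - (z + 1 / 2) * 0 - 0) = binetLogGamma z := by
    ring
  rw [hlim] at h5
  refine h5.congr' ?_
  filter_upwards [eventually_ge_atTop 1] with n hn
  have hn0 : (0 : ℝ) < n := by exact_mod_cast hn
  have hnC : (n : ℂ) ≠ 0 := by exact_mod_cast hn0.ne'
  have hne : 1 + (z + 1) / n ≠ 0 := by
    intro h
    have h6 : z + n + 1 = 0 := by field_simp at h; linear_combination h
    have := congrArg Complex.re h6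
    simp at this
    linarith
  have hlog : Complex.log (z + n + 1) = Complex.log (1 + (z + 1) / n) + (Real.log n : ℂ) := by
    rw [add_comm (Complex.log _), ← Complex.log_ofReal_mul hn0 hne]
    congr 1
    push_cast
    field_simp
    ring
  rw [sum_log_add hz]
  push_cast
  simp only [← add_assoc, binetLogGamma]
  rw [hlog]
  push_cast
  ring

/-! ### Points of the Riemann surface -/

theorem pt_re (r θ : ℝ) : (pt r θ).re = r * Real.cos θ := by
  rw [pt, Complex.re_ofReal_mul, Complex.exp_ofReal_mul_I_re]

theorem pt_im (r θ : ℝ) : (pt r θ).im = r * Real.sin θ := by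
  rw [pt, Complex.im_ofReal_mul, Complex.exp_ofReal_mul_I_im]

theorem norm_pt {r : ℝ} (hr : 0 < r) (θ : ℝ) : ‖pt r θ‖ = r := by
  rw [pt, norm_mul, Complex.norm_exp_ofReal_mul_I, mul_one, Complex.norm_real,
    Real.norm_of_nonneg hr.le]

theorem pt_ne_zero {r : ℝ} (hr : 0 < r) (θ : ℝ) : pt r θ ≠ 0 := by
  rw [← norm_pos_iff, norm_pt hr]; exact hr

theorem continuous_pt (r : ℝ) : Continuous (pt r) := by
  unfold pt; fun_prop

theorem pt_neg (r θ : ℝ) : pt r (-θ) = (starRingEnd ℂ) (pt r θ) := by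
  apply Complex.ext
  · rw [pt_re, Complex.conj_re, pt_re, Real.cos_neg]
  · rw [pt_im, Complex.conj_im, pt_im, Real.sin_neg, mul_neg]

theorem pt_sub_pi (r θ : ℝ) : pt r (θ - Real.pi) = -pt r θ := by
  apply Complex.ext
  · rw [pt_re, Complex.neg_re, pt_re, Real.cos_sub_pi, mul_neg]
  · rw [pt_im, Complex.neg_im, pt_im, Real.sin_sub_pi, mul_neg]

theorem pt_add_pi (r θ : ℝ) : pt r (θ + Real.pi) = -pt r θ := by
  apply Complex.ext
  · rw [pt_re, Complex.neg_re, pt_re, Real.cos_add_pi, mul_neg]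
  · rw [pt_im, Complex.neg_im, pt_im, Real.sin_add_pi, mul_neg]

theorem log_pt {r θ : ℝ} (hr : 0 < r) (h1 : -Real.pi < θ) (h2 : θ ≤ Real.pi) :
    Complex.log (pt r θ) = lnPt r θ := by
  rw [pt, Complex.log_ofReal_mul hr (Complex.exp_ne_zero _), Complex.log_exp, lnPt]
  · simpa using h1
  · simpa using h2

theorem exp_lnPt {r : ℝ} (hr : 0 < r) (θ : ℝ) : Complex.exp (lnPt r θ) = pt r θ := by
  rw [lnPt, Complex.exp_add, ← Complex.ofReal_exp, Real.exp_log hr, pt]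

theorem lnPt_neg (r θ : ℝ) : lnPt r (-θ) = (starRingEnd ℂ) (lnPt r θ) := by
  simp [lnPt]

theorem lnPt_sub (r θ c : ℝ) : lnPt r (θ - c) = lnPt r θ - c * Complex.I := by
  simp [lnPt]; ring

theorem continuous_lnPt (r : ℝ) : Continuous (lnPt r) := by
  unfold lnPt; fun_prop

theorem leading_neg (r θ : ℝ) : leading r (-θ) = (starRingEnd ℂ) (leading r θ) := by
  simp [leading, lnPt_neg, pt_neg, Complex.conj_ofReal, map_ofNat]

theorem continuous_leading (r : ℝ) : Continuous (leading r) := by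
  have := continuous_pt r
  have := continuous_lnPt r
  unfold leading; fun_prop

theorem binetLogGamma_pt {r θ : ℝ} (hr : 0 < r) (h1 : -Real.pi < θ) (h2 : θ ≤ Real.pi) :
    binetLogGamma (pt r θ) = leading r θ + binet (pt r θ) := by
  rw [binetLogGamma, log_pt hr h1 h2, leading]

/-- The terms z ln z cancel, so the exponential of this sum is elementary and can be compared with
Γ(z)Γ(−z). -/
theorem leading_add_leading_sub_pi (r θ : ℝ) :
    leading r θ + leading r (θ - Real.pi) = -lnPt r θ + Real.pi * Complex.I * pt r θ
      + Real.pi * Complex.I / 2 + (Real.log (2 * Real.pi) : ℂ) := by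
  rw [leading, leading, lnPt_sub, pt_sub_pi]
  ring

theorem integral_conj' {f g : ℝ → ℂ} {s : Set ℝ} (h : ∀ x, g x = (starRingEnd ℂ) (f x)) :
    ∫ x in s, g x = (starRingEnd ℂ) (∫ x in s, f x) := by
  rw [← integral_conj]
  exact integral_congr_ae (ae_of_all _ h)

theorem binetTerm_conj (z : ℂ) (n : ℕ) :
    binetTerm ((starRingEnd ℂ) z) n = (starRingEnd ℂ) (binetTerm z n) := by
  refine integral_conj' fun t => ?_
  simp [Complex.conj_ofReal, -Complex.ofReal_exp]

/-- Conjugation transfers statements from θ to −θ, that is, from the upper to the lower signs. -/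
theorem binet_conj (z : ℂ) : binet ((starRingEnd ℂ) z) = (starRingEnd ℂ) (binet z) := by
  rw [binet, binet, Complex.conj_tsum]
  refine tsum_congr fun n => ?_
  rw [binetTerm_conj]
  simp [Complex.conj_ofReal]

/-! ### Continuity of the principal branch of `ln Γ` -/

/-- The tail of the series converges uniformly on a ball around 0 and is continuous there, so only
finitely many logarithms matter. The set s is left free to cover both the slit plane and the
approach to the negative axis from above. -/
theorem continuousWithinAt_logGamma {s : Set ℂ} {z : ℂ} (h0 : ContinuousWithinAt Complex.log s z)
    (h : ∀ n : ℕ, ContinuousWithinAt (fun w => Complex.log (1 + w / ((n : ℂ) + 1))) s z) :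
    ContinuousWithinAt logGamma s z := by
  set R : ℝ := ‖z‖ + 1 with hR
  set N : ℕ := ⌈2 * R⌉₊ with hN
  have hsplit : logGamma = fun w => -(Real.eulerMascheroniConstant : ℂ) * w - Complex.log w
      + (∑ n ∈ Finset.range N, (w / ((n : ℂ) + 1) - Complex.log (1 + w / ((n : ℂ) + 1)))
        + ∑' n : ℕ, (w / (((n + N : ℕ) : ℂ) + 1) - Complex.log (1 + w / (((n + N : ℕ) : ℂ) + 1)))) := by
    funext w
    rw [logGamma, (summable_logGamma_term w).sum_add_tsum_nat_add N]
  have htail : ContinuousOn (fun w : ℂ => ∑' n : ℕ, (w / (((n + N : ℕ) : ℂ) + 1)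
      - Complex.log (1 + w / (((n + N : ℕ) : ℂ) + 1)))) (Metric.ball 0 R) := by
    have hsum : Summable fun n : ℕ => R ^ 2 * (1 / (((n + N : ℕ) : ℝ) + 1) ^ 2) :=
      (summable_nat_add_iff N).2 (summable_inv_succ_sq.mul_left (R ^ 2))
    have hnR : ∀ n : ℕ, 2 * R ≤ ((n + N : ℕ) : ℝ) := fun n => by
      have := Nat.le_ceil (2 * R)
      push_cast
      linarith [n.cast_nonneg (α := ℝ)]
    refine continuousOn_tsum (fun n => ?_) hsum (fun n w hw => ?_)
    · refine ContinuousOn.sub (by fun_prop) (ContinuousOn.clog (by fun_prop) fun w hw => ?_)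
      apply Complex.mem_slitPlane_of_norm_lt_one
      rw [norm_div_succ, div_lt_one (by positivity)]
      rw [mem_ball_zero_iff] at hw
      have := hnR n
      have := norm_nonneg w
      linarith
    · rw [mem_ball_zero_iff] at hw
      exact norm_logGamma_term_le hw.le (hnR n)
  have hz : z ∈ Metric.ball (0 : ℂ) R := by rw [mem_ball_zero_iff]; linarith
  have htail' := (htail.continuousAt (Metric.isOpen_ball.mem_nhds hz)).continuousWithinAt (s := s)
  rw [hsplit]
  refine ContinuousWithinAt.add (ContinuousWithinAt.sub (by fun_prop) h0)
    (ContinuousWithinAt.add ?_ htail')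
  exact tendsto_finsetSum _ fun n _ =>
    ContinuousWithinAt.sub (f := fun w => w / ((n : ℂ) + 1)) (by fun_prop) (h n)

theorem one_add_div_succ_mem_slitPlane {z : ℂ} (hz : z ∈ Complex.slitPlane) (n : ℕ) :
    1 + z / ((n : ℂ) + 1) ∈ Complex.slitPlane := by
  have h : z / ((n : ℂ) + 1) = ((((n : ℝ) + 1)⁻¹ : ℝ) : ℂ) * z := by
    push_cast; rw [div_eq_mul_inv, mul_comm]
  rw [Complex.mem_slitPlane_iff] at hz ⊢
  rw [h, Complex.add_re, Complex.add_im, Complex.re_ofReal_mul, Complex.im_ofReal_mul]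
  rcases hz with hz | hz
  · left
    have : 0 < ((n : ℝ) + 1)⁻¹ * z.re := by positivity
    simpa using by linarith
  · right
    have : ((n : ℝ) + 1)⁻¹ * z.im ≠ 0 := mul_ne_zero (by positivity) hz
    simpa using this

theorem continuousAt_logGamma {z : ℂ} (hz : z ∈ Complex.slitPlane) : ContinuousAt logGamma z := by
  rw [← continuousWithinAt_univ]
  refine continuousWithinAt_logGamma (continuousAt_clog hz).continuousWithinAt fun n => ?_
  exact ContinuousWithinAt.clog (by fun_prop) (one_add_div_succ_mem_slitPlane hz n)

theorem continuousWithinAt_clog_im_nonneg {w : ℂ} (hw0 : w ≠ 0) :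
    ContinuousWithinAt Complex.log {w | 0 ≤ w.im} w := by
  by_cases h : w ∈ Complex.slitPlane
  · exact (continuousAt_clog h).continuousWithinAt
  · rw [Complex.mem_slitPlane_iff, not_or, not_lt, not_not] at h
    refine Complex.continuousWithinAt_log_of_re_neg_of_im_zero (lt_of_le_of_ne h.1 fun h0 => ?_) h.2
    exact hw0 (Complex.ext h0 h.2)

theorem continuousWithinAt_logGamma_im_nonneg {z : ℂ} (hnp : NotPole z) :
    ContinuousWithinAt logGamma {w | 0 ≤ w.im} z := by
  refine continuousWithinAt_logGamma (continuousWithinAt_clog_im_nonneg hnp.ne_zero) fun n => ?_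
  have him : ∀ w : ℂ, 0 ≤ w.im → 0 ≤ (1 + w / ((n : ℂ) + 1)).im := by
    intro w hw
    have h : w / ((n : ℂ) + 1) = ((((n : ℝ) + 1)⁻¹ : ℝ) : ℂ) * w := by
      push_cast; rw [div_eq_mul_inv, mul_comm]
    rw [h, Complex.add_im, Complex.im_ofReal_mul, Complex.one_im, zero_add]
    positivity
  refine ContinuousWithinAt.comp (f := fun w : ℂ => 1 + w / ((n : ℂ) + 1)) (t := {w | 0 ≤ w.im})
    (continuousWithinAt_clog_im_nonneg (one_add_div_succ_ne_zero hnp n)) (by fun_prop) ?_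
  exact fun w hw => him w hw

theorem logGamma_conj {z : ℂ} (hz : z ∈ Complex.slitPlane) :
    logGamma ((starRingEnd ℂ) z) = (starRingEnd ℂ) (logGamma z) := by
  have hlog : ∀ w ∈ Complex.slitPlane,
      Complex.log ((starRingEnd ℂ) w) = (starRingEnd ℂ) (Complex.log w) := fun w hw =>
    Complex.log_conj w (Complex.slitPlane_arg_ne_pi hw)
  rw [logGamma, logGamma, map_add, Complex.conj_tsum, map_sub, hlog z hz]
  congr 1
  · simp
  · refine tsum_congr fun n => ?_
    rw [map_sub, ← hlog _ (one_add_div_succ_mem_slitPlane hz n)]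
    simp

/-! ### The reflection formula for the principal branch -/

/-- The closed unit disc touches the line Re = 1 only at 1. So 1 − e^w stays away from the cut of
the principal logarithm. -/
theorem one_sub_exp_re_pos {w : ℂ} (h1 : w.re ≤ 0) (h2 : Complex.exp w ≠ 1) :
    0 < (1 - Complex.exp w).re := by
  have hn : ‖Complex.exp w‖ ≤ 1 := by rw [Complex.norm_exp]; exact Real.exp_le_one_iff.2 h1
  have hre := Complex.re_le_norm (Complex.exp w)
  rw [Complex.sub_re, Complex.one_re, sub_pos]
  refine lt_of_le_of_ne (hre.trans hn) fun h => h2 ?_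
  have hsq := Complex.sq_norm (Complex.exp w)
  rw [Complex.normSq_apply, h] at hsq
  have h0 : (Complex.exp w).im = 0 := by
    have : ‖Complex.exp w‖ ^ 2 ≤ 1 := pow_le_one₀ (norm_nonneg _) hn
    have : (Complex.exp w).im * (Complex.exp w).im ≤ 0 := by linarith
    exact mul_self_eq_zero.1 (le_antisymm this (mul_self_nonneg _))
  exact Complex.ext h h0

/-- `z` is not an integer. -/
theorem exp_two_pi_mul_I_ne_one {z : ℂ} (h1 : NotPole z) (h2 : NotPole (-z)) :
    Complex.exp (2 * Complex.I * Real.pi * z) ≠ 1 := by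
  intro h
  rw [Complex.exp_eq_one_iff] at h
  obtain ⟨m, hm⟩ := h
  have hz : z = m := by
    have h2 : (2 * Complex.I * Real.pi : ℂ) ≠ 0 := by
      simp [Real.pi_ne_zero]
    apply mul_left_cancel₀ h2
    rw [hm]; ring
  obtain ⟨k, rfl | rfl⟩ := m.eq_nat_or_neg
  · exact h2 k (by rw [hz]; simp)
  · exact h1 k (by rw [hz]; simp)

theorem Gamma_mul_Gamma_neg {z : ℂ} (h1 : NotPole z) (h2 : NotPole (-z)) :
    Complex.Gamma z * Complex.Gamma (-z) * (1 - Complex.exp (2 * Complex.I * Real.pi * z)) =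
      2 * Real.pi * Complex.I * Complex.exp (Real.pi * Complex.I * z) / z := by
  have hz := h1.ne_zero
  have hE := exp_two_pi_mul_I_ne_one h1 h2
  have key := Complex.Gamma_mul_Gamma_one_sub z
  rw [sub_eq_add_neg, add_comm, Complex.Gamma_add_one _ (neg_ne_zero.2 hz), Complex.sin] at key
  set e := Complex.exp (Real.pi * Complex.I * z) with he
  have he0 : e ≠ 0 := Complex.exp_ne_zero _
  have h3 : Complex.exp (2 * Complex.I * Real.pi * z) = e ^ 2 := by
    rw [he, ← Complex.exp_nat_mul]; congr 1; push_cast; ring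
  have h4 : Complex.exp (-(Real.pi * z) * Complex.I) = e⁻¹ := by
    rw [he, ← Complex.exp_neg]; congr 1; ring
  have h5 : Complex.exp (Real.pi * z * Complex.I) = e := by
    rw [he]; congr 1; ring
  rw [h3] at hE ⊢
  rw [h4, h5] at key
  have h6 : 1 - e ^ 2 ≠ 0 := sub_ne_zero.2 (Ne.symm hE)
  have h7 : e⁻¹ - e ≠ 0 := by
    intro h; apply h6; field_simp at h; simpa using h
  have hI := Complex.I_ne_zero
  field_simp at key ⊢
  have := key
  apply mul_left_cancel₀ hI
  linear_combination (-1) * key - 2 * Real.pi * e * Complex.I_sq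

theorem notPole_neg {z : ℂ} (hz : z.re ≤ 0) (hz0 : z ≠ 0) : NotPole (-z) := by
  intro n h
  have h1 : z = n := neg_injective h
  rw [h1, Complex.natCast_re] at hz
  apply hz0
  have : n = 0 := by exact_mod_cast le_antisymm hz n.cast_nonneg
  rw [h1, this, Nat.cast_zero]

theorem notPole_of_im_ne_zero {z : ℂ} (hz : z.im ≠ 0) : NotPole z := by
  rintro n rfl
  simp at hz

/-- A continuous function on an interval with values in the discrete set 2πiℤ is constant. -/
theorem eqOn_of_exp_eq_one {D : ℝ → ℂ} {a b : ℝ} (hab : a ≤ b) (hD : ContinuousOn D (Set.Icc a b))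
    (h : ∀ x ∈ Set.Icc a b, Complex.exp (D x) = 1) : D a = D b := by
  have hT : DiscreteTopology (Set.range ((↑) : ℤ → ℝ)) :=
    (Int.isClosedEmbedding_coe_real.isEmbedding.toHomeomorph).symm.isEmbedding.discreteTopology
  have hval : ∀ x ∈ Set.Icc a b, ∃ n : ℤ, D x = n * (2 * Real.pi * Complex.I) := fun x hx =>
    Complex.exp_eq_one_iff.1 (h x hx)
  have him : ∀ (n : ℤ), ((n : ℂ) * (2 * Real.pi * Complex.I)).im / (2 * Real.pi) = n := by
    intro n
    have : (n : ℂ) * (2 * Real.pi * Complex.I) = ((n * (2 * Real.pi) : ℝ) : ℂ) * Complex.I := by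
      push_cast; ring
    rw [this, Complex.im_ofReal_mul, Complex.I_im, mul_one]
    field_simp
  have hc : ContinuousOn (fun x => (D x).im / (2 * Real.pi)) (Set.Icc a b) :=
    (Complex.continuous_im.comp_continuousOn hD).div_const _
  have := isPreconnected_Icc.constant_of_mapsTo (T := Set.range ((↑) : ℤ → ℝ)) ⟨hT⟩ hc
    (fun x hx => by
      obtain ⟨n, hn⟩ := hval x hx
      exact ⟨n, by simp only [hn, him]⟩)
    (Set.left_mem_Icc.2 hab) (Set.right_mem_Icc.2 hab)
  obtain ⟨m, hm⟩ := hval a (Set.left_mem_Icc.2 hab)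
  obtain ⟨n, hn⟩ := hval b (Set.right_mem_Icc.2 hab)
  simp only [hm, hn, him] at this
  rw [hm, hn]
  congr 1
  exact_mod_cast this

theorem exp_leading_add_leading_sub_pi {r : ℝ} (hr : 0 < r) (θ : ℝ) :
    Complex.exp (leading r θ + leading r (θ - Real.pi)) =
      2 * Real.pi * Complex.I * Complex.exp (Real.pi * Complex.I * pt r θ) / pt r θ := by
  have hpi : (0 : ℝ) < 2 * Real.pi := by positivity
  rw [leading_add_leading_sub_pi, Complex.exp_add, Complex.exp_add, Complex.exp_add,
    Complex.exp_neg, exp_lnPt hr, ← Complex.ofReal_exp, Real.exp_log hpi,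
    show (Real.pi : ℂ) * Complex.I / 2 = Real.pi / 2 * Complex.I by ring, Complex.exp_pi_div_two_mul_I]
  push_cast
  field_simp

theorem notPole_pt_of_mem {r θ₀ : ℝ} (hr : 0 < r) (h2 : θ₀ ≤ Real.pi) (hnp : NotPole (pt r θ₀))
    {θ : ℝ} (hθ : θ ∈ Set.Icc (Real.pi / 2) θ₀) : NotPole (pt r θ) := by
  rcases hθ.2.eq_or_lt with rfl | h
  · exact hnp
  · refine notPole_of_im_ne_zero ?_
    rw [pt_im]
    have := Real.sin_pos_of_pos_of_lt_pi (by linarith [hθ.1, Real.pi_pos]) (h.trans_le h2)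
    positivity

theorem pt_re_nonpos {r θ : ℝ} (hr : 0 < r) (h1 : Real.pi / 2 ≤ θ) (h2 : θ ≤ Real.pi) :
    (pt r θ).re ≤ 0 := by
  rw [pt_re]
  have := Real.cos_nonpos_of_pi_div_two_le_of_le h1 (by linarith)
  nlinarith

theorem pt_im_nonneg {r θ : ℝ} (hr : 0 < r) (h1 : 0 ≤ θ) (h2 : θ ≤ Real.pi) :
    0 ≤ (pt r θ).im := by
  rw [pt_im]
  exact mul_nonneg hr.le (Real.sin_nonneg_of_nonneg_of_le_pi h1 h2)

theorem two_I_pi_mul_re (z : ℂ) : (2 * Complex.I * Real.pi * z).re = -(2 * Real.pi * z.im) := by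
  have : 2 * Complex.I * Real.pi * z = ((2 * Real.pi : ℝ) : ℂ) * (Complex.I * z) := by
    push_cast; ring
  rw [this, Complex.re_ofReal_mul, Complex.I_mul_re]
  ring

theorem pt_pi_div_two (r : ℝ) : pt r (Real.pi / 2) = r * Complex.I := by
  rw [pt]
  push_cast
  rw [Complex.exp_pi_div_two_mul_I]

/-- The reflection formula for the principal branch of `ln Γ`. -/
theorem logGamma_add_logGamma_neg {r θ₀ : ℝ} (hr : 0 < r) (h1 : Real.pi / 2 ≤ θ₀)
    (h2 : θ₀ ≤ Real.pi) (hnp : NotPole (pt r θ₀)) :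
    logGamma (pt r θ₀) + logGamma (-pt r θ₀) = leading r θ₀ + leading r (θ₀ - Real.pi)
      - Complex.log (1 - Complex.exp (2 * Complex.I * Real.pi * pt r θ₀)) := by
  have hpi := Real.pi_pos
  -- D is the defect of the formula along the arc from the imaginary axis to θ₀. The reflection
  -- formula of Γ gives e^D = 1, so D is constant and has to be found at π/2 only.
  set D : ℝ → ℂ := fun θ => logGamma (pt r θ) + logGamma (-pt r θ)
    - (leading r θ + leading r (θ - Real.pi)
      - Complex.log (1 - Complex.exp (2 * Complex.I * Real.pi * pt r θ))) with hD
  have hnp1 : ∀ θ ∈ Set.Icc (Real.pi / 2) θ₀, NotPole (pt r θ) := fun θ hθ =>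
    notPole_pt_of_mem hr h2 hnp hθ
  have hnp2 : ∀ θ ∈ Set.Icc (Real.pi / 2) θ₀, NotPole (-pt r θ) := fun θ hθ =>
    notPole_neg (pt_re_nonpos hr hθ.1 (hθ.2.trans h2)) (pt_ne_zero hr θ)
  have him : ∀ θ ∈ Set.Icc (Real.pi / 2) θ₀, 0 ≤ (pt r θ).im := fun θ hθ =>
    pt_im_nonneg hr (by linarith [hθ.1]) (hθ.2.trans h2)
  have hslit : ∀ θ ∈ Set.Icc (Real.pi / 2) θ₀, 0 <
      (1 - Complex.exp (2 * Complex.I * Real.pi * pt r θ)).re := fun θ hθ => by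
    refine one_sub_exp_re_pos ?_ (exp_two_pi_mul_I_ne_one (hnp1 θ hθ) (hnp2 θ hθ))
    rw [two_I_pi_mul_re]
    have := him θ hθ
    simp only [Left.neg_nonpos_iff]
    positivity
  have hne : ∀ θ ∈ Set.Icc (Real.pi / 2) θ₀,
      1 - Complex.exp (2 * Complex.I * Real.pi * pt r θ) ≠ 0 := fun θ hθ h => by
    have := hslit θ hθ
    rw [h] at this
    simp at this
  have hcont : ContinuousOn D (Set.Icc (Real.pi / 2) θ₀) := by
    intro θ hθ
    have hpt : ContinuousWithinAt (pt r) (Set.Icc (Real.pi / 2) θ₀) θ :=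
      (continuous_pt r).continuousWithinAt
    refine ContinuousWithinAt.sub (ContinuousWithinAt.add ?_ ?_) (ContinuousWithinAt.sub ?_ ?_)
    · exact (continuousWithinAt_logGamma_im_nonneg (hnp1 θ hθ)).comp hpt him
    · have hs : -pt r θ ∈ Complex.slitPlane := by
        rw [Complex.mem_slitPlane_iff, Complex.neg_re, Complex.neg_im]
        rcases hθ.1.eq_or_lt with h | h
        · right
          rw [← h, pt_im, Real.sin_pi_div_two, mul_one]
          exact neg_ne_zero.2 hr.ne'
        · left
          rw [pt_re]
          have := Real.cos_neg_of_pi_div_two_lt_of_lt h (by linarith [hθ.2])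
          nlinarith
      exact ContinuousAt.comp_continuousWithinAt (f := fun θ => -pt r θ)
        (continuousAt_logGamma hs) hpt.neg
    · have := continuous_leading r
      exact Continuous.continuousWithinAt (by fun_prop)
    · refine ContinuousWithinAt.clog ?_ (Or.inl (hslit θ hθ))
      have := continuous_pt r
      exact Continuous.continuousWithinAt (by fun_prop)
  have hexp : ∀ θ ∈ Set.Icc (Real.pi / 2) θ₀, Complex.exp (D θ) = 1 := by
    intro θ hθ
    have h3 := Gamma_mul_Gamma_neg (hnp1 θ hθ) (hnp2 θ hθ)
    have h4 := hne θ hθ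
    simp only [hD]
    rw [Complex.exp_sub, Complex.exp_sub, Complex.exp_add, exp_logGamma (hnp1 θ hθ),
      exp_logGamma (hnp2 θ hθ), Complex.exp_log h4, exp_leading_add_leading_sub_pi hr, ← h3]
    have h5 := Complex.Gamma_ne_zero (hnp1 θ hθ)
    have h6 := Complex.Gamma_ne_zero (hnp2 θ hθ)
    rw [mul_div_cancel_right₀ _ h4, div_self (mul_ne_zero h5 h6)]
  -- On the imaginary axis −z is the conjugate of z, so D is real there, and the only real element
  -- of 2πiℤ is 0.
  have hstart : D (Real.pi / 2) = 0 := by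
    have hmem : Real.pi / 2 ∈ Set.Icc (Real.pi / 2) θ₀ := Set.left_mem_Icc.2 h1
    have hconj : (starRingEnd ℂ) (D (Real.pi / 2)) = D (Real.pi / 2) := by
      have hs : pt r (Real.pi / 2) ∈ Complex.slitPlane := by
        rw [Complex.mem_slitPlane_iff]
        right
        rw [pt_im, Real.sin_pi_div_two, mul_one]
        exact hr.ne'
      have hneg : -pt r (Real.pi / 2) = (starRingEnd ℂ) (pt r (Real.pi / 2)) := by
        rw [pt_pi_div_two]; simp
      have hlead : leading r (Real.pi / 2 - Real.pi) = (starRingEnd ℂ) (leading r (Real.pi / 2)) := by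
        rw [← leading_neg]; congr 1; ring
      have hlog : (starRingEnd ℂ) (Complex.log
          (1 - Complex.exp (2 * Complex.I * Real.pi * pt r (Real.pi / 2))))
          = Complex.log (1 - Complex.exp (2 * Complex.I * Real.pi * pt r (Real.pi / 2))) := by
        rw [← Complex.log_conj _ (Complex.slitPlane_arg_ne_pi (Or.inl (hslit _ hmem)))]
        congr 1
        rw [pt_pi_div_two, map_sub, map_one, ← Complex.exp_conj]
        simp [map_ofNat]
      simp only [hD]
      rw [hneg, hlead, logGamma_conj hs, map_sub, map_sub, map_add, map_add, hlog,
        Complex.conj_conj, Complex.conj_conj]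
      ring
    obtain ⟨n, hn⟩ := Complex.exp_eq_one_iff.1 (hexp _ hmem)
    have him0 := Complex.conj_eq_iff_im.1 hconj
    rw [hn] at him0 ⊢
    have : (n : ℂ) * (2 * Real.pi * Complex.I) = ((n * (2 * Real.pi) : ℝ) : ℂ) * Complex.I := by
      push_cast; ring
    rw [this, Complex.im_ofReal_mul, Complex.I_im, mul_one] at him0
    rw [this, him0]
    simp
  have := eqOn_of_exp_eq_one h1 hcont hexp
  rw [hstart] at this
  exact sub_eq_zero.1 this.symm

/-- The principal branch in the second quadrant, including the negative axis. -/
theorem logGamma_second_quadrant {r θ : ℝ} (hr : 0 < r) (h1 : Real.pi / 2 < θ)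
    (h2 : θ ≤ Real.pi) (hnp : NotPole (pt r θ)) :
    logGamma (pt r θ) = leading r θ + binet (pt r θ)
      - Complex.log (1 - Complex.exp (2 * Complex.I * Real.pi * pt r θ)) := by
  have hpi := Real.pi_pos
  have h3 := logGamma_add_logGamma_neg hr h1.le h2 hnp
  have hre : 0 < (-pt r θ).re := by
    rw [Complex.neg_re, pt_re]
    have := Real.cos_neg_of_pi_div_two_lt_of_lt h1 (by linarith)
    nlinarith
  -- The point −z lies in the right half-plane with argument θ − π. Binet's formula holds for it,
  -- its leading terms cancel, and oddness turns binet(−z) into −binet(z).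
  rw [logGamma_eq_binetLogGamma hre, ← pt_sub_pi, binetLogGamma_pt hr (by linarith) (by linarith),
    pt_sub_pi, binet_neg] at h3
  linear_combination h3

theorem logGamma_third_quadrant {r θ : ℝ} (hr : 0 < r) (h1 : -Real.pi < θ)
    (h2 : θ < -(Real.pi / 2)) :
    logGamma (pt r θ) = leading r θ + binet (pt r θ)
      - Complex.log (1 - Complex.exp (-(2 * Complex.I * Real.pi * pt r θ))) := by
  have hsin : 0 < Real.sin (-θ) := Real.sin_pos_of_pos_of_lt_pi (by linarith [Real.pi_pos]) (by linarith)
  have him : 0 < (pt r (-θ)).im := by rw [pt_im]; positivity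
  have hnp : NotPole (pt r (-θ)) := notPole_of_im_ne_zero him.ne'
  have h3 := logGamma_second_quadrant hr (by linarith) (by linarith) hnp
  have hs : pt r (-θ) ∈ Complex.slitPlane := Or.inr him.ne'
  have hslit : 1 - Complex.exp (2 * Complex.I * Real.pi * pt r (-θ)) ∈ Complex.slitPlane := by
    left
    refine one_sub_exp_re_pos ?_ (exp_two_pi_mul_I_ne_one hnp (notPole_of_im_ne_zero ?_))
    · rw [two_I_pi_mul_re]
      simp only [Left.neg_nonpos_iff]
      positivity
    · rw [Complex.neg_im]; exact neg_ne_zero.2 him.ne'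
  have h4 := congrArg (starRingEnd ℂ) h3
  rw [map_sub, map_add, ← logGamma_conj hs, ← leading_neg, ← binet_conj, ← pt_neg, neg_neg,
    ← Complex.log_conj _ (Complex.slitPlane_arg_ne_pi hslit), map_sub, ← Complex.exp_conj, map_one,
    map_mul, ← pt_neg, neg_neg] at h4
  rw [h4]
  simp [map_ofNat]

theorem logGamma_right {r θ : ℝ} (hr : 0 < r) (h1 : -(Real.pi / 2) < θ) (h2 : θ < Real.pi / 2) :
    logGamma (pt r θ) = leading r θ + binet (pt r θ) := by
  have hpi := Real.pi_pos
  have hre : 0 < (pt r θ).re := by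
    rw [pt_re]
    have := Real.cos_pos_of_mem_Ioo ⟨by linarith, h2⟩
    positivity
  rw [logGamma_eq_binetLogGamma hre, binetLogGamma_pt hr (by linarith) (by linarith)]

/-! ### Limits of Binet's integral at the Stokes lines -/

/-- The regularized kernel `(e^{-at} - e^{-ar}) / (t² - r²)`. -/
def regKernel (a r t : ℝ) : ℝ := (Real.exp (-a * t) - Real.exp (-a * r)) / (t ^ 2 - r ^ 2)

theorem exp_sub_exp_le {u v : ℝ} : Real.exp (-u) - Real.exp (-v) ≤ Real.exp (-u) * (v - u) := by
  have h1 := Real.add_one_le_exp (-(v - u))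
  have h2 : Real.exp (-v) = Real.exp (-u) * Real.exp (-(v - u)) := by
    rw [← Real.exp_add]; congr 1; ring
  rw [h2]
  nlinarith [Real.exp_pos (-u)]

theorem exp_neg_le_two_div_sq {x : ℝ} (hx : 0 < x) : Real.exp (-x) ≤ 2 / x ^ 2 := by
  have h := Real.quadratic_le_exp_of_nonneg hx.le
  rw [Real.exp_neg, inv_le_comm₀ (Real.exp_pos _) (by positivity), inv_div]
  nlinarith

theorem exp_neg_le_one_div {x : ℝ} (hx : 0 < x) : Real.exp (-x) ≤ 1 / x := by
  have h := Real.add_one_le_exp x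
  rw [Real.exp_neg, inv_le_comm₀ (Real.exp_pos _) (by positivity), inv_div, div_one]
  linarith

/-- Both summands of the bound have integral O(1/a), uniformly in a. With a = 2πn and the factor 1/n
in front, the series of integrals then converges like Σ 1/n². -/
theorem exists_abs_regKernel_le {r : ℝ} (hr : 0 < r) : ∃ C : ℝ, 0 < C ∧ ∀ a t : ℝ, 1 ≤ a → 0 < t →
    |regKernel a r t| ≤ C * (Real.exp (-a * t) + 1 / a * (1 + t ^ 2)⁻¹) := by
  -- The three constants belong to t ≤ r/2, r/2 < t < 2r and t ≥ 2r. In the middle range the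
  -- exponential has Lipschitz constant a e^{−ar/2} ≤ 8/(r²a); in the outer ranges |t² − r²| is at
  -- least 3/4 of the larger square.
  set C₁ : ℝ := 4 / (3 * r ^ 2) with hC₁
  set C₂ : ℝ := 8 / r ^ 3 * (1 + 4 * r ^ 2) with hC₂
  set C₃ : ℝ := 4 / 3 * (1 / r) * (1 + 1 / (4 * r ^ 2)) with hC₃
  have h₁ : 0 < C₁ := by positivity
  have h₂ : 0 < C₂ := by positivity
  have h₃ : 0 < C₃ := by positivity
  refine ⟨C₁ + C₂ + C₃, by positivity, fun a t ha ht => ?_⟩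
  have ha0 : 0 < a := by linarith
  have hE := Real.exp_pos (-a * t)
  have hI : 0 < 1 / a * (1 + t ^ 2)⁻¹ := by positivity
  rw [regKernel, abs_div]
  rcases le_or_gt t (r / 2) with h | h
  · have hd : 3 / 4 * r ^ 2 ≤ |t ^ 2 - r ^ 2| := by
      rw [abs_sub_comm, abs_of_nonneg (by nlinarith)]; nlinarith
    have hn : |Real.exp (-a * t) - Real.exp (-a * r)| ≤ Real.exp (-a * t) := by
      have h4 : Real.exp (-a * r) ≤ Real.exp (-a * t) := Real.exp_le_exp.2 (by nlinarith)
      rw [abs_of_nonneg (by linarith)]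
      linarith [Real.exp_pos (-a * r)]
    calc _ ≤ Real.exp (-a * t) / (3 / 4 * r ^ 2) := by gcongr
      _ = C₁ * Real.exp (-a * t) := by rw [hC₁]; field_simp
      _ ≤ C₁ * (Real.exp (-a * t) + 1 / a * (1 + t ^ 2)⁻¹) := by gcongr; linarith
      _ ≤ _ := by gcongr; linarith
  rcases lt_or_ge t (2 * r) with h' | h'
  · have hlip : |Real.exp (-a * t) - Real.exp (-a * r)| ≤ a * Real.exp (-(a * r / 2)) * |t - r| := by
      have key : ∀ x y : ℝ, r / 2 ≤ x → x ≤ y →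
          |Real.exp (-a * x) - Real.exp (-a * y)| ≤ a * Real.exp (-(a * r / 2)) * (y - x) := by
        intro x y hx hxy
        have h4 : Real.exp (-a * y) ≤ Real.exp (-a * x) := Real.exp_le_exp.2 (by nlinarith)
        rw [abs_of_nonneg (by linarith), neg_mul, neg_mul]
        refine (exp_sub_exp_le).trans ?_
        have h5 : Real.exp (-(a * x)) ≤ Real.exp (-(a * r / 2)) := Real.exp_le_exp.2 (by nlinarith)
        have h6 : 0 ≤ a * y - a * x := by nlinarith
        calc _ ≤ Real.exp (-(a * r / 2)) * (a * y - a * x) := by gcongr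
          _ = _ := by ring
      rcases le_total t r with h4 | h4
      · rw [abs_sub_comm t r, abs_of_nonneg (by linarith : 0 ≤ r - t)]
        exact key t r h.le h4
      · rw [abs_sub_comm, abs_of_nonneg (by linarith : 0 ≤ t - r)]
        exact key r t (by linarith) h4
    have hexp : a * Real.exp (-(a * r / 2)) ≤ 8 / (r ^ 2 * a) := by
      calc _ ≤ a * (2 / (a * r / 2) ^ 2) := by
            gcongr; exact exp_neg_le_two_div_sq (by positivity)
        _ = _ := by field_simp; ring
    have hfac : |t ^ 2 - r ^ 2| = |t - r| * (t + r) := by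
      rw [show t ^ 2 - r ^ 2 = (t - r) * (t + r) by ring, abs_mul,
        abs_of_pos (by linarith : 0 < t + r)]
    have hmain : |Real.exp (-a * t) - Real.exp (-a * r)| / |t ^ 2 - r ^ 2| ≤ 8 / (r ^ 3 * a) := by
      -- At t = r the quotient is 0, division by 0 being 0.
      rcases eq_or_ne t r with rfl | hne
      · simp; positivity
      · have hp : 0 < |t - r| := abs_pos.2 (sub_ne_zero.2 hne)
        rw [hfac, div_le_iff₀ (by positivity)]
        calc _ ≤ 8 / (r ^ 2 * a) * |t - r| := hlip.trans (by gcongr)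
          _ = 8 / (r ^ 3 * a) * (|t - r| * r) := by field_simp
          _ ≤ _ := by gcongr; linarith
    calc _ ≤ 8 / (r ^ 3 * a) := hmain
      _ = 8 / r ^ 3 * (1 / a * 1) := by field_simp
      _ ≤ 8 / r ^ 3 * (1 / a * ((1 + 4 * r ^ 2) * (1 + t ^ 2)⁻¹)) := by
          gcongr
          rw [← div_eq_mul_inv, one_le_div (by positivity)]
          nlinarith
      _ = C₂ * (1 / a * (1 + t ^ 2)⁻¹) := by rw [hC₂]; ring
      _ ≤ C₂ * (Real.exp (-a * t) + 1 / a * (1 + t ^ 2)⁻¹) := by gcongr; linarith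
      _ ≤ _ := by gcongr; linarith
  · have hd : 3 / 4 * t ^ 2 ≤ |t ^ 2 - r ^ 2| := by
      rw [abs_of_nonneg (by nlinarith)]; nlinarith
    have hn : |Real.exp (-a * t) - Real.exp (-a * r)| ≤ 1 / (a * r) := by
      have h4 : Real.exp (-a * t) ≤ Real.exp (-a * r) := Real.exp_le_exp.2 (by nlinarith)
      rw [abs_sub_comm, abs_of_nonneg (by linarith)]
      have := exp_neg_le_one_div (x := a * r) (by positivity)
      rw [neg_mul a r]
      linarith
    calc _ ≤ 1 / (a * r) / (3 / 4 * t ^ 2) := by gcongr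
      _ = 4 / 3 * (1 / r) * (1 / a * (1 / t ^ 2)) := by field_simp
      _ ≤ 4 / 3 * (1 / r) * (1 / a * ((1 + 1 / (4 * r ^ 2)) * (1 + t ^ 2)⁻¹)) := by
          gcongr
          rw [← div_eq_mul_inv, div_le_div_iff₀ (by positivity) (by positivity), one_mul, add_mul,
            one_mul, add_comm]
          gcongr
          rw [div_mul_eq_mul_div, one_mul, one_le_div (by positivity)]
          nlinarith
      _ = C₃ * (1 / a * (1 + t ^ 2)⁻¹) := by rw [hC₃]; ring
      _ ≤ C₃ * (Real.exp (-a * t) + 1 / a * (1 + t ^ 2)⁻¹) := by gcongr; linarith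
      _ ≤ _ := by gcongr; linarith

theorem measurable_regKernel (a r : ℝ) : Measurable (regKernel a r) := by
  unfold regKernel; fun_prop

theorem integrableOn_regKernel_bound {a : ℝ} (ha : 1 ≤ a) (C : ℝ) :
    IntegrableOn (fun t : ℝ => C * (Real.exp (-a * t) + 1 / a * (1 + t ^ 2)⁻¹)) (Set.Ioi 0) :=
  ((integrableOn_exp_neg_mul (by linarith)).add
    (integrable_inv_one_add_sq.integrableOn.const_mul _)).const_mul _

theorem integrableOn_regKernel {a r : ℝ} (ha : 1 ≤ a) (hr : 0 < r) :
    IntegrableOn (regKernel a r) (Set.Ioi 0) := by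
  obtain ⟨C, _, h⟩ := exists_abs_regKernel_le hr
  refine (integrableOn_regKernel_bound ha C).mono' (measurable_regKernel a r).aestronglyMeasurable
    ((ae_restrict_iff' measurableSet_Ioi).2 (ae_of_all _ fun t ht => h a t ha ht))

theorem exists_integral_abs_regKernel_le {r : ℝ} (hr : 0 < r) : ∃ C : ℝ, 0 < C ∧ ∀ a : ℝ, 1 ≤ a →
    ∫ t in Set.Ioi (0 : ℝ), |regKernel a r t| ≤ C / a := by
  obtain ⟨C, hC, h⟩ := exists_abs_regKernel_le hr
  refine ⟨C * (1 + Real.pi), by positivity, fun a ha => ?_⟩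
  have ha0 : 0 < a := by linarith
  refine (setIntegral_mono_on (integrableOn_regKernel ha hr).norm
    (integrableOn_regKernel_bound ha C) measurableSet_Ioi fun t ht => h a t ha ht).trans ?_
  rw [integral_const_mul, integral_add (integrableOn_exp_neg_mul ha0)
    (integrable_inv_one_add_sq.integrableOn.const_mul _), integral_exp_neg_mul ha0,
    integral_const_mul]
  have hle : ∫ t in Set.Ioi (0 : ℝ), (1 + t ^ 2)⁻¹ ≤ Real.pi := by
    rw [← integral_univ_inv_one_add_sq]
    exact setIntegral_le_integral integrable_inv_one_add_sq (ae_of_all _ fun t => by positivity)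
  calc _ ≤ C * (1 / a + 1 / a * Real.pi) := by gcongr
    _ = _ := by ring

theorem integrableOn_div_sq_add_sq {z : ℂ} (hz : z.re ≠ 0) :
    IntegrableOn (fun t : ℝ => z / ((t : ℂ) ^ 2 + z ^ 2)) (Set.Ioi 0) := by
  obtain ⟨c, hc, h⟩ := exists_mul_one_add_sq_le_norm hz
  refine (integrable_inv_one_add_sq.integrableOn.const_mul (‖z‖ / c)).mono' ?_ (ae_of_all _ fun t => ?_)
  · exact Measurable.aestronglyMeasurable (by fun_prop)
  · rw [norm_div]
    calc _ ≤ ‖z‖ / (c * (1 + t ^ 2)) := by gcongr; exact h t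
      _ = _ := by field_simp

/-- The antiderivative is (ln(z + it) − ln(z − it))/2i, both arguments staying in the right
half-plane. At infinity the two copies of ln t cancel and ln(±i) remains. -/
theorem integral_div_sq_add_sq {z : ℂ} (hz : 0 < z.re) :
    ∫ t in Set.Ioi (0 : ℝ), z / ((t : ℂ) ^ 2 + z ^ 2) = Real.pi / 2 := by
  have hre1 : ∀ t : ℝ, 0 < (z + t * Complex.I).re := fun t => by simpa using hz
  have hre2 : ∀ t : ℝ, 0 < (z - t * Complex.I).re := fun t => by simpa using hz
  have hne : ∀ w : ℂ, 0 < w.re → w ≠ 0 := fun w hw h => by rw [h] at hw; simp at hw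
  set F : ℝ → ℂ := fun t => 1 / (2 * Complex.I) *
    (Complex.log (z + t * Complex.I) - Complex.log (z - t * Complex.I)) with hF
  have hd : ∀ t ∈ Set.Ici (0 : ℝ), HasDerivAt F (z / ((t : ℂ) ^ 2 + z ^ 2)) t := by
    intro t _
    have h0 : HasDerivAt (fun t : ℝ => (t : ℂ) * Complex.I) Complex.I t := by
      have : HasDerivAt (fun t : ℝ => (t : ℂ)) 1 t := Complex.ofRealCLM.hasDerivAt (x := t)
      simpa using this.mul_const Complex.I
    have h1 := (h0.const_add z).clog_real (Or.inl (hre1 t))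
    have h2 := (h0.const_sub z).clog_real (Or.inl (hre2 t))
    refine ((h1.sub h2).const_mul (1 / (2 * Complex.I))).congr_deriv ?_
    have h3 := hne _ (hre1 t)
    have h4 := hne _ (hre2 t)
    have h5 : (t : ℂ) ^ 2 + z ^ 2 = (z + t * Complex.I) * (z - t * Complex.I) := by
      linear_combination (t : ℂ) ^ 2 * Complex.I_sq
    have hI := Complex.I_ne_zero
    have h6 : (z + t * Complex.I) + (z - t * Complex.I) = 2 * z := by ring
    rw [h5]
    generalize z + t * Complex.I = A at *
    generalize z - t * Complex.I = B at *
    field_simp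
    linear_combination h6
  have hlim : Tendsto F atTop (𝓝 (Real.pi / 2)) := by
    have hz0 : Tendsto (fun t : ℝ => z / (t : ℂ)) atTop (𝓝 0) := by
      have : Tendsto (fun t : ℝ => ((t⁻¹ : ℝ) : ℂ)) atTop (𝓝 ((0 : ℝ) : ℂ)) :=
        (Complex.continuous_ofReal.tendsto _).comp tendsto_inv_atTop_zero
      simpa [div_eq_mul_inv] using this.const_mul z
    have h1 : Tendsto (fun t : ℝ => Complex.log (z / t + Complex.I)) atTop
        (𝓝 (Complex.log (0 + Complex.I))) :=
      (hz0.add_const _).clog (by simp [Complex.mem_slitPlane_iff])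
    have h2 : Tendsto (fun t : ℝ => Complex.log (z / t - Complex.I)) atTop
        (𝓝 (Complex.log (0 - Complex.I))) :=
      (hz0.sub_const _).clog (by simp [Complex.mem_slitPlane_iff])
    have h3 := (h1.sub h2).const_mul (1 / (2 * Complex.I))
    rw [zero_add, zero_sub, Complex.log_I, Complex.log_neg_I] at h3
    have h4 : 1 / (2 * Complex.I) * (Real.pi / 2 * Complex.I - -(Real.pi / 2) * Complex.I)
        = Real.pi / 2 := by
      have hI := Complex.I_ne_zero
      field_simp
      ring
    rw [h4] at h3
    refine h3.congr' ?_
    filter_upwards [eventually_gt_atTop 0] with t ht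
    have htC : (t : ℂ) ≠ 0 := by exact_mod_cast ht.ne'
    have e1 : z + t * Complex.I = t * (z / t + Complex.I) := by field_simp
    have e2 : z - t * Complex.I = t * (z / t - Complex.I) := by field_simp
    have n1 : z / t + Complex.I ≠ 0 := fun h => hne _ (hre1 t) (by rw [e1, h, mul_zero])
    have n2 : z / t - Complex.I ≠ 0 := fun h => hne _ (hre2 t) (by rw [e2, h, mul_zero])
    simp only [hF]
    rw [e1, e2, Complex.log_ofReal_mul ht n1, Complex.log_ofReal_mul ht n2]
    ring
  rw [integral_Ioi_of_hasDerivAt_of_tendsto' hd (integrableOn_div_sq_add_sq hz.ne') hlim]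
  simp [hF]

theorem integrableOn_exp_mul_div {a : ℝ} (ha : 0 < a) {z : ℂ} (hz : z.re ≠ 0) :
    IntegrableOn (fun t : ℝ => (Real.exp (-a * t) : ℂ) * (z / ((t : ℂ) ^ 2 + z ^ 2)))
      (Set.Ioi 0) := by
  refine Integrable.mono' (integrableOn_div_sq_add_sq hz).norm ?_ ?_
  · exact Measurable.aestronglyMeasurable (by fun_prop)
  · refine (ae_restrict_iff' measurableSet_Ioi).2 (ae_of_all _ fun t (ht : 0 < t) => ?_)
    rw [norm_mul, Complex.norm_real, Real.norm_of_nonneg (Real.exp_nonneg _)]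
    refine mul_le_of_le_one_left (norm_nonneg _) (Real.exp_le_one_iff.2 ?_)
    nlinarith

/-- Subtracting the value of the exponential at t = r regularizes the limit at the imaginary axis
with |z| = r. The subtracted part is exactly (π/2)e^{−ar}, independent of z: it is the half residue
behind the Stokes jump. -/
theorem binetTerm_eq_reg {z : ℂ} (hz : 0 < z.re) (r : ℝ) (n : ℕ) :
    binetTerm z n = (∫ t in Set.Ioi (0 : ℝ),
      ((Real.exp (-(2 * Real.pi * ((n : ℝ) + 1)) * t)
        - Real.exp (-(2 * Real.pi * ((n : ℝ) + 1)) * r) : ℝ) : ℂ) * (z / ((t : ℂ) ^ 2 + z ^ 2)))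
      + (Real.exp (-(2 * Real.pi * ((n : ℝ) + 1)) * r) : ℂ) * (Real.pi / 2) := by
  have ha : 0 < 2 * Real.pi * ((n : ℝ) + 1) := by positivity
  rw [← integral_div_sq_add_sq hz, ← integral_const_mul, binetTerm]
  have h1 := integrableOn_exp_mul_div ha hz.ne'
  have h2 := (integrableOn_div_sq_add_sq hz.ne').const_mul
    (Real.exp (-(2 * Real.pi * ((n : ℝ) + 1)) * r) : ℂ)
  rw [← integral_add _ h2]
  · congr 1 with t
    push_cast
    ring
  · refine (h1.sub h2).congr (ae_of_all _ fun t => ?_)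
    simp only [Pi.sub_apply]
    push_cast
    ring

/-- On the circle |z| = r one has |t² + z²| ≥ |t² − r²|, so a single integrable function dominates
all approaches to the axis. -/
theorem norm_reg_le {r : ℝ} {z : ℂ} (hz : ‖z‖ = r) (a : ℝ) {t : ℝ} (ht : 0 < t) :
    ‖((Real.exp (-a * t) - Real.exp (-a * r) : ℝ) : ℂ) * (z / ((t : ℂ) ^ 2 + z ^ 2))‖
      ≤ r * |regKernel a r t| := by
  rw [norm_mul, norm_div, hz, Complex.norm_real, Real.norm_eq_abs, regKernel, abs_div,
    mul_div_assoc', mul_comm, mul_div_assoc r]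
  have hr : 0 ≤ r := hz ▸ norm_nonneg z
  refine mul_le_mul_of_nonneg_left ?_ hr
  rcases eq_or_ne (t ^ 2 - r ^ 2) 0 with h | h
  · have h1 : t = r := (sq_eq_sq₀ ht.le hr).1 (by linarith)
    simp [h1]
  · refine div_le_div_of_nonneg_left (abs_nonneg _) (abs_pos.2 h) ?_
    have := abs_norm_sub_norm_le ((t : ℂ) ^ 2) (-z ^ 2)
    rw [sub_neg_eq_add, norm_neg, norm_pow, norm_pow, hz, Complex.norm_real, Real.norm_eq_abs,
      sq_abs] at this
    exact this

/-- The principal value integral on the Stokes line, as a series of regularized integrals. -/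
def linePV (r : ℝ) : ℝ :=
  ∑' n : ℕ, 1 / (2 * Real.pi * ((n : ℝ) + 1)) *
    ∫ t in Set.Ioi (0 : ℝ), regKernel (2 * Real.pi * ((n : ℝ) + 1)) r t

theorem one_le_two_pi_mul_succ (n : ℕ) : 1 ≤ 2 * Real.pi * ((n : ℝ) + 1) := by
  nlinarith [Real.pi_gt_three, n.cast_nonneg (α := ℝ)]

section Limit

variable {ι : Type*} {l : Filter ι} {Z : ι → ℂ} {z₀ : ℂ} {r : ℝ}

theorem norm_binetTerm_le (hr : 0 < r) : ∃ C : ℝ, 0 < C ∧ ∀ (z : ℂ) (n : ℕ), 0 < z.re → ‖z‖ = r →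
    ‖binetTerm z n‖ ≤ C / ((n : ℝ) + 1) := by
  obtain ⟨C, hC, h⟩ := exists_integral_abs_regKernel_le hr
  refine ⟨r * C + 1 / r * (Real.pi / 2), by positivity, fun z n hz hzr => ?_⟩
  have ha := one_le_two_pi_mul_succ n
  have ha1 : (n : ℝ) + 1 ≤ 2 * Real.pi * ((n : ℝ) + 1) := by
    nlinarith [Real.pi_gt_three, n.cast_nonneg (α := ℝ)]
  rw [binetTerm_eq_reg hz r]
  refine (norm_add_le _ _).trans ?_
  rw [add_div]
  refine add_le_add ?_ ?_
  · calc _ ≤ ∫ t in Set.Ioi (0 : ℝ), r * |regKernel (2 * Real.pi * ((n : ℝ) + 1)) r t| := by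
          refine norm_integral_le_of_norm_le ((integrableOn_regKernel ha hr).norm.const_mul r) ?_
          exact (ae_restrict_iff' measurableSet_Ioi).2 (ae_of_all _ fun t ht => norm_reg_le hzr _ ht)
      _ ≤ r * (C / (2 * Real.pi * ((n : ℝ) + 1))) := by
          rw [integral_const_mul]; gcongr; exact h _ ha
      _ ≤ r * (C / ((n : ℝ) + 1)) := by gcongr
      _ = _ := by ring
  · rw [norm_mul, Complex.norm_real, Real.norm_of_nonneg (Real.exp_nonneg _)]
    have h1 : ‖(Real.pi : ℂ) / 2‖ = Real.pi / 2 := by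
      rw [norm_div, Complex.norm_real, Real.norm_of_nonneg Real.pi_pos.le]; simp
    rw [h1]
    calc _ ≤ 1 / (2 * Real.pi * ((n : ℝ) + 1) * r) * (Real.pi / 2) := by
          gcongr
          rw [neg_mul]
          exact exp_neg_le_one_div (by positivity)
      _ ≤ 1 / (((n : ℝ) + 1) * r) * (Real.pi / 2) := by gcongr
      _ = _ := by field_simp

theorem tendsto_binetTerm [l.IsCountablyGenerated] (hr : 0 < r) (hz₀ : z₀ ^ 2 = -(r : ℂ) ^ 2)
    (hlim : Tendsto Z l (𝓝 z₀)) (hre : ∀ᶠ i in l, 0 < (Z i).re) (hnorm : ∀ᶠ i in l, ‖Z i‖ = r)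
    (n : ℕ) :
    Tendsto (fun i => binetTerm (Z i) n) l
      (𝓝 (z₀ * (∫ t in Set.Ioi (0 : ℝ), regKernel (2 * Real.pi * ((n : ℝ) + 1)) r t : ℝ)
        + (Real.exp (-(2 * Real.pi * ((n : ℝ) + 1)) * r) : ℂ) * (Real.pi / 2))) := by
  set a : ℝ := 2 * Real.pi * ((n : ℝ) + 1) with ha
  have ha1 : 1 ≤ a := one_le_two_pi_mul_succ n
  have h1 : Tendsto (fun i => ∫ t in Set.Ioi (0 : ℝ),
      ((Real.exp (-a * t) - Real.exp (-a * r) : ℝ) : ℂ) * (Z i / ((t : ℂ) ^ 2 + Z i ^ 2))) l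
      (𝓝 (∫ t in Set.Ioi (0 : ℝ), z₀ * (regKernel a r t : ℂ))) := by
    refine tendsto_integral_filter_of_dominated_convergence (fun t => r * |regKernel a r t|)
      (Eventually.of_forall fun i => Measurable.aestronglyMeasurable (by fun_prop)) ?_
      ((integrableOn_regKernel ha1 hr).norm.const_mul r) ?_
    · filter_upwards [hnorm] with i hi
      exact (ae_restrict_iff' measurableSet_Ioi).2 (ae_of_all _ fun t ht => norm_reg_le hi _ ht)
    · have hne : ∀ᵐ t : ℝ ∂(volume.restrict (Set.Ioi 0)), t ≠ r :=
        ae_restrict_of_ae (Measure.ae_ne volume r)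
      filter_upwards [hne, ae_restrict_mem measurableSet_Ioi] with t ht ht0
      have hd : (t : ℂ) ^ 2 + z₀ ^ 2 ≠ 0 := by
        rw [hz₀]
        intro h
        have h2 : t ^ 2 = r ^ 2 := by
          have : (t : ℂ) ^ 2 = (r : ℂ) ^ 2 := by linear_combination h
          exact_mod_cast this
        exact ht ((sq_eq_sq₀ (le_of_lt ht0) hr.le).1 h2)
      have h3 := (hlim.div ((hlim.pow 2).const_add ((t : ℂ) ^ 2)) hd).const_mul
        ((Real.exp (-a * t) - Real.exp (-a * r) : ℝ) : ℂ)
      have e : z₀ * (regKernel a r t : ℂ) = ((Real.exp (-a * t) - Real.exp (-a * r) : ℝ) : ℂ)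
          * (z₀ / ((t : ℂ) ^ 2 + z₀ ^ 2)) := by
        rw [regKernel, hz₀]
        push_cast
        ring
      rw [e]
      exact h3
  rw [integral_const_mul, integral_complex_ofReal] at h1
  refine (h1.add_const _).congr' ?_
  filter_upwards [hre] with i hi
  rw [binetTerm_eq_reg hi r]

theorem tsum_exp_div {r : ℝ} (hr : 0 < r) :
    HasSum (fun n : ℕ => Real.exp (-(2 * Real.pi * ((n : ℝ) + 1)) * r) / ((n : ℝ) + 1))
      (-Real.log (1 - Real.exp (-(2 * Real.pi * r)))) := by
  have h1 : |Real.exp (-(2 * Real.pi * r))| < 1 := by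
    rw [Real.abs_exp, Real.exp_lt_one_iff]
    have := Real.pi_pos
    have : 0 < 2 * Real.pi * r := by positivity
    linarith
  convert Real.hasSum_pow_div_log_of_abs_lt_one h1 using 2 with n
  rw [← Real.exp_nat_mul]
  congr 2
  push_cast
  ring

/-- The one-sided limits of Binet's integral at the imaginary axis, along circles. -/
theorem tendsto_binet_right [l.IsCountablyGenerated] (hr : 0 < r) (hz₀ : z₀ ^ 2 = -(r : ℂ) ^ 2)
    (hlim : Tendsto Z l (𝓝 z₀)) (hre : ∀ᶠ i in l, 0 < (Z i).re)
    (hnorm : ∀ᶠ i in l, ‖Z i‖ = r) :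
    Tendsto (fun i => binet (Z i)) l (𝓝 (2 * z₀ * (linePV r : ℂ)
      - 1 / 2 * (Real.log (1 - Real.exp (-(2 * Real.pi * r))) : ℂ))) := by
  have hpi : (Real.pi : ℂ) ≠ 0 := by exact_mod_cast Real.pi_ne_zero
  obtain ⟨C, hC, hbd⟩ := norm_binetTerm_le hr
  obtain ⟨C', hC', hbd'⟩ := exists_integral_abs_regKernel_le hr
  have h1 : Tendsto (fun i => binet (Z i)) l (𝓝 (∑' n : ℕ, 1 / ((Real.pi : ℂ) * ((n : ℂ) + 1)) *
      (z₀ * (∫ t in Set.Ioi (0 : ℝ), regKernel (2 * Real.pi * ((n : ℝ) + 1)) r t : ℝ)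
        + (Real.exp (-(2 * Real.pi * ((n : ℝ) + 1)) * r) : ℂ) * (Real.pi / 2)))) := by
    refine tendsto_tsum_of_dominated_convergence
      (bound := fun n : ℕ => C / Real.pi * (1 / ((n : ℝ) + 1) ^ 2))
      (summable_inv_succ_sq.mul_left _) (fun n => ?_) ?_
    · exact (tendsto_binetTerm hr hz₀ hlim hre hnorm n).const_mul _
    · filter_upwards [hre, hnorm] with i h2 h3 n
      rw [norm_mul, norm_div, norm_one, norm_mul, norm_succ, Complex.norm_real,
        Real.norm_of_nonneg Real.pi_pos.le]
      calc _ ≤ 1 / (Real.pi * ((n : ℝ) + 1)) * (C / ((n : ℝ) + 1)) := by gcongr; exact hbd _ n h2 h3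
        _ = _ := by field_simp
  have hs1 : Summable fun n : ℕ => 1 / (2 * Real.pi * ((n : ℝ) + 1)) *
      ∫ t in Set.Ioi (0 : ℝ), regKernel (2 * Real.pi * ((n : ℝ) + 1)) r t := by
    refine Summable.of_norm_bounded (summable_inv_succ_sq.mul_left C') fun n => ?_
    have ha := one_le_two_pi_mul_succ n
    have ha1 : (n : ℝ) + 1 ≤ 2 * Real.pi * ((n : ℝ) + 1) := by
      nlinarith [Real.pi_gt_three, n.cast_nonneg (α := ℝ)]
    rw [norm_mul, Real.norm_of_nonneg (by positivity)]
    calc _ ≤ 1 / ((n : ℝ) + 1) * (C' / ((n : ℝ) + 1)) := by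
          gcongr
          refine (norm_integral_le_integral_norm _).trans ((hbd' _ ha).trans ?_)
          gcongr
      _ = _ := by field_simp
  have hs2 := tsum_exp_div hr
  have h4 : HasSum (fun n : ℕ => ((1 / (2 * Real.pi * ((n : ℝ) + 1)) *
      ∫ t in Set.Ioi (0 : ℝ), regKernel (2 * Real.pi * ((n : ℝ) + 1)) r t : ℝ) : ℂ))
      (linePV r : ℂ) := Complex.hasSum_ofReal.2 hs1.hasSum
  have h5 := ((h4.mul_left (2 * z₀)).add ((Complex.hasSum_ofReal.2 hs2).mul_left (1 / 2))).tsum_eq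
  convert h1 using 2
  rw [← tsum_congr, h5]
  · push_cast; ring
  · intro n
    have h2 : ((n : ℂ) + 1) ≠ 0 := by exact_mod_cast Nat.succ_ne_zero n
    push_cast
    field_simp

/-- By oddness the principal value term is unchanged while the half residue changes sign. -/
theorem tendsto_binet_left [l.IsCountablyGenerated] (hr : 0 < r) (hz₀ : z₀ ^ 2 = -(r : ℂ) ^ 2)
    (hlim : Tendsto Z l (𝓝 z₀)) (hre : ∀ᶠ i in l, (Z i).re < 0)
    (hnorm : ∀ᶠ i in l, ‖Z i‖ = r) :
    Tendsto (fun i => binet (Z i)) l (𝓝 (2 * z₀ * (linePV r : ℂ)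
      + 1 / 2 * (Real.log (1 - Real.exp (-(2 * Real.pi * r))) : ℂ))) := by
  have h := tendsto_binet_right (Z := fun i => -Z i) (z₀ := -z₀) hr (by rw [neg_sq, hz₀]) hlim.neg
    (by filter_upwards [hre] with i hi; simpa using hi)
    (by filter_upwards [hnorm] with i hi; rwa [norm_neg])
  have h' := h.neg
  simp only [binet_neg, neg_neg] at h'
  convert h' using 2
  ring

end Limit

/-! ### The principal value on a Stokes line -/

/-- The singular part of `1 / (y² - Y²)` at `Y`, cut off outside a window of radius `w`. -/
def windowKernel (w Y y : ℝ) : ℝ := if |y - Y| < w then 1 / (2 * Y * (y - Y)) else 0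

/-- The rest of `1 / (y² - Y²)` after removal of the cut-off singular part at `Y`. -/
def windowRest (w Y y : ℝ) : ℝ := 1 / (y ^ 2 - Y ^ 2) - windowKernel w Y y

theorem measurable_windowKernel (w Y : ℝ) : Measurable (windowKernel w Y) := by
  unfold windowKernel
  refine Measurable.ite ?_ (by fun_prop) measurable_const
  exact measurableSet_lt (by fun_prop) measurable_const

theorem measurable_windowRest (w Y : ℝ) : Measurable (windowRest w Y) := by
  have := measurable_windowKernel w Y
  unfold windowRest
  fun_prop

theorem windowRest_of_lt {w Y y : ℝ} (hY : 0 < Y) (hy : 0 < y) (hne : y ≠ Y) (h : |y - Y| < w) :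
    windowRest w Y y = -(1 / (2 * Y)) * (1 / (y + Y)) := by
  rw [windowRest, windowKernel, if_pos h]
  have h1 : y - Y ≠ 0 := sub_ne_zero.2 hne
  have h2 : y + Y ≠ 0 := by positivity
  rw [show y ^ 2 - Y ^ 2 = (y - Y) * (y + Y) by ring]
  field_simp
  ring

theorem windowRest_of_le {w Y y : ℝ} (h : w ≤ |y - Y|) :
    windowRest w Y y = 1 / (y ^ 2 - Y ^ 2) := by
  rw [windowRest, windowKernel, if_neg (not_lt.2 h), sub_zero]

/-- The bound grows only like Y² for fixed w, which the factor e^{−Y} of the n-th term absorbs. -/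
theorem abs_windowRest_le {w Y y : ℝ} (hw : 0 < w) (hY : 2 * w ≤ Y) (hy : 0 < y) :
    |windowRest w Y y| ≤ (2 + 1 / w ^ 2) * (1 + 4 * Y ^ 2) * (1 + y ^ 2)⁻¹ := by
  have hY0 : 0 < Y := by linarith
  have hw2 : 0 < 1 / w ^ 2 := by positivity
  have hsmall : y ≤ 2 * Y → ∀ x : ℝ, x ≤ 1 / w ^ 2 →
      x ≤ (2 + 1 / w ^ 2) * (1 + 4 * Y ^ 2) * (1 + y ^ 2)⁻¹ := by
    intro h x hx
    have h1 : 1 ≤ (1 + 4 * Y ^ 2) * (1 + y ^ 2)⁻¹ := by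
      rw [← div_eq_mul_inv, one_le_div (by positivity)]
      nlinarith
    calc x ≤ (2 + 1 / w ^ 2) * 1 := by linarith
      _ ≤ (2 + 1 / w ^ 2) * ((1 + 4 * Y ^ 2) * (1 + y ^ 2)⁻¹) := by gcongr
      _ = _ := by ring
  rcases lt_or_ge |y - Y| w with h | h
  · rw [abs_lt] at h
    refine hsmall (by linarith) _ ?_
    rcases eq_or_ne y Y with rfl | hne
    · rw [windowRest, windowKernel]
      simp
      positivity
    · rw [windowRest_of_lt hY0 hy hne (abs_lt.2 h), abs_mul, abs_neg,
        abs_of_pos (by positivity), abs_of_pos (by positivity), one_div_mul_one_div]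
      refine one_div_le_one_div_of_le (by positivity) ?_
      nlinarith
  rw [windowRest_of_le h, abs_div, abs_one]
  rcases le_or_gt y (2 * Y) with h' | h'
  · refine hsmall h' _ ?_
    refine one_div_le_one_div_of_le (by positivity) ?_
    rw [show y ^ 2 - Y ^ 2 = (y - Y) * (y + Y) by ring, abs_mul,
      abs_of_pos (by linarith : 0 < y + Y)]
    nlinarith
  · have h1 : 3 / 4 * y ^ 2 ≤ |y ^ 2 - Y ^ 2| := by
      rw [abs_of_nonneg (by nlinarith)]; nlinarith
    calc 1 / |y ^ 2 - Y ^ 2| ≤ 1 / (3 / 4 * y ^ 2) := by gcongr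
      _ ≤ (2 + 1 / w ^ 2) * 1 * (1 + y ^ 2)⁻¹ := by
          rw [← div_eq_mul_inv, div_le_div_iff₀ (by positivity) (by positivity)]
          have h2 : 2 * w ^ 2 ≤ y ^ 2 := by nlinarith
          have h3 : 2 ≤ 1 / w ^ 2 * y ^ 2 := by
            rw [div_mul_eq_mul_div, one_mul, le_div_iff₀ (by positivity)]; exact h2
          nlinarith
      _ ≤ _ := by gcongr; nlinarith

theorem integrableOn_windowRest {w Y : ℝ} (hw : 0 < w) (hY : 2 * w ≤ Y) :
    IntegrableOn (windowRest w Y) (Set.Ioi 0) :=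
  (integrable_inv_one_add_sq.integrableOn.const_mul ((2 + 1 / w ^ 2) * (1 + 4 * Y ^ 2))).mono'
    (measurable_windowRest w Y).aestronglyMeasurable
    ((ae_restrict_iff' measurableSet_Ioi).2 (ae_of_all _ fun _ hy => abs_windowRest_le hw hY hy))

theorem integral_abs_windowRest_le {w Y : ℝ} (hw : 0 < w) (hY : 2 * w ≤ Y) :
    ∫ y in Set.Ioi (0 : ℝ), |windowRest w Y y| ≤ (2 + 1 / w ^ 2) * (1 + 4 * Y ^ 2) * Real.pi := by
  refine (setIntegral_mono_on (integrableOn_windowRest hw hY).norm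
    (integrable_inv_one_add_sq.integrableOn.const_mul _) measurableSet_Ioi
    fun y hy => abs_windowRest_le hw hY hy).trans ?_
  rw [integral_const_mul]
  gcongr
  rw [← integral_univ_inv_one_add_sq]
  exact setIntegral_le_integral integrable_inv_one_add_sq (ae_of_all _ fun t => by positivity)

/-- This expresses that the principal value of ∫ dy/(y² − Y²) over the half-line is 0. -/
theorem integral_windowRest {w Y : ℝ} (hw : 0 < w) (hY : 2 * w ≤ Y) :
    ∫ y in Set.Ioi (0 : ℝ), windowRest w Y y = 0 := by
  have hY0 : 0 < Y := by linarith
  -- Inside the window ln|y − Y| is frozen at ln w, since its derivative has been removed there. So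
  -- Φ is continuous, an antiderivative off three points, and zero at 0 and at infinity.
  set Φ : ℝ → ℝ := fun y => 1 / (2 * Y) * (Real.log (max |y - Y| w) - Real.log (y + Y)) with hΦ
  have hint := integrableOn_windowRest hw hY
  have hFTC : ∀ b : ℝ, 0 < b → ∫ y in (0 : ℝ)..b, windowRest w Y y = Φ b - Φ 0 := by
    intro b hb
    refine MeasureTheory.integral_eq_of_hasDerivAt_off_countable Φ (windowRest w Y)
      (s := {Y - w, Y, Y + w}) (Set.toFinite _).countable ?_ ?_ ?_
    · rw [Set.uIcc_of_le hb.le]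
      have h1 : ∀ y ∈ Set.Icc 0 b, max |y - Y| w ≠ 0 := fun y _ =>
        (lt_of_lt_of_le hw (le_max_right _ _)).ne'
      have h2 : ∀ y ∈ Set.Icc 0 b, y + Y ≠ 0 := fun y hy => by linarith [hy.1]
      exact (((ContinuousOn.log (by fun_prop) h1).sub (ContinuousOn.log (by fun_prop) h2))).const_mul _ 
    · rintro y ⟨hy, hys⟩
      rw [min_eq_left hb.le] at hy
      simp only [Set.mem_insert_iff, Set.mem_singleton_iff, not_or] at hys
      have hy0 : 0 < y := hy.1
      have hd2 : HasDerivAt (fun y => Real.log (y + Y)) (1 / (y + Y)) y :=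
        ((hasDerivAt_id y).add_const Y).log (by positivity)
      rcases lt_or_ge |y - Y| w with h | h
      · rw [windowRest_of_lt hY0 hy0 hys.2.1 h]
        have hd1 : HasDerivAt (fun y => Real.log (max |y - Y| w)) 0 y := by
          refine (hasDerivAt_const y (Real.log w)).congr_of_eventuallyEq ?_
          have : ∀ᶠ x in 𝓝 y, |x - Y| < w :=
            (by fun_prop : Continuous fun x : ℝ => |x - Y|).continuousAt.eventually_lt_const h
          filter_upwards [this] with x hx
          rw [max_eq_right hx.le]
        refine ((hd1.sub hd2).const_mul (1 / (2 * Y))).congr_deriv ?_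
        ring
      · have h' : w < |y - Y| := by
          refine lt_of_le_of_ne h fun he => ?_
          rcases abs_eq_abs.1 (he.symm.trans (abs_of_pos hw).symm) with h3 | h3
          · exact hys.2.2 (by linarith)
          · exact hys.1 (by linarith)
        rw [windowRest_of_le h]
        have hne : y - Y ≠ 0 := sub_ne_zero.2 hys.2.1
        have hd1 : HasDerivAt (fun y => Real.log (max |y - Y| w)) (1 / (y - Y)) y := by
          refine (((hasDerivAt_id y).sub_const Y).log hne).congr_of_eventuallyEq ?_
          have : ∀ᶠ x in 𝓝 y, w < |x - Y| :=
            (by fun_prop : Continuous fun x : ℝ => |x - Y|).continuousAt.eventually_const_lt h'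
          filter_upwards [this] with x hx
          rw [max_eq_left hx.le, Real.log_abs, id]
        refine ((hd1.sub hd2).const_mul (1 / (2 * Y))).congr_deriv ?_
        have h4 : y + Y ≠ 0 := by positivity
        rw [show y ^ 2 - Y ^ 2 = (y - Y) * (y + Y) by ring]
        field_simp
        ring
    · rw [intervalIntegrable_iff_integrableOn_Ioc_of_le hb.le]
      exact hint.mono_set Set.Ioc_subset_Ioi_self
  have hΦ0 : Φ 0 = 0 := by
    simp only [hΦ]
    rw [zero_sub, abs_neg, abs_of_pos hY0, max_eq_left (by linarith), zero_add, sub_self, mul_zero]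
  have hlim : Tendsto Φ atTop (𝓝 0) := by
    have h1 : Tendsto (fun y : ℝ => 1 - 2 * Y / (y + Y)) atTop (𝓝 (1 - 0)) :=
      (Tendsto.const_div_atTop (tendsto_atTop_add_const_right _ _ tendsto_id) _).const_sub 1
    rw [sub_zero] at h1
    have h2 := (h1.log one_ne_zero).const_mul (1 / (2 * Y))
    rw [Real.log_one, mul_zero] at h2
    refine h2.congr' ?_
    filter_upwards [eventually_gt_atTop (Y + w)] with y hy
    have h3 : 0 < y - Y := by linarith
    have h4 : 0 < y + Y := by linarith
    simp only [hΦ]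
    rw [abs_of_pos h3, max_eq_left (by linarith), ← Real.log_div h3.ne' h4.ne']
    congr 2
    field_simp
    ring
  refine tendsto_nhds_unique (intervalIntegral_tendsto_integral_Ioi 0 hint tendsto_id) ?_
  refine hlim.congr' ?_
  filter_upwards [eventually_gt_atTop 0] with b hb
  rw [id, hFTC b hb, hΦ0, sub_zero]

/-! ### The poles and the cut domain of integration -/

/-- The pole `2(n+1)πr`. -/
def linePole (r : ℝ) (n : ℕ) : ℝ := 2 * ((n : ℝ) + 1) * Real.pi * r

/-- The domain of integration with `ε`-neighbourhoods of the poles removed. -/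
def cutSet (r ε : ℝ) : Set ℝ := {y : ℝ | 0 < y ∧ ∀ s ∈ linePoles r, ε < |y - s|}

theorem mem_cutSet {r ε y : ℝ} : y ∈ cutSet r ε ↔ 0 < y ∧ ∀ n, ε < |y - linePole r n| := by
  constructor
  · rintro ⟨h1, h2⟩
    exact ⟨h1, fun n => h2 _ ⟨n, rfl⟩⟩
  · rintro ⟨h1, h2⟩
    exact ⟨h1, by rintro s ⟨n, rfl⟩; exact h2 n⟩

theorem measurableSet_cutSet (r ε : ℝ) : MeasurableSet (cutSet r ε) := by
  have : cutSet r ε = Set.Ioi 0 ∩ ⋂ n, {y | ε < |y - linePole r n|} := by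
    ext y
    rw [mem_cutSet]
    simp
  rw [this]
  exact measurableSet_Ioi.inter (MeasurableSet.iInter fun n =>
    measurableSet_lt measurable_const (by fun_prop))

theorem cutSet_subset (r ε : ℝ) : cutSet r ε ⊆ Set.Ioi 0 := fun _ hy => hy.1

theorem linePole_pos {r : ℝ} (hr : 0 < r) (n : ℕ) : 0 < linePole r n := by
  unfold linePole; positivity

theorem two_mul_le_linePole {r : ℝ} (hr : 0 < r) (n : ℕ) : 2 * (Real.pi * r) ≤ linePole r n := by
  unfold linePole
  have : 0 < Real.pi * r := by positivity
  nlinarith [n.cast_nonneg (α := ℝ)]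

theorem succ_mul_le_linePole {r : ℝ} (hr : 0 < r) (n : ℕ) : ((n : ℝ) + 1) * r ≤ linePole r n := by
  unfold linePole
  have h : 1 ≤ 2 * Real.pi := by linarith [Real.pi_gt_three]
  have : 0 < ((n : ℝ) + 1) * r := by positivity
  nlinarith

theorem two_mul_le_abs_linePole_sub {r : ℝ} (hr : 0 < r) {m n : ℕ} (h : m ≠ n) :
    2 * (Real.pi * r) ≤ |linePole r m - linePole r n| := by
  have h1 : linePole r m - linePole r n = 2 * (Real.pi * r) * (((m : ℤ) - n : ℤ) : ℝ) := by
    unfold linePole; push_cast; ring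
  have h2 : (1 : ℝ) ≤ |(((m : ℤ) - n : ℤ) : ℝ)| := by
    rw [← Int.cast_abs, ← Int.cast_one, Int.cast_le]
    exact Int.one_le_abs (sub_ne_zero.2 (Nat.cast_injective.ne h))
  rw [h1, abs_mul, abs_of_pos (by positivity)]
  exact le_mul_of_one_le_right (by positivity) h2

/-- One ε must work for all poles at once; the distance of y/2πr to its nearest integer provides it.
-/
theorem eventually_mem_cutSet {r y : ℝ} (hr : 0 < r) (hy : 0 < y) (hne : ∀ n, y ≠ linePole r n) :
    ∀ᶠ ε in 𝓝[>] (0 : ℝ), y ∈ cutSet r ε := by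
  have hw : 0 < 2 * Real.pi * r := by positivity
  set x := y / (2 * Real.pi * r) with hx
  have hxy : y = x * (2 * Real.pi * r) := by rw [hx]; field_simp
  have hx0 : 0 < x := by positivity
  have hpos : 0 < |x - round x| := by
    rw [abs_pos, sub_ne_zero]
    intro h
    have h1 : (0 : ℝ) < (round x : ℤ) := by rw [← h]; exact hx0
    have h2 : 0 < round x := by exact_mod_cast h1
    obtain ⟨k, hk⟩ := Int.eq_ofNat_of_zero_le h2.le
    have hk1 : 1 ≤ k := by omega
    apply hne (k - 1)
    rw [hk, Int.cast_natCast] at h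
    rw [linePole, hxy, h]
    push_cast [hk1]
    ring
  filter_upwards [nhdsWithin_le_nhds (Iio_mem_nhds (mul_pos hw hpos))] with ε hε
  refine mem_cutSet.2 ⟨hy, fun n => lt_of_lt_of_le hε ?_⟩
  have h1 : y - linePole r n = (2 * Real.pi * r) * (x - ((n + 1 : ℤ) : ℝ)) := by
    rw [linePole, hxy]; push_cast; ring
  rw [h1, abs_mul, abs_of_pos hw]
  exact mul_le_mul_of_nonneg_left (round_le x (n + 1)) hw.le

theorem ae_ne_linePole (r : ℝ) : ∀ᵐ y : ℝ, ∀ n, y ≠ linePole r n :=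
  ae_all_iff.2 fun n => Measure.ae_ne volume (linePole r n)

theorem tendsto_integral_cutSet {r : ℝ} (hr : 0 < r) {h : ℝ → ℝ}
    (hi : IntegrableOn h (Set.Ioi 0)) :
    Tendsto (fun ε => ∫ y in cutSet r ε, h y) (𝓝[>] 0) (𝓝 (∫ y in Set.Ioi (0 : ℝ), h y)) := by
  have h1 : ∀ ε, ∫ y in cutSet r ε, h y = ∫ y in Set.Ioi (0 : ℝ), (cutSet r ε).indicator h y := by
    intro ε
    rw [setIntegral_indicator (measurableSet_cutSet r ε),
      Set.inter_eq_self_of_subset_right (cutSet_subset r ε)]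
  simp_rw [h1]
  refine tendsto_integral_filter_of_dominated_convergence (fun y => ‖h y‖)
    (Eventually.of_forall fun ε => hi.aestronglyMeasurable.indicator (measurableSet_cutSet r ε))
    (Eventually.of_forall fun ε => ae_of_all _ fun y => norm_indicator_le_norm_self _ _) hi.norm ?_
  filter_upwards [ae_restrict_of_ae (ae_ne_linePole r), ae_restrict_mem measurableSet_Ioi]
    with y hy hy0
  refine tendsto_const_nhds.congr' ?_
  filter_upwards [eventually_mem_cutSet hr hy0 hy] with ε hε
  rw [Set.indicator_of_mem hε]

/-- The window radius πr is half the spacing of the poles. Inside the window the other poles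
therefore impose no further condition, the cut domain is symmetric about Y, and the kernel is odd
under y ↦ 2Y − y. -/
theorem setIntegral_cutSet_windowKernel {r : ℝ} (hr : 0 < r) (ε : ℝ) (n : ℕ) :
    ∫ y in cutSet r ε, windowKernel (Real.pi * r) (linePole r n) y = 0 := by
  set Y := linePole r n with hY
  set w := Real.pi * r with hw
  have hw0 : 0 < w := by positivity
  set h : ℝ → ℝ := fun y => if ε < |y - Y| ∧ |y - Y| < w then 1 / (2 * Y * (y - Y)) else 0 with hh
  classical
  have hind : (cutSet r ε).indicator (windowKernel w Y) = h := by
    funext y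
    rw [Set.indicator_apply, windowKernel]
    simp only [hh]
    by_cases h2 : |y - Y| < w
    · have hiff : y ∈ cutSet r ε ↔ ε < |y - Y| := by
        rw [mem_cutSet]
        refine ⟨fun h3 => h3.2 n, fun h3 => ⟨?_, fun m => ?_⟩⟩
        · have := two_mul_le_linePole hr n
          have := (abs_lt.1 h2).1
          linarith
        · rcases eq_or_ne m n with rfl | hmn
          · exact h3
          · have h4 := two_mul_le_abs_linePole_sub hr hmn
            have h5 := abs_sub_le (linePole r m) y Y
            rw [abs_sub_comm _ y] at h5
            linarith
      simp [hiff, h2]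
    · simp [h2]
  rw [← integral_indicator (measurableSet_cutSet r ε), hind]
  have hodd : ∀ y, h (2 * Y - y) = -h y := by
    intro y
    simp only [hh]
    have h1 : 2 * Y - y - Y = -(y - Y) := by ring
    rw [h1, abs_neg]
    split_ifs
    · rw [mul_neg, div_neg]
    · simp
  have := integral_sub_left_eq_self h volume (2 * Y)
  simp_rw [hodd] at this
  rw [integral_neg] at this
  linarith

theorem lineTerm_eq (N : ℕ) (r y : ℝ) (n : ℕ) :
    lineTerm N r y n = 1 / (((n : ℝ) + 1) ^ (2 * N - 2) * (y ^ 2 - linePole r n ^ 2)) := by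
  rw [lineTerm, linePole]
  ring_nf

theorem summable_lineTerm (N : ℕ) {r : ℝ} (hr : 0 < r) (y : ℝ) : Summable (lineTerm N r y) := by
  refine Summable.of_norm_bounded_eventually_nat (summable_inv_succ_sq.mul_left (2 / r ^ 2)) ?_
  filter_upwards [eventually_ge_atTop ⌈2 * |y| / r⌉₊] with n hn
  have h1 : 2 * |y| ≤ linePole r n := by
    have h2 := Nat.ceil_le.1 hn
    rw [div_le_iff₀ hr] at h2
    have := succ_mul_le_linePole hr n
    nlinarith
  have h3 : (((n : ℝ) + 1) * r) ^ 2 ≤ linePole r n ^ 2 := by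
    gcongr
    exact succ_mul_le_linePole hr n
  have h4 : linePole r n ^ 2 / 2 ≤ |y ^ 2 - linePole r n ^ 2| := by
    have h5 : y ^ 2 ≤ linePole r n ^ 2 / 4 := by
      rw [← sq_abs y]; nlinarith [abs_nonneg y]
    rw [abs_sub_comm, abs_of_nonneg (by nlinarith [sq_nonneg (linePole r n)])]
    nlinarith [sq_nonneg (linePole r n)]
  rw [lineTerm_eq, norm_div, norm_one, norm_mul, norm_pow, Real.norm_eq_abs, Real.norm_eq_abs,
    abs_of_pos (by positivity : 0 < (n : ℝ) + 1)]
  have h6 : (1 : ℝ) ≤ ((n : ℝ) + 1) ^ (2 * N - 2) :=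
    one_le_pow₀ (by linarith [n.cast_nonneg (α := ℝ)])
  calc _ ≤ 1 / (1 * ((((n : ℝ) + 1) * r) ^ 2 / 2)) := by
        gcongr
        linarith
    _ = _ := by field_simp

/-- A majorant integrable in y and summable over the poles. Near Y the denominator only gives
1/(εY); the second factor 1/Y comes from half of the exponential, as y > Y/2 there. -/
theorem abs_exp_div_le {Y y ε : ℝ} (hε : 0 < ε) (hY : 0 < Y) (hy : 0 < y) (h : ε < |y - Y|) :
    |Real.exp (-y) * (1 / (y ^ 2 - Y ^ 2))| ≤ Real.exp (-(1 / 2) * y) * ((2 + 4 / ε) * (1 / Y ^ 2)) := by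
  have hfac : |y ^ 2 - Y ^ 2| = |y - Y| * (y + Y) := by
    rw [show y ^ 2 - Y ^ 2 = (y - Y) * (y + Y) by ring, abs_mul, abs_of_pos (by linarith : 0 < y + Y)]
  rw [abs_mul, Real.abs_exp, abs_div, abs_one, hfac]
  rcases le_or_gt (Y / 2) |y - Y| with h1 | h1
  · calc _ ≤ Real.exp (-(1 / 2) * y) * (1 / (Y / 2 * Y)) := by
          gcongr
          · linarith
          · linarith
      _ = Real.exp (-(1 / 2) * y) * (2 * (1 / Y ^ 2)) := by field_simp
      _ ≤ _ := by gcongr; linarith [show 0 < 4 / ε by positivity]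
  · have h2 : Y / 2 < y := by linarith [(abs_lt.1 h1).1]
    have h3 : Real.exp (-y) ≤ Real.exp (-(1 / 2) * y) * (4 / Y) := by
      have h4 : Real.exp (-(Y / 4)) ≤ 4 / Y := by
        have := exp_neg_le_one_div (x := Y / 4) (by positivity)
        rwa [one_div_div] at this
      calc Real.exp (-y) ≤ Real.exp (-(1 / 2) * y + -(Y / 4)) := Real.exp_le_exp.2 (by linarith)
        _ = Real.exp (-(1 / 2) * y) * Real.exp (-(Y / 4)) := Real.exp_add _ _
        _ ≤ _ := by gcongr
    calc _ ≤ Real.exp (-(1 / 2) * y) * (4 / Y) * (1 / (ε * Y)) := by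
          gcongr
          linarith
      _ = Real.exp (-(1 / 2) * y) * (4 / ε * (1 / Y ^ 2)) := by field_simp
      _ ≤ _ := by gcongr; linarith

/-! ### Splitting off the singular part; the principal value for N = 1 -/

theorem regKernel_scale (a r t : ℝ) :
    regKernel 1 (a * r) (a * t) = 1 / a ^ 2 * regKernel a r t := by
  rw [regKernel, regKernel, show (a * t) ^ 2 - (a * r) ^ 2 = a ^ 2 * (t ^ 2 - r ^ 2) by ring,
    show -1 * (a * t) = -a * t by ring, show -1 * (a * r) = -a * r by ring,
    div_mul_div_comm, one_mul]

theorem integral_regKernel_scale {a : ℝ} (ha : 0 < a) (r : ℝ) :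
    ∫ y in Set.Ioi (0 : ℝ), regKernel 1 (a * r) y
      = 1 / a * ∫ t in Set.Ioi (0 : ℝ), regKernel a r t := by
  have := integral_comp_mul_left_Ioi' (fun y => regKernel 1 (a * r) y) 0 ha
  rw [mul_zero] at this
  rw [← this]
  simp_rw [regKernel_scale]
  rw [integral_const_mul, smul_eq_mul, ← mul_assoc]
  congr 1
  field_simp

theorem integral_abs_regKernel_scale {a : ℝ} (ha : 0 < a) (r : ℝ) :
    ∫ y in Set.Ioi (0 : ℝ), |regKernel 1 (a * r) y|
      = 1 / a * ∫ t in Set.Ioi (0 : ℝ), |regKernel a r t| := by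
  have := integral_comp_mul_left_Ioi' (fun y => |regKernel 1 (a * r) y|) 0 ha
  rw [mul_zero] at this
  rw [← this]
  simp_rw [regKernel_scale, abs_mul]
  rw [integral_const_mul, smul_eq_mul, ← mul_assoc, abs_of_pos (by positivity)]
  congr 1
  field_simp

theorem linePole_eq (r : ℝ) (n : ℕ) : linePole r n = 2 * Real.pi * ((n : ℝ) + 1) * r := by
  rw [linePole]; ring

/-- The `n`-th term of the integrand on the Stokes line without its singular part. -/
def lineRegular (r : ℝ) (n : ℕ) (y : ℝ) : ℝ :=
  regKernel 1 (linePole r n) y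
    + Real.exp (-linePole r n) * windowRest (Real.pi * r) (linePole r n) y

theorem exp_mul_eq_lineRegular (r : ℝ) (n : ℕ) (y : ℝ) :
    Real.exp (-y) * (1 / (y ^ 2 - linePole r n ^ 2)) = lineRegular r n y
      + Real.exp (-linePole r n) * windowKernel (Real.pi * r) (linePole r n) y := by
  rw [lineRegular, windowRest, regKernel, neg_one_mul, neg_one_mul]
  ring

theorem integrableOn_lineRegular {r : ℝ} (hr : 0 < r) (n : ℕ) :
    IntegrableOn (lineRegular r n) (Set.Ioi 0) :=
  (integrableOn_regKernel le_rfl (linePole_pos hr n)).add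
    ((integrableOn_windowRest (by positivity) (two_mul_le_linePole hr n)).const_mul _)

theorem integral_lineRegular {r : ℝ} (hr : 0 < r) (n : ℕ) :
    ∫ y in Set.Ioi (0 : ℝ), lineRegular r n y = 1 / (2 * Real.pi * ((n : ℝ) + 1)) *
      ∫ t in Set.Ioi (0 : ℝ), regKernel (2 * Real.pi * ((n : ℝ) + 1)) r t := by
  unfold lineRegular
  rw [integral_add (integrableOn_regKernel le_rfl (linePole_pos hr n))
    ((integrableOn_windowRest (by positivity) (two_mul_le_linePole hr n)).const_mul _),
    integral_const_mul, integral_windowRest (by positivity) (two_mul_le_linePole hr n), mul_zero,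
    add_zero, linePole_eq, integral_regKernel_scale (by positivity)]

theorem exp_neg_le_div_pow_four {x : ℝ} (hx : 0 < x) : Real.exp (-x) ≤ 24 / x ^ 4 := by
  have h := Real.pow_div_factorial_le_exp x hx.le 4
  rw [Real.exp_neg, inv_le_comm₀ (Real.exp_pos _) (by positivity), inv_div]
  simpa [Nat.factorial] using h

/-- The regularized kernel contributes O(1/n²) after scaling. For the rest, e^{−Y} ≤ 24/Y⁴ beats the
growth Y² and leaves 1/Y². -/
theorem summable_integral_abs_lineRegular {r : ℝ} (hr : 0 < r) :
    Summable fun n : ℕ => ∫ y in Set.Ioi (0 : ℝ), |lineRegular r n y| := by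
  obtain ⟨C, hC, h⟩ := exists_integral_abs_regKernel_le hr
  set w : ℝ := Real.pi * r with hw
  have hw0 : 0 < w := by positivity
  set K : ℝ := 24 * (2 + 1 / w ^ 2) * (4 + 1 / w ^ 2) * Real.pi / r ^ 2 with hK
  refine Summable.of_nonneg_of_le (fun n => integral_nonneg fun y => abs_nonneg _) (fun n => ?_)
    (summable_inv_succ_sq.mul_left (C + K))
  set Y := linePole r n with hY
  have hY0 : 0 < Y := linePole_pos hr n
  have hwY : 2 * w ≤ Y := two_mul_le_linePole hr n
  have hnY : ((n : ℝ) + 1) * r ≤ Y := succ_mul_le_linePole hr n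
  have hreg := integrableOn_regKernel le_rfl hY0
  have ha := one_le_two_pi_mul_succ n
  have ha1 : (n : ℝ) + 1 ≤ 2 * Real.pi * ((n : ℝ) + 1) := by
    nlinarith [Real.pi_gt_three, n.cast_nonneg (α := ℝ)]
  calc ∫ y in Set.Ioi (0 : ℝ), |lineRegular r n y|
      ≤ ∫ y in Set.Ioi (0 : ℝ), (|regKernel 1 Y y| + Real.exp (-Y) * |windowRest w Y y|) := by
        refine setIntegral_mono_on (integrableOn_lineRegular hr n).norm
          (hreg.norm.add ((integrableOn_windowRest hw0 hwY).norm.const_mul _)) measurableSet_Ioi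
          fun y _ => (abs_add_le _ _).trans (le_of_eq ?_)
        rw [abs_mul, Real.abs_exp]
    _ = (∫ y in Set.Ioi (0 : ℝ), |regKernel 1 Y y|)
        + Real.exp (-Y) * ∫ y in Set.Ioi (0 : ℝ), |windowRest w Y y| := by
        have h1 : IntegrableOn (fun y => |regKernel 1 Y y|) (Set.Ioi 0) := hreg.norm
        have h2 : IntegrableOn (fun y => Real.exp (-Y) * |windowRest w Y y|) (Set.Ioi 0) :=
          (integrableOn_windowRest hw0 hwY).norm.const_mul _
        rw [integral_add h1 h2, integral_const_mul]
    _ ≤ 1 / ((n : ℝ) + 1) * (C / ((n : ℝ) + 1))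
        + 24 / Y ^ 4 * ((2 + 1 / w ^ 2) * (Y ^ 2 * (4 + 1 / w ^ 2)) * Real.pi) := by
        refine add_le_add ?_ (mul_le_mul (exp_neg_le_div_pow_four hY0)
          ((integral_abs_windowRest_le hw0 hwY).trans ?_) (integral_nonneg fun y => abs_nonneg _)
          (by positivity))
        · rw [hY, linePole_eq, integral_abs_regKernel_scale (by positivity)]
          gcongr
          refine (h _ ha).trans ?_
          gcongr
        · gcongr
          have h1 : 1 ≤ Y ^ 2 * (1 / w ^ 2) := by
            rw [mul_one_div, one_le_div (by positivity)]; nlinarith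
          linarith
    _ = C * (1 / ((n : ℝ) + 1) ^ 2) + 24 * (2 + 1 / w ^ 2) * (4 + 1 / w ^ 2) * Real.pi / Y ^ 2 := by
        field_simp
    _ ≤ C * (1 / ((n : ℝ) + 1) ^ 2)
        + 24 * (2 + 1 / w ^ 2) * (4 + 1 / w ^ 2) * Real.pi / (((n : ℝ) + 1) * r) ^ 2 := by
        gcongr
    _ = _ := by rw [hK]; field_simp

theorem measurable_lineTerm (N : ℕ) (r : ℝ) (n : ℕ) : Measurable fun y => lineTerm N r y n := by
  unfold lineTerm; fun_prop

theorem measurable_lineIntegrand (N : ℕ) (r : ℝ) : Measurable (lineIntegrand N r) := by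
  have := Measurable.tsum (L := SummationFilter.unconditional ℕ)
    (fun n => measurable_lineTerm N r n)
  unfold lineIntegrand
  fun_prop

theorem lineIntegrand_one (r y : ℝ) : lineIntegrand 1 r y
    = ∑' n : ℕ, Real.exp (-y) * (1 / (y ^ 2 - linePole r n ^ 2)) := by
  rw [lineIntegrand, tsum_mul_left]
  congr 1
  · simp
  · exact tsum_congr fun n => by rw [lineTerm_eq]; simp

theorem integrableOn_cutSet_term {r ε : ℝ} (hr : 0 < r) (hε : 0 < ε) (n : ℕ) :
    IntegrableOn (fun y => Real.exp (-y) * (1 / (y ^ 2 - linePole r n ^ 2))) (cutSet r ε) := by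
  refine Integrable.mono' (((integrableOn_exp_neg_mul (b := 1 / 2) (by norm_num)).mono_set
    (cutSet_subset r ε)).mul_const ((2 + 4 / ε) * (1 / linePole r n ^ 2)))
    (Measurable.aestronglyMeasurable (by fun_prop))
    ((ae_restrict_iff' (measurableSet_cutSet r ε)).2 (ae_of_all _ fun y hy => ?_))
  exact abs_exp_div_le hε (linePole_pos hr n) hy.1 ((mem_cutSet.1 hy).2 n)

theorem summable_cut_bound {r : ℝ} (hr : 0 < r) {c : ℝ} (hc : 0 < c) :
    Summable fun n : ℕ => c * (1 / linePole r n ^ 2) := by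
  refine Summable.of_nonneg_of_le (fun n => by positivity) (fun n => ?_)
    (summable_inv_succ_sq.mul_left (c / r ^ 2))
  calc _ ≤ c * (1 / (((n : ℝ) + 1) * r) ^ 2) := by gcongr; exact succ_mul_le_linePole hr n
    _ = _ := by field_simp

theorem setIntegral_cutSet_term {r ε : ℝ} (hr : 0 < r) (hε : 0 < ε) (n : ℕ) :
    ∫ y in cutSet r ε, Real.exp (-y) * (1 / (y ^ 2 - linePole r n ^ 2))
      = ∫ y in cutSet r ε, lineRegular r n y := by
  have h1 := integrableOn_cutSet_term hr hε n
  have h2 := (integrableOn_lineRegular hr n).mono_set (cutSet_subset r ε)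
  have h3 : IntegrableOn (fun y => Real.exp (-linePole r n) *
      windowKernel (Real.pi * r) (linePole r n) y) (cutSet r ε) := by
    refine (h1.sub h2).congr (ae_of_all _ fun y => ?_)
    simp only [Pi.sub_apply, exp_mul_eq_lineRegular]
    ring
  simp_rw [exp_mul_eq_lineRegular]
  rw [integral_add h2 h3, integral_const_mul, setIntegral_cutSet_windowKernel hr, mul_zero,
    add_zero]

/-- For fixed ε > 0 sum and integral commute and each singular part integrates to 0. What remains is
integrable on the whole half-line with summable norms, so ε → 0 passes through the sum. -/
theorem hasPrincipalValue_one {r : ℝ} (hr : 0 < r) :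
    HasPrincipalValue (lineIntegrand 1 r) (linePoles r) (linePV r) := by
  have hbd : ∀ (ε : ℝ), 0 < ε → ∀ n : ℕ, ∀ y ∈ cutSet r ε,
      ‖Real.exp (-y) * (1 / (y ^ 2 - linePole r n ^ 2))‖ ≤
        Real.exp (-(1 / 2) * y) * ((2 + 4 / ε) * (1 / linePole r n ^ 2)) := fun ε hε n y hy =>
    abs_exp_div_le hε (linePole_pos hr n) hy.1 ((mem_cutSet.1 hy).2 n)
  have hexp : ∀ ε : ℝ, IntegrableOn (fun y : ℝ => Real.exp (-(1 / 2) * y)) (cutSet r ε) := fun ε =>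
    (integrableOn_exp_neg_mul (b := 1 / 2) (by norm_num)).mono_set (cutSet_subset r ε)
  refine ⟨fun ε hε => ?_, ?_⟩
  · have hsum := summable_cut_bound hr (c := 2 + 4 / ε) (by positivity)
    refine Integrable.mono' ((hexp ε).mul_const (∑' n, (2 + 4 / ε) * (1 / linePole r n ^ 2)))
      (measurable_lineIntegrand 1 r).aestronglyMeasurable
      ((ae_restrict_iff' (measurableSet_cutSet r ε)).2 (ae_of_all _ fun y hy => ?_))
    rw [lineIntegrand_one]
    exact tsum_of_norm_bounded (hsum.hasSum.mul_left _) fun n => hbd ε hε n y hy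
  · have hsum : ∀ ε : ℝ, 0 < ε →
        ∫ y in cutSet r ε, lineIntegrand 1 r y = ∑' n, ∫ y in cutSet r ε, lineRegular r n y := by
      intro ε hε
      have hs := summable_cut_bound hr (c := 2 + 4 / ε) (by positivity)
      simp_rw [lineIntegrand_one]
      rw [← integral_tsum_of_summable_integral_norm (integrableOn_cutSet_term hr hε)]
      · exact tsum_congr fun n => setIntegral_cutSet_term hr hε n
      · refine Summable.of_nonneg_of_le (fun n => integral_nonneg fun y => norm_nonneg _)
          (fun n => ?_) (hs.mul_left (∫ y in cutSet r ε, Real.exp (-(1 / 2) * y)))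
        rw [← integral_mul_const]
        exact setIntegral_mono_on (integrableOn_cutSet_term hr hε n).norm ((hexp ε).mul_const _)
          (measurableSet_cutSet r ε) (hbd ε hε n)
    have hlim : Tendsto (fun ε => ∑' n, ∫ y in cutSet r ε, lineRegular r n y) (𝓝[>] 0)
        (𝓝 (∑' n, ∫ y in Set.Ioi (0 : ℝ), lineRegular r n y)) := by
      refine tendsto_tsum_of_dominated_convergence (summable_integral_abs_lineRegular hr)
        (fun n => tendsto_integral_cutSet hr (integrableOn_lineRegular hr n))
        (Eventually.of_forall fun ε n => (norm_integral_le_integral_norm _).trans ?_)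
      exact setIntegral_mono_set (integrableOn_lineRegular hr n).norm
        (ae_of_all _ fun y => norm_nonneg _) (LE.le.eventuallyLE (cutSet_subset r ε))
    have hP : ∑' n, ∫ y in Set.Ioi (0 : ℝ), lineRegular r n y = linePV r :=
      tsum_congr fun n => integral_lineRegular hr n
    rw [hP] at hlim
    refine hlim.congr' ?_
    filter_upwards [self_mem_nhdsWithin] with ε hε
    exact (hsum ε hε).symm

/-! ### Recursion in the truncation index, on a Stokes line -/

/-- The geometric step again, as y²/(y² − Y²) = 1 + Y²/(y² − Y²) with Y = 2πr(n+1). -/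
theorem lineIntegrand_succ (m : ℕ) {r : ℝ} (hr : 0 < r) {y : ℝ} (hy0 : 0 < y)
    (hy : ∀ n, y ≠ linePole r n) :
    lineIntegrand (m + 2) r y
      = y ^ (2 * m) * Real.exp (-y) * (∑' n : ℕ, 1 / ((n : ℝ) + 1) ^ (2 * (m + 1)))
      + (2 * Real.pi * r) ^ 2 * lineIntegrand (m + 1) r y := by
  have hs : Summable fun n : ℕ => 1 / ((n : ℝ) + 1) ^ (2 * (m + 1)) := by
    have := (summable_nat_add_iff 1).2
      (Real.summable_one_div_nat_pow.2 (show 1 < 2 * (m + 1) by omega))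
    simpa using this
  have hterm : ∀ n : ℕ, y ^ 2 * lineTerm (m + 2) r y n = 1 / ((n : ℝ) + 1) ^ (2 * (m + 1))
      + (2 * Real.pi * r) ^ 2 * lineTerm (m + 1) r y n := by
    intro n
    have h1 : y ^ 2 - linePole r n ^ 2 ≠ 0 := by
      rw [sub_ne_zero]
      intro h
      exact hy n ((sq_eq_sq₀ hy0.le (linePole_pos hr n).le).1 h)
    have h2 : linePole r n = (2 * Real.pi * r) * ((n : ℝ) + 1) := by rw [linePole]; ring
    have h3 : (n : ℝ) + 1 ≠ 0 := by positivity
    rw [lineTerm_eq, lineTerm_eq, show 2 * (m + 2) - 2 = 2 * m + 2 by omega,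
      show 2 * (m + 1) - 2 = 2 * m by omega, show 2 * (m + 1) = 2 * m + 2 by ring, pow_add _ (2 * m) 2]
    rw [h2] at h1 ⊢
    generalize hD : y ^ 2 - (2 * Real.pi * r * ((n : ℝ) + 1)) ^ 2 = D at h1 ⊢
    rw [sub_eq_iff_eq_add.1 hD]
    field_simp
  rw [lineIntegrand, lineIntegrand, show 2 * (m + 2) - 2 = 2 * m + 2 by omega,
    show 2 * (m + 1) - 2 = 2 * m by omega, pow_add]
  have := (hs.tsum_add ((summable_lineTerm (m + 1) hr y).mul_left ((2 * Real.pi * r) ^ 2)))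
  rw [← tsum_congr hterm, tsum_mul_left, tsum_mul_left] at this
  linear_combination (y ^ (2 * m) * Real.exp (-y)) * this

theorem HasPrincipalValue.succ {m : ℕ} {r : ℝ} (hr : 0 < r) {P : ℝ}
    (h : HasPrincipalValue (lineIntegrand (m + 1) r) (linePoles r) P) :
    HasPrincipalValue (lineIntegrand (m + 2) r) (linePoles r)
      ((Nat.factorial (2 * m) : ℝ) * (∑' n : ℕ, 1 / ((n : ℝ) + 1) ^ (2 * (m + 1)))
        + (2 * Real.pi * r) ^ 2 * P) := by
  set ζ := ∑' n : ℕ, 1 / ((n : ℝ) + 1) ^ (2 * (m + 1))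
  have hφ : IntegrableOn (fun y : ℝ => y ^ (2 * m) * Real.exp (-y) * ζ) (Set.Ioi 0) :=
    (integrableOn_pow_mul_exp_neg (2 * m)).mul_const ζ
  have hae : ∀ ε, ∀ᵐ y ∂(volume.restrict (cutSet r ε)), y ^ (2 * m) * Real.exp (-y) * ζ
      + (2 * Real.pi * r) ^ 2 * lineIntegrand (m + 1) r y = lineIntegrand (m + 2) r y := by
    intro ε
    filter_upwards [ae_restrict_of_ae (ae_ne_linePole r),
      ae_restrict_mem (measurableSet_cutSet r ε)] with y h1 h2
    exact (lineIntegrand_succ m hr h2.1 h1).symm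
  have h1 : ∀ ε, 0 < ε → IntegrableOn (lineIntegrand (m + 1) r) (cutSet r ε) := h.1
  refine ⟨fun ε hε => ?_, ?_⟩
  · exact ((hφ.mono_set (cutSet_subset r ε)).add ((h1 ε hε).const_mul _)).congr (hae ε)
  · have h2 := (tendsto_integral_cutSet hr hφ).add (h.2.const_mul ((2 * Real.pi * r) ^ 2))
    rw [integral_mul_const, integral_pow_mul_exp_neg] at h2
    refine h2.congr' ?_
    filter_upwards [self_mem_nhdsWithin] with ε hε
    change _ = ∫ y in cutSet r ε, lineIntegrand (m + 2) r y
    rw [← integral_congr_ae (hae ε), integral_add (hφ.mono_set (cutSet_subset r ε))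
      ((h1 ε hε).const_mul _), integral_const_mul]
    rfl

theorem tsum_ofReal_one_div_succ_pow (m : ℕ) :
    ((∑' n : ℕ, 1 / ((n : ℝ) + 1) ^ (2 * (m + 1)) : ℝ) : ℂ)
      = riemannZeta (2 * ((m + 1 : ℕ) : ℂ)) := by
  have := tsum_one_div_succ_pow (k := 2 * (m + 1)) (by omega)
  rw [Nat.cast_mul, Nat.cast_ofNat] at this
  rw [← this, Complex.ofReal_tsum]
  refine tsum_congr fun n => ?_
  push_cast
  rfl

/-- Truncating later only moves terms from the principal value to the series. -/
theorem exists_hasPrincipalValue (m : ℕ) {r : ℝ} (hr : 0 < r) {z : ℂ} (hz : z ^ 2 = -(r : ℂ) ^ 2) :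
    ∃ P : ℝ, HasPrincipalValue (lineIntegrand (m + 1) r) (linePoles r) P ∧
      truncatedSeries (m + 1) z + 2 * z / (2 * (Real.pi : ℂ) * (r : ℂ)) ^ (2 * (m + 1) - 2) * (P : ℂ)
        = 2 * z * (linePV r : ℂ) := by
  have hpi : (Real.pi : ℂ) ≠ 0 := by exact_mod_cast Real.pi_ne_zero
  have hrC : (r : ℂ) ≠ 0 := by exact_mod_cast hr.ne'
  induction m with
  | zero =>
    refine ⟨linePV r, hasPrincipalValue_one hr, ?_⟩
    rw [truncatedSeries_one]
    simp
  | succ m ih =>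
    obtain ⟨P, hP, heq⟩ := ih
    refine ⟨_, hP.succ hr, ?_⟩
    have hG : Complex.Gamma (2 * ((m + 1 : ℕ) : ℂ) - 1) = (Nat.factorial (2 * m) : ℂ) := by
      rw [← Complex.Gamma_nat_eq_factorial]
      congr 1
      push_cast
      ring
    -- On a Stokes line z² = −r², so the alternating sign of the truncated series disappears and all
    -- its terms carry the same sign.
    have hzp : (2 * z) ^ (2 * (m + 1)) = (-1) ^ (m + 1) * (2 * (r : ℂ)) ^ (2 * (m + 1)) := by
      rw [pow_mul, mul_pow, hz, pow_mul, ← mul_pow]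
      congr 1
      ring
    rw [← heq, truncatedSeries_succ, cosecantPoly_one, hG, hzp, Complex.ofReal_add,
      Complex.ofReal_mul, Complex.ofReal_mul, tsum_ofReal_one_div_succ_pow,
      show 2 * (m + 1 + 1) - 2 = 2 * m + 2 by omega, show 2 * (m + 1) - 2 = 2 * m by omega,
      show 2 * (m + 1) = 2 * m + 2 by ring, mul_pow (2 * (Real.pi : ℂ)), mul_pow (2 : ℂ) Real.pi,
      mul_pow (2 : ℂ) r]
    set ζ := riemannZeta (2 * ((m + 1 : ℕ) : ℂ))
    have h1 : ((-1 : ℂ)) ^ (m + 1) ≠ 0 := pow_ne_zero _ (by norm_num)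
    push_cast
    generalize (-1 : ℂ) ^ (m + 1) = s at *
    field_simp
    ring

/-! ### The exponential of the sector formula -/

theorem pt_add_two_pi (r θ : ℝ) : pt r (θ + 2 * Real.pi) = pt r θ := by
  rw [show θ + 2 * Real.pi = θ + Real.pi + Real.pi by ring, pt_add_pi, pt_add_pi, neg_neg]

theorem leading_add_two_pi (r θ : ℝ) :
    leading r (θ + 2 * Real.pi) = leading r θ + (pt r θ - 1 / 2) * (2 * Real.pi * Complex.I) := by
  have h2 : lnPt r (θ + 2 * Real.pi) = lnPt r θ + 2 * Real.pi * Complex.I := by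
    rw [lnPt, lnPt]; push_cast; ring
  rw [leading, leading, pt_add_two_pi, h2]
  ring

theorem exp_leading_add_binet_zero {r θ : ℝ} (hr : 0 < r) (h1 : -(Real.pi / 2) < θ)
    (h2 : θ < Real.pi / 2) :
    Complex.exp (leading r θ + binet (pt r θ)) = Complex.Gamma (pt r θ) := by
  have hre : 0 < (pt r θ).re := by
    rw [pt_re]; exact mul_pos hr (Real.cos_pos_of_mem_Ioo ⟨h1, h2⟩)
  rw [← logGamma_right hr h1 h2, exp_logGamma (notPole_of_re_pos hre)]

/-- The formula at −z, argument θ − π, divided into the reflection formula. Only exponentials occur,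
so θ may go beyond π. -/
theorem exp_leading_add_binet_one {r θ : ℝ} (hr : 0 < r) (h1 : Real.pi / 2 < θ)
    (h2 : θ < 3 * Real.pi / 2) (hnp : NotPole (pt r θ)) :
    Complex.exp (leading r θ + binet (pt r θ)) = Complex.Gamma (pt r θ) *
      (1 - Complex.exp (2 * Complex.I * Real.pi * pt r θ)) := by
  have h3 := exp_leading_add_binet_zero (θ := θ - Real.pi) hr (by linarith) (by linarith)
  have hre : 0 < (-pt r θ).re := by
    rw [← pt_sub_pi, pt_re]
    exact mul_pos hr (Real.cos_pos_of_mem_Ioo ⟨by linarith, by linarith⟩)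
  have hnp' := notPole_of_re_pos hre
  have h4 := exp_leading_add_leading_sub_pi hr θ
  rw [← Gamma_mul_Gamma_neg hnp hnp', Complex.exp_add] at h4
  rw [pt_sub_pi, binet_neg, Complex.exp_add, Complex.exp_neg] at h3
  have h5 : Complex.Gamma (-pt r θ) ≠ 0 := Complex.Gamma_ne_zero hnp'
  have h6 := Complex.exp_ne_zero (binet (pt r θ))
  rw [← div_eq_mul_inv, div_eq_iff h6] at h3
  rw [Complex.exp_add]
  apply mul_left_cancel₀ h5
  rw [h3] at h4
  linear_combination h4

/-- `leading + binet` is a logarithm of `Γ(z)` up to the exponentials of the Stokes terms. -/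
theorem exp_leading_add_binet (M : ℕ) {r θ : ℝ} (hr : 0 < r) (h1 : ((M : ℝ) - 1 / 2) * Real.pi < θ)
    (h2 : θ < ((M : ℝ) + 1 / 2) * Real.pi) (hnp : NotPole (pt r θ)) :
    Complex.exp (leading r θ + binet (pt r θ)) = Complex.Gamma (pt r θ) *
      (-Complex.exp (2 * Complex.I * Real.pi * pt r θ)) ^ (M / 2) *
      (1 - Complex.exp (2 * Complex.I * Real.pi * pt r θ)) ^ (M % 2) := by
  induction M using Nat.twoStepInduction generalizing θ with
  | zero =>
    norm_num at h1 h2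
    simpa using exp_leading_add_binet_zero hr (by linarith) (by linarith)
  | one =>
    norm_num at h1 h2
    simpa using exp_leading_add_binet_one hr (by linarith) (by linarith) hnp
  | more M ih _ =>
    push_cast at h1 h2
    have hθ := pt_add_two_pi r (θ - 2 * Real.pi)
    rw [sub_add_cancel] at hθ
    have h := ih (θ := θ - 2 * Real.pi) (by linarith) (by linarith) (by rwa [← hθ])
    -- Two sectors up is the same z on the next sheet: only the leading terms change, and their
    -- exponential gains the factor −e^{2πiz}.
    have hl := leading_add_two_pi r (θ - 2 * Real.pi)
    rw [sub_add_cancel] at hl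
    have he : Complex.exp ((pt r θ - 1 / 2) * (2 * Real.pi * Complex.I))
        = -Complex.exp (2 * Complex.I * Real.pi * pt r θ) := by
      rw [show (pt r θ - 1 / 2) * (2 * Real.pi * Complex.I)
        = 2 * Complex.I * Real.pi * pt r θ - Real.pi * Complex.I by ring, Complex.exp_sub,
        Complex.exp_pi_mul_I, div_neg, div_one]
    rw [← hθ] at h hl
    rw [show (M + 2) / 2 = M / 2 + 1 by omega, Nat.add_mod_right, pow_succ, hl,
      add_right_comm, Complex.exp_add, h, he]
    ring

theorem notPole_conj {z : ℂ} (h : NotPole z) : NotPole ((starRingEnd ℂ) z) := fun n hn =>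
  h n (by simpa using congrArg (starRingEnd ℂ) hn)

theorem exp_leading_add_binet_sign (M : ℕ) {σ r θ : ℝ} (hσ : σ = 1 ∨ σ = -1) (hr : 0 < r)
    (h1 : ((M : ℝ) - 1 / 2) * Real.pi < σ * θ) (h2 : σ * θ < ((M : ℝ) + 1 / 2) * Real.pi)
    (hnp : NotPole (pt r θ)) :
    Complex.exp (leading r θ + binet (pt r θ)) = Complex.Gamma (pt r θ) *
      (-Complex.exp ((σ : ℂ) * (2 * Complex.I * Real.pi * pt r θ))) ^ (M / 2) *
      (1 - Complex.exp ((σ : ℂ) * (2 * Complex.I * Real.pi * pt r θ))) ^ (M % 2) := by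
  rcases hσ with rfl | rfl
  · rw [one_mul] at h1 h2
    simpa using exp_leading_add_binet M hr h1 h2 hnp
  · rw [neg_one_mul] at h1 h2
    have hconj := pt_neg r θ
    have h := exp_leading_add_binet M hr h1 h2 (by rw [hconj]; exact notPole_conj hnp)
    rw [leading_neg, hconj, binet_conj, ← map_add, Complex.Gamma_conj, Complex.exp_conj] at h
    have he : Complex.exp (2 * Complex.I * Real.pi * (starRingEnd ℂ) (pt r θ)) = (starRingEnd ℂ)
        (Complex.exp (((-1 : ℝ) : ℂ) * (2 * Complex.I * Real.pi * pt r θ))) := by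
      rw [← Complex.exp_conj]
      congr 1
      simp [map_ofNat]
    rw [he] at h
    apply (starRingEnd ℂ).injective
    rw [h]
    simp

theorem one_sub_exp_ne_zero {σ : ℝ} (hσ : σ = 1 ∨ σ = -1) {z : ℂ} (h1 : NotPole z)
    (h2 : NotPole (-z)) : 1 - Complex.exp ((σ : ℂ) * (2 * Complex.I * Real.pi * z)) ≠ 0 := by
  refine sub_ne_zero.2 (Ne.symm ?_)
  rcases hσ with rfl | rfl
  · simpa using exp_two_pi_mul_I_ne_one h1 h2
  · have := exp_two_pi_mul_I_ne_one h2 (by rwa [neg_neg])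
    simpa using this

theorem neg_one_pow_mul_cos_pos {M : ℕ} {t : ℝ} (h1 : ((M : ℝ) - 1 / 2) * Real.pi < t)
    (h2 : t < ((M : ℝ) + 1 / 2) * Real.pi) : 0 < (-1) ^ M * Real.cos t := by
  rw [← Real.cos_sub_nat_mul_pi]
  exact Real.cos_pos_of_mem_Ioo ⟨by linarith, by linarith⟩

theorem cos_sign_mul {σ : ℝ} (hσ : σ = 1 ∨ σ = -1) (t : ℝ) : Real.cos (σ * t) = Real.cos t := by
  rcases hσ with rfl | rfl <;> simp

theorem sin_sign_mul {σ : ℝ} (hσ : σ = 1 ∨ σ = -1) (t : ℝ) :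
    Real.sin (σ * t) = σ * Real.sin t := by
  rcases hσ with rfl | rfl <;> simp

theorem neg_one_pow_mul_pt_re_pos {M : ℕ} {σ r θ : ℝ} (hσ : σ = 1 ∨ σ = -1) (hr : 0 < r)
    (h1 : ((M : ℝ) - 1 / 2) * Real.pi < σ * θ) (h2 : σ * θ < ((M : ℝ) + 1 / 2) * Real.pi) :
    0 < (-1) ^ M * (pt r θ).re := by
  rw [pt_re, ← cos_sign_mul hσ θ, mul_left_comm]
  exact mul_pos hr (neg_one_pow_mul_cos_pos h1 h2)

/-! ### Closed forms in the sectors and on the lines -/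

/-- The closed form of the determination in the `M`-th Stokes sector on the side `σ`. -/
def sectorValue (M : ℕ) (σ r θ : ℝ) : ℂ :=
  leading r θ + binet (pt r θ) + sectorDisc M σ (pt r θ)

/-- The closed form of the determination on the `M`-th Stokes lines. -/
def lineValue (M : ℕ) (r θ : ℝ) : ℂ :=
  leading r θ + 2 * pt r θ * (linePV r : ℂ) + (lineDisc M r : ℂ)

theorem sectorDisc_zero (σ : ℝ) (z : ℂ) : sectorDisc 0 σ z = 0 := by simp [sectorDisc]

theorem sectorDisc_even (m : ℕ) (σ : ℝ) (z : ℂ) : sectorDisc (2 * m) σ z =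
    -(m : ℂ) * Complex.log (-Complex.exp ((σ : ℂ) * (2 * Complex.I * Real.pi * z))) := by
  simp [sectorDisc]

theorem sectorDisc_odd (m : ℕ) (σ : ℝ) (z : ℂ) : sectorDisc (2 * m + 1) σ z =
    -(m : ℂ) * Complex.log (-Complex.exp ((σ : ℂ) * (2 * Complex.I * Real.pi * z)))
      - Complex.log (1 - Complex.exp ((σ : ℂ) * (2 * Complex.I * Real.pi * z))) := by
  rw [sectorDisc, show (2 * m + 1) / 2 = m by omega, pow_succ, pow_mul]
  norm_num

theorem exp_sectorValue (M : ℕ) {σ r θ : ℝ} (hσ : σ = 1 ∨ σ = -1) (hr : 0 < r)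
    (h1 : ((M : ℝ) - 1 / 2) * Real.pi < σ * θ) (h2 : σ * θ < ((M : ℝ) + 1 / 2) * Real.pi)
    (hnp : NotPole (pt r θ)) :
    Complex.exp (sectorValue M σ r θ) = Complex.Gamma (pt r θ) := by
  have hre := neg_one_pow_mul_pt_re_pos hσ hr h1 h2
  have hE : -Complex.exp ((σ : ℂ) * (2 * Complex.I * Real.pi * pt r θ)) ≠ 0 :=
    neg_ne_zero.2 (Complex.exp_ne_zero _)
  rw [sectorValue, Complex.exp_add, exp_leading_add_binet_sign M hσ hr h1 h2 hnp]
  rcases Nat.even_or_odd' M with ⟨m, rfl | rfl⟩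
  · rw [sectorDisc_even, show 2 * m / 2 = m by omega, Nat.mul_mod_right, neg_mul,
      Complex.exp_neg, Complex.exp_nat_mul, Complex.exp_log hE]
    field_simp
  -- For odd M the point lies in the left half-plane, so −z is no pole and z is not an integer;
  -- hence 1 − e^{±2πiz} ≠ 0.
  · have hz : NotPole (-pt r θ) := by
      refine notPole_of_re_pos ?_
      rw [pow_succ, pow_mul] at hre
      norm_num at hre
      simpa using hre
    have hF := one_sub_exp_ne_zero hσ hnp hz
    rw [sectorDisc_odd, show (2 * m + 1) / 2 = m by omega, show (2 * m + 1) % 2 = 1 by omega,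
      Complex.exp_sub, neg_mul, Complex.exp_neg, Complex.exp_nat_mul, Complex.exp_log hE,
      Complex.exp_log hF, pow_one]
    generalize 1 - Complex.exp ((σ : ℂ) * (2 * Complex.I * Real.pi * pt r θ)) = w at hF ⊢
    field_simp

/-! ### One-sided limits of the discontinuity terms -/

section Limits

variable {ι : Type*} {l : Filter ι} {u : ι → ℂ} {c s : ℝ}

theorem tendsto_im_zero (hu : Tendsto u l (𝓝 (c : ℂ))) : Tendsto (fun i => (u i).im) l (𝓝 0) := by
  have := (Complex.continuous_im.tendsto (c : ℂ)).comp hu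
  rwa [Complex.ofReal_im] at this

/-- Near the real axis −e^u is close to the cut; the side from which u comes decides whether the
principal value is u − iπ or u + iπ. -/
theorem tendsto_log_neg_exp (hs : s = 1 ∨ s = -1) (hu : Tendsto u l (𝓝 (c : ℂ)))
    (h : ∀ᶠ i in l, 0 < s * (u i).im) :
    Tendsto (fun i => Complex.log (-Complex.exp (u i))) l (𝓝 ((c : ℂ) - s * Real.pi * Complex.I)) := by
  have him := tendsto_im_zero hu
  have h1 := him.eventually (Ioo_mem_nhds (neg_lt_zero.2 Real.pi_pos) Real.pi_pos)
  refine (hu.sub_const _).congr' ?_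
  filter_upwards [h, h1] with i hi hi1
  have he : -Complex.exp (u i) = Complex.exp (u i - s * Real.pi * Complex.I) := by
    rw [Complex.exp_sub]
    rcases hs with rfl | rfl
    · simp [div_neg]
    · simp [Complex.exp_neg, div_neg]
  have h2 : (u i - s * Real.pi * Complex.I).im = (u i).im - s * Real.pi := by simp
  rw [he, Complex.log_exp]
  · rw [h2]
    rcases hs with rfl | rfl <;> linarith [hi1.1, Real.pi_pos]
  · rw [h2]
    rcases hs with rfl | rfl <;> linarith [hi1.2, Real.pi_pos]

theorem tendsto_log_one_sub_exp_of_neg (hc : c < 0) (hu : Tendsto u l (𝓝 (c : ℂ))) :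
    Tendsto (fun i => Complex.log (1 - Complex.exp (u i))) l
      (𝓝 (Real.log (1 - Real.exp c) : ℂ)) := by
  have hpos : 0 < 1 - Real.exp c := sub_pos.2 (Real.exp_lt_one_iff.2 hc)
  have h1 : Tendsto (fun i => 1 - Complex.exp (u i)) l (𝓝 ((1 - Real.exp c : ℝ) : ℂ)) := by
    push_cast
    exact ((Complex.continuous_exp.tendsto _).comp hu).const_sub 1
  rw [Complex.ofReal_log hpos.le]
  exact h1.clog (Complex.ofReal_mem_slitPlane.2 hpos)

/-- For c > 0 the number 1 − e^u is again near the cut. It equals −e^v with v = ln(e^u − 1), whose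
imaginary part has the sign of that of u. -/
theorem tendsto_log_one_sub_exp_of_pos (hs : s = 1 ∨ s = -1) (hc : 0 < c)
    (hu : Tendsto u l (𝓝 (c : ℂ))) (h : ∀ᶠ i in l, 0 < s * (u i).im) :
    Tendsto (fun i => Complex.log (1 - Complex.exp (u i))) l
      (𝓝 ((c : ℂ) + (Real.log (1 - Real.exp (-c)) : ℂ) - s * Real.pi * Complex.I)) := by
  have hpos : 0 < Real.exp c - 1 := sub_pos.2 (Real.one_lt_exp_iff.2 hc)
  have hlog : Real.log (Real.exp c - 1) = c + Real.log (1 - Real.exp (-c)) := by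
    have h0 : 0 < 1 - Real.exp (-c) := sub_pos.2 (Real.exp_lt_one_iff.2 (by linarith))
    have h1 : Real.exp c - 1 = Real.exp c * (1 - Real.exp (-c)) := by
      rw [mul_sub, ← Real.exp_add, add_neg_cancel, Real.exp_zero, mul_one]
    rw [h1, Real.log_mul (Real.exp_ne_zero _) h0.ne', Real.log_exp]
  have h1 : Tendsto (fun i => Complex.exp (u i) - 1) l (𝓝 ((Real.exp c - 1 : ℝ) : ℂ)) := by
    push_cast
    exact ((Complex.continuous_exp.tendsto _).comp hu).sub_const 1
  have h2 := h1.clog (Complex.ofReal_mem_slitPlane.2 hpos)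
  have h3 : ∀ᶠ i in l, Complex.exp (u i) - 1 ∈ Complex.slitPlane :=
    h1.eventually (Complex.isOpen_slitPlane.mem_nhds (Complex.ofReal_mem_slitPlane.2 hpos))
  have h4 := (tendsto_im_zero hu).eventually (Ioo_mem_nhds (neg_lt_zero.2 Real.pi_pos) Real.pi_pos)
  rw [← Complex.ofReal_log hpos.le, hlog] at h2
  have h5 : ∀ᶠ i in l, 0 < s * (Complex.log (Complex.exp (u i) - 1)).im := by
    filter_upwards [h, h4] with i hi hi4
    have him : (Complex.exp (u i) - 1).im = Real.exp (u i).re * Real.sin (u i).im := by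
      rw [Complex.sub_im, Complex.one_im, sub_zero, Complex.exp_im]
    rw [Complex.log_im]
    rcases hs with rfl | rfl
    · rw [one_mul] at hi ⊢
      have h6 : 0 < (Complex.exp (u i) - 1).im := by
        rw [him]
        exact mul_pos (Real.exp_pos _) (Real.sin_pos_of_pos_of_lt_pi hi hi4.2)
      refine lt_of_le_of_ne (Complex.arg_nonneg_iff.2 h6.le) fun h7 => ?_
      exact h6.ne' (Complex.arg_eq_zero_iff.1 h7.symm).2
    · rw [neg_one_mul, neg_pos] at hi ⊢
      rw [Complex.arg_neg_iff, him]
      exact mul_neg_of_pos_of_neg (Real.exp_pos _) (Real.sin_neg_of_neg_of_neg_pi_lt hi hi4.1)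
  have h6 := tendsto_log_neg_exp hs h2 h5
  push_cast at h6 ⊢
  refine h6.congr' ?_
  filter_upwards [h3] with i hi
  rw [Complex.exp_log (Complex.slitPlane_ne_zero hi), neg_sub]

end Limits

/-! ### The means on the Stokes lines -/

theorem sin_stokes (M : ℕ) : Real.sin (((M : ℝ) + 1 / 2) * Real.pi) = (-1) ^ M := by
  rw [show ((M : ℝ) + 1 / 2) * Real.pi = Real.pi / 2 + M * Real.pi by ring,
    Real.sin_add_nat_mul_pi, Real.sin_pi_div_two, mul_one]

theorem cos_stokes (M : ℕ) : Real.cos (((M : ℝ) + 1 / 2) * Real.pi) = 0 := by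
  rw [show ((M : ℝ) + 1 / 2) * Real.pi = Real.pi / 2 + M * Real.pi by ring,
    Real.cos_add_nat_mul_pi, Real.cos_pi_div_two, mul_zero]

theorem pt_stokes_sq {σ : ℝ} (hσ : σ = 1 ∨ σ = -1) (r : ℝ) (M : ℕ) :
    pt r (σ * (((M : ℝ) + 1 / 2) * Real.pi)) ^ 2 = -(r : ℂ) ^ 2 := by
  have h : pt r (σ * (((M : ℝ) + 1 / 2) * Real.pi)) = ((r * (σ * (-1) ^ M) : ℝ) : ℂ) * Complex.I := by
    apply Complex.ext
    · rw [pt_re, cos_sign_mul hσ, cos_stokes]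
      simp only [Complex.mul_re, Complex.ofReal_re, Complex.ofReal_im, Complex.I_re, Complex.I_im]
      ring
    · rw [pt_im, sin_sign_mul hσ, sin_stokes]
      simp only [Complex.mul_im, Complex.ofReal_re, Complex.ofReal_im, Complex.I_re, Complex.I_im]
      ring
  have h2 : (σ * (-1) ^ M) ^ 2 = 1 := by
    rw [mul_pow, ← pow_mul, mul_comm M 2, pow_mul]
    rcases hσ with rfl | rfl <;> norm_num
  rw [h, mul_pow, Complex.I_sq, ← Complex.ofReal_pow, mul_pow, h2]
  push_cast
  ring

/-- With θ = σt the real part is independent of σ, and the sign of σ cos t tells from which side the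
real limit is approached. -/
theorem exponent_eq {σ : ℝ} (hσ : σ = 1 ∨ σ = -1) (r t : ℝ) :
    (σ : ℂ) * (2 * Complex.I * Real.pi * pt r (σ * t)) =
      ((-(2 * Real.pi * r) * Real.sin t : ℝ) : ℂ)
        + ((2 * Real.pi * r * (σ * Real.cos t) : ℝ) : ℂ) * Complex.I := by
  have h : pt r (σ * t) = ((r * Real.cos t : ℝ) : ℂ) + ((r * (σ * Real.sin t) : ℝ) : ℂ) * Complex.I := by
    apply Complex.ext
    · rw [pt_re, cos_sign_mul hσ]
      simp only [Complex.add_re, Complex.mul_re, Complex.ofReal_re, Complex.ofReal_im,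
        Complex.I_re, Complex.I_im]
      ring
    · rw [pt_im, sin_sign_mul hσ]
      simp only [Complex.add_im, Complex.mul_im, Complex.ofReal_re, Complex.ofReal_im,
        Complex.I_re, Complex.I_im]
      ring
  have hI := Complex.I_sq
  rw [h]
  push_cast
  rcases hσ with rfl | rfl
  · push_cast
    linear_combination (2 * Real.pi * r * Complex.sin t) * hI
  · push_cast
    linear_combination (2 * Real.pi * r * Complex.sin t) * hI

theorem exponent_im {σ : ℝ} (hσ : σ = 1 ∨ σ = -1) (r t : ℝ) :
    ((σ : ℂ) * (2 * Complex.I * Real.pi * pt r (σ * t))).im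
      = 2 * Real.pi * r * (σ * Real.cos t) := by
  rw [exponent_eq hσ]
  simp only [Complex.add_im, Complex.mul_im, Complex.ofReal_re, Complex.ofReal_im, Complex.I_re,
    Complex.I_im]
  ring

theorem tendsto_exponent {σ : ℝ} (hσ : σ = 1 ∨ σ = -1) (r : ℝ) (M : ℕ) {l : Filter ℝ}
    (hl : l ≤ 𝓝 (((M : ℝ) + 1 / 2) * Real.pi)) :
    Tendsto (fun t => (σ : ℂ) * (2 * Complex.I * Real.pi * pt r (σ * t))) l
      (𝓝 ((-(2 * Real.pi * r) * (-1) ^ M : ℝ) : ℂ)) := by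
  simp_rw [exponent_eq hσ]
  have : Continuous fun t : ℝ => ((-(2 * Real.pi * r) * Real.sin t : ℝ) : ℂ)
        + ((2 * Real.pi * r * (σ * Real.cos t) : ℝ) : ℂ) * Complex.I := by fun_prop
  have h := (this.tendsto (((M : ℝ) + 1 / 2) * Real.pi)).mono_left hl
  rw [sin_stokes, cos_stokes] at h
  simpa using h

section Mean

variable {σ r : ℝ} {M : ℕ} {l : Filter ℝ}

theorem eventually_neg_one_pow_mul_cos_left (M : ℕ) :
    ∀ᶠ t in 𝓝[<] (((M : ℝ) + 1 / 2) * Real.pi), 0 < (-1) ^ M * Real.cos t := by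
  have h : ((M : ℝ) - 1 / 2) * Real.pi < ((M : ℝ) + 1 / 2) * Real.pi := by
    nlinarith [Real.pi_pos]
  filter_upwards [Ioo_mem_nhdsLT h] with t ht
  exact neg_one_pow_mul_cos_pos ht.1 ht.2

theorem eventually_neg_one_pow_mul_cos_right (M : ℕ) :
    ∀ᶠ t in 𝓝[>] (((M : ℝ) + 1 / 2) * Real.pi), (-1) ^ M * Real.cos t < 0 := by
  have h : ((M : ℝ) + 1 / 2) * Real.pi < (((M + 1 : ℕ) : ℝ) + 1 / 2) * Real.pi := by
    push_cast; nlinarith [Real.pi_pos]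
  filter_upwards [Ioo_mem_nhdsGT h] with t ht
  have := neg_one_pow_mul_cos_pos (M := M + 1) (t := t)
    (by push_cast; linarith [ht.1]) ht.2
  rw [pow_succ] at this
  linarith

theorem tendsto_leading_stokes (σ r : ℝ) (M : ℕ) (hl : l ≤ 𝓝 (((M : ℝ) + 1 / 2) * Real.pi)) :
    Tendsto (fun t => leading r (σ * t)) l (𝓝 (leading r (σ * (((M : ℝ) + 1 / 2) * Real.pi)))) :=
  (((continuous_leading r).comp (continuous_const_mul σ)).tendsto _).mono_left hl

theorem tendsto_pt_stokes (σ r : ℝ) (M : ℕ) (hl : l ≤ 𝓝 (((M : ℝ) + 1 / 2) * Real.pi)) :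
    Tendsto (fun t => pt r (σ * t)) l (𝓝 (pt r (σ * (((M : ℝ) + 1 / 2) * Real.pi)))) :=
  (((continuous_pt r).comp (continuous_const_mul σ)).tendsto _).mono_left hl

theorem tendsto_binet_stokes_right [l.IsCountablyGenerated] (hσ : σ = 1 ∨ σ = -1) (hr : 0 < r)
    (hl : l ≤ 𝓝 (((M : ℝ) + 1 / 2) * Real.pi)) (h : ∀ᶠ t in l, 0 < Real.cos t) :
    Tendsto (fun t => binet (pt r (σ * t))) l
      (𝓝 (2 * pt r (σ * (((M : ℝ) + 1 / 2) * Real.pi)) * (linePV r : ℂ)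
      - 1 / 2 * (Real.log (1 - Real.exp (-(2 * Real.pi * r))) : ℂ))) := by
  refine tendsto_binet_right hr (pt_stokes_sq hσ r M) (tendsto_pt_stokes σ r M hl) ?_
    (Eventually.of_forall fun t => norm_pt hr _)
  filter_upwards [h] with t ht
  rw [pt_re, cos_sign_mul hσ]
  exact mul_pos hr ht

theorem tendsto_binet_stokes_left [l.IsCountablyGenerated] (hσ : σ = 1 ∨ σ = -1) (hr : 0 < r)
    (hl : l ≤ 𝓝 (((M : ℝ) + 1 / 2) * Real.pi)) (h : ∀ᶠ t in l, Real.cos t < 0) :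
    Tendsto (fun t => binet (pt r (σ * t))) l
      (𝓝 (2 * pt r (σ * (((M : ℝ) + 1 / 2) * Real.pi)) * (linePV r : ℂ)
      + 1 / 2 * (Real.log (1 - Real.exp (-(2 * Real.pi * r))) : ℂ))) := by
  refine tendsto_binet_left hr (pt_stokes_sq hσ r M) (tendsto_pt_stokes σ r M hl) ?_
    (Eventually.of_forall fun t => norm_pt hr _)
  filter_upwards [h] with t ht
  rw [pt_re, cos_sign_mul hσ]
  exact mul_neg_of_pos_of_neg hr ht

theorem eventually_exponent_im_pos (hσ : σ = 1 ∨ σ = -1) (hr : 0 < r)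
    (h : ∀ᶠ t in l, 0 < Real.cos t) :
    ∀ᶠ t in l, 0 < σ * ((σ : ℂ) * (2 * Complex.I * Real.pi * pt r (σ * t))).im := by
  filter_upwards [h] with t ht
  rw [exponent_im hσ]
  have : 0 < 2 * Real.pi * r * Real.cos t := by positivity
  rcases hσ with rfl | rfl <;> linarith

theorem eventually_exponent_im_neg (hσ : σ = 1 ∨ σ = -1) (hr : 0 < r)
    (h : ∀ᶠ t in l, Real.cos t < 0) :
    ∀ᶠ t in l, 0 < -σ * ((σ : ℂ) * (2 * Complex.I * Real.pi * pt r (σ * t))).im := by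
  filter_upwards [h] with t ht
  rw [exponent_im hσ]
  have : 2 * Real.pi * r * Real.cos t < 0 := mul_neg_of_pos_of_neg (by positivity) ht
  rcases hσ with rfl | rfl <;> linarith

theorem neg_sign (hσ : σ = 1 ∨ σ = -1) : -σ = 1 ∨ -σ = -1 := by
  rcases hσ with rfl | rfl <;> norm_num

theorem lineDisc_even (m : ℕ) (r : ℝ) : lineDisc (2 * m) r =
    m * (2 * Real.pi * r) - 1 / 2 * Real.log (1 - Real.exp (-(2 * Real.pi * r))) := by
  simp [lineDisc]

theorem lineDisc_odd (m : ℕ) (r : ℝ) : lineDisc (2 * m + 1) r =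
    -((m + 1) * (2 * Real.pi * r)) - 1 / 2 * Real.log (1 - Real.exp (-(2 * Real.pi * r))) := by
  rw [lineDisc, show (2 * m + 1) / 2 = m by omega, pow_succ, pow_mul]
  norm_num
  ring

/-- Binet's integral goes from −½ℓ to +½ℓ with ℓ = ln(1 − e^{−2πr}), and the new term −ℓ restores
−½ℓ. Only the sign of σπi in the m logarithms ln(−e^u) flips, and it averages out. -/
theorem exists_mean_even (m : ℕ) (hσ : σ = 1 ∨ σ = -1) (hr : 0 < r) : ∃ a b : ℂ,
    Tendsto (fun t => sectorValue (2 * m) σ r (σ * t))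
      (𝓝[<] ((((2 * m : ℕ) : ℝ) + 1 / 2) * Real.pi)) (𝓝 a) ∧
    Tendsto (fun t => sectorValue (2 * m + 1) σ r (σ * t))
      (𝓝[>] ((((2 * m : ℕ) : ℝ) + 1 / 2) * Real.pi)) (𝓝 b) ∧
    lineValue (2 * m) r (σ * ((((2 * m : ℕ) : ℝ) + 1 / 2) * Real.pi)) = (a + b) / 2 := by
  set l₁ := 𝓝[<] ((((2 * m : ℕ) : ℝ) + 1 / 2) * Real.pi)
  set l₂ := 𝓝[>] ((((2 * m : ℕ) : ℝ) + 1 / 2) * Real.pi)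
  have hl₁ : l₁ ≤ 𝓝 ((((2 * m : ℕ) : ℝ) + 1 / 2) * Real.pi) := nhdsWithin_le_nhds
  have hl₂ : l₂ ≤ 𝓝 ((((2 * m : ℕ) : ℝ) + 1 / 2) * Real.pi) := nhdsWithin_le_nhds
  have hcos₁ : ∀ᶠ t in l₁, 0 < Real.cos t := by
    filter_upwards [eventually_neg_one_pow_mul_cos_left (2 * m)] with t ht
    simpa [pow_mul] using ht
  have hcos₂ : ∀ᶠ t in l₂, Real.cos t < 0 := by
    filter_upwards [eventually_neg_one_pow_mul_cos_right (2 * m)] with t ht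
    simpa [pow_mul] using ht
  have hc : -(2 * Real.pi * r) * (-1) ^ (2 * m) = -(2 * Real.pi * r) := by simp [pow_mul]
  have hu₁ := tendsto_exponent hσ r (2 * m) hl₁
  have hu₂ := tendsto_exponent hσ r (2 * m) hl₂
  rw [hc] at hu₁ hu₂
  have hneg : -(2 * Real.pi * r) < 0 := neg_lt_zero.2 (by positivity)
  have h1 := ((tendsto_leading_stokes σ r (2 * m) hl₁).add
    (tendsto_binet_stokes_right hσ hr hl₁ hcos₁)).add
    ((tendsto_log_neg_exp hσ hu₁ (eventually_exponent_im_pos hσ hr hcos₁)).const_mul (-(m : ℂ)))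
  have h2 := ((tendsto_leading_stokes σ r (2 * m) hl₂).add
    (tendsto_binet_stokes_left hσ hr hl₂ hcos₂)).add
    (((tendsto_log_neg_exp (neg_sign hσ) hu₂
      (eventually_exponent_im_neg hσ hr hcos₂)).const_mul (-(m : ℂ))).sub
      (tendsto_log_one_sub_exp_of_neg hneg hu₂))
  refine ⟨_, _, h1.congr fun t => ?_, h2.congr fun t => ?_, ?_⟩
  · rw [sectorValue, sectorDisc_even]
  · rw [sectorValue, sectorDisc_odd]
  · rw [lineValue, lineDisc_even]
    push_cast
    ring

/-- Here e^u is large: ln(1 − e^u) contributes 2πr + ℓ up to ±πi on the left, with ℓ = ln(1 −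
e^{−2πr}), while on the right it is replaced by an (m+1)-st copy of ln(−e^u). Both sides have real
discontinuity part −(m+1)·2πr − ½ℓ once the half residue is included. -/
theorem exists_mean_odd (m : ℕ) (hσ : σ = 1 ∨ σ = -1) (hr : 0 < r) : ∃ a b : ℂ,
    Tendsto (fun t => sectorValue (2 * m + 1) σ r (σ * t))
      (𝓝[<] ((((2 * m + 1 : ℕ) : ℝ) + 1 / 2) * Real.pi)) (𝓝 a) ∧
    Tendsto (fun t => sectorValue (2 * m + 1 + 1) σ r (σ * t))
      (𝓝[>] ((((2 * m + 1 : ℕ) : ℝ) + 1 / 2) * Real.pi)) (𝓝 b) ∧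
    lineValue (2 * m + 1) r (σ * ((((2 * m + 1 : ℕ) : ℝ) + 1 / 2) * Real.pi)) = (a + b) / 2 := by
  set l₁ := 𝓝[<] ((((2 * m + 1 : ℕ) : ℝ) + 1 / 2) * Real.pi)
  set l₂ := 𝓝[>] ((((2 * m + 1 : ℕ) : ℝ) + 1 / 2) * Real.pi)
  have hl₁ : l₁ ≤ 𝓝 ((((2 * m + 1 : ℕ) : ℝ) + 1 / 2) * Real.pi) := nhdsWithin_le_nhds
  have hl₂ : l₂ ≤ 𝓝 ((((2 * m + 1 : ℕ) : ℝ) + 1 / 2) * Real.pi) := nhdsWithin_le_nhds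
  have hcos₁ : ∀ᶠ t in l₁, Real.cos t < 0 := by
    filter_upwards [eventually_neg_one_pow_mul_cos_left (2 * m + 1)] with t ht
    simpa [pow_succ, pow_mul] using ht
  have hcos₂ : ∀ᶠ t in l₂, 0 < Real.cos t := by
    filter_upwards [eventually_neg_one_pow_mul_cos_right (2 * m + 1)] with t ht
    simpa [pow_succ, pow_mul] using ht
  have hc : -(2 * Real.pi * r) * (-1) ^ (2 * m + 1) = 2 * Real.pi * r := by
    simp [pow_succ, pow_mul]
  have hu₁ := tendsto_exponent hσ r (2 * m + 1) hl₁
  have hu₂ := tendsto_exponent hσ r (2 * m + 1) hl₂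
  rw [hc] at hu₁ hu₂
  have hpos : 0 < 2 * Real.pi * r := by positivity
  have him := eventually_exponent_im_neg hσ hr hcos₁
  have h1 := ((tendsto_leading_stokes σ r (2 * m + 1) hl₁).add
    (tendsto_binet_stokes_left hσ hr hl₁ hcos₁)).add
    (((tendsto_log_neg_exp (neg_sign hσ) hu₁ him).const_mul (-(m : ℂ))).sub
      (tendsto_log_one_sub_exp_of_pos (neg_sign hσ) hpos hu₁ him))
  have h2 := ((tendsto_leading_stokes σ r (2 * m + 1) hl₂).add
    (tendsto_binet_stokes_right hσ hr hl₂ hcos₂)).add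
    ((tendsto_log_neg_exp hσ hu₂ (eventually_exponent_im_pos hσ hr hcos₂)).const_mul
      (-((m + 1 : ℕ) : ℂ)))
  refine ⟨_, _, h1.congr fun t => ?_, h2.congr fun t => ?_, ?_⟩
  · rw [sectorValue, sectorDisc_odd]
  · rw [sectorValue, show 2 * m + 1 + 1 = 2 * (m + 1) by ring, sectorDisc_even]
  · rw [lineValue, lineDisc_odd]
    push_cast
    ring

/-- On a Stokes line the closed form is the mean of the limits from the two adjacent sectors. -/
theorem exists_mean (M : ℕ) (hσ : σ = 1 ∨ σ = -1) (hr : 0 < r) : ∃ a b : ℂ,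
    Tendsto (fun t => sectorValue M σ r (σ * t)) (𝓝[<] (((M : ℝ) + 1 / 2) * Real.pi)) (𝓝 a) ∧
    Tendsto (fun t => sectorValue (M + 1) σ r (σ * t))
      (𝓝[>] (((M : ℝ) + 1 / 2) * Real.pi)) (𝓝 b) ∧
    lineValue M r (σ * (((M : ℝ) + 1 / 2) * Real.pi)) = (a + b) / 2 := by
  rcases Nat.even_or_odd' M with ⟨m, rfl | rfl⟩
  · exact exists_mean_even m hσ hr
  · exact exists_mean_odd m hσ hr

end Mean

/-! ### The determination -/

open Classical in
/-- The determination of `ln Γ` on the Riemann surface of the logarithm. -/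
def logGammaSurface (r θ : ℝ) : ℂ :=
  if ∃ k : ℤ, θ = ((k : ℝ) + 1 / 2) * Real.pi then lineValue ⌊|θ| / Real.pi⌋₊ r θ
  else sectorValue ⌊|θ| / Real.pi + 1 / 2⌋₊ (if 0 ≤ θ then 1 else -1) r θ

theorem ne_stokes_of_mem_sector {M : ℕ} {σ θ : ℝ} (hσ : σ = 1 ∨ σ = -1)
    (h1 : ((M : ℝ) - 1 / 2) * Real.pi < σ * θ) (h2 : σ * θ < ((M : ℝ) + 1 / 2) * Real.pi)
    (k : ℤ) : θ ≠ ((k : ℝ) + 1 / 2) * Real.pi := by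
  rintro rfl
  rw [← mul_assoc] at h1 h2
  have h3 := lt_of_mul_lt_mul_right h1 Real.pi_pos.le
  have h4 := lt_of_mul_lt_mul_right h2 Real.pi_pos.le
  rcases hσ with rfl | rfl
  · have h5 : (M : ℤ) < k + 1 := by
      have : ((M : ℤ) : ℝ) < ((k + 1 : ℤ) : ℝ) := by push_cast; linarith
      exact_mod_cast this
    have h6 : k < (M : ℤ) := by
      have : (k : ℝ) < ((M : ℤ) : ℝ) := by push_cast; linarith
      exact_mod_cast this
    omega
  · have h5 : (M : ℤ) < -k := by
      have : ((M : ℤ) : ℝ) < ((-k : ℤ) : ℝ) := by push_cast; linarith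
      exact_mod_cast this
    have h6 : -k < (M : ℤ) + 1 := by
      have : ((-k : ℤ) : ℝ) < ((M + 1 : ℤ) : ℝ) := by push_cast; linarith
      exact_mod_cast this
    omega

/-- In the sector M = 0 both signs σ are admissible; the discontinuity term vanishes there, so the
choice made by the sign of θ is harmless. -/
theorem logGammaSurface_sector {M : ℕ} {σ θ : ℝ} (hσ : σ = 1 ∨ σ = -1) (r : ℝ)
    (h1 : ((M : ℝ) - 1 / 2) * Real.pi < σ * θ) (h2 : σ * θ < ((M : ℝ) + 1 / 2) * Real.pi) :
    logGammaSurface r θ = sectorValue M σ r θ := by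
  have hline : ¬ ∃ k : ℤ, θ = ((k : ℝ) + 1 / 2) * Real.pi := fun ⟨k, hk⟩ =>
    ne_stokes_of_mem_sector hσ h1 h2 k hk
  have hpi := Real.pi_pos
  rw [logGammaSurface, if_neg hline]
  rcases M.eq_zero_or_pos with rfl | hM
  · have habs : |θ| < 1 / 2 * Real.pi := by
      rw [abs_lt]
      norm_num at h1 h2
      rcases hσ with rfl | rfl <;> constructor <;> linarith
    have hfloor : ⌊|θ| / Real.pi + 1 / 2⌋₊ = 0 := by
      rw [Nat.floor_eq_zero]
      have := (div_lt_iff₀ hpi).2 habs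
      linarith
    rw [hfloor, sectorValue, sectorValue, sectorDisc_zero, sectorDisc_zero]
  · have hM1 : (1 : ℝ) ≤ M := by exact_mod_cast hM
    have hpos : 0 < σ * θ := lt_of_le_of_lt (by apply mul_nonneg _ hpi.le; linarith) h1
    have habs : |θ| = σ * θ := by
      rw [← abs_of_pos hpos, abs_mul]
      rcases hσ with rfl | rfl <;> simp
    have hsign : (if 0 ≤ θ then (1 : ℝ) else -1) = σ := by
      rcases hσ with rfl | rfl
      · rw [if_pos (by linarith)]
      · rw [if_neg (by linarith)]
    have hfloor : ⌊|θ| / Real.pi + 1 / 2⌋₊ = M := by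
      rw [habs, Nat.floor_eq_iff (by positivity)]
      have h3 := (lt_div_iff₀ hpi).2 h1
      have h4 := (div_lt_iff₀ hpi).2 h2
      constructor <;> linarith
    rw [hfloor, hsign]

theorem logGammaSurface_line (M : ℕ) {σ : ℝ} (hσ : σ = 1 ∨ σ = -1) (r : ℝ) :
    logGammaSurface r (σ * (((M : ℝ) + 1 / 2) * Real.pi))
      = lineValue M r (σ * (((M : ℝ) + 1 / 2) * Real.pi)) := by
  have hline : ∃ k : ℤ, σ * (((M : ℝ) + 1 / 2) * Real.pi) = ((k : ℝ) + 1 / 2) * Real.pi := by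
    rcases hσ with rfl | rfl
    · exact ⟨M, by push_cast; ring⟩
    · exact ⟨-M - 1, by push_cast; ring⟩
  have hpi := Real.pi_pos
  have hfloor : ⌊|σ * (((M : ℝ) + 1 / 2) * Real.pi)| / Real.pi⌋₊ = M := by
    have : |σ * (((M : ℝ) + 1 / 2) * Real.pi)| = ((M : ℝ) + 1 / 2) * Real.pi := by
      rw [abs_mul, abs_of_nonneg (a := ((M : ℝ) + 1 / 2) * Real.pi) (by positivity)]
      rcases hσ with rfl | rfl <;> simp
    rw [this, mul_div_cancel_right₀ _ hpi.ne', Nat.floor_eq_iff (by positivity)]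
    constructor <;> linarith
  rw [logGammaSurface, if_pos hline, hfloor]

theorem exists_sector {θ : ℝ} (h : ∀ k : ℤ, θ ≠ ((k : ℝ) + 1 / 2) * Real.pi) :
    ∃ (M : ℕ) (σ : ℝ), (σ = 1 ∨ σ = -1) ∧ ((M : ℝ) - 1 / 2) * Real.pi < σ * θ ∧
      σ * θ < ((M : ℝ) + 1 / 2) * Real.pi := by
  have hpi := Real.pi_pos
  obtain ⟨σ, hσ, habs⟩ : ∃ σ : ℝ, (σ = 1 ∨ σ = -1) ∧ |θ| = σ * θ := by
    rcases abs_choice θ with h | h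
    · exact ⟨1, Or.inl rfl, by rw [h, one_mul]⟩
    · exact ⟨-1, Or.inr rfl, by rw [h, neg_one_mul]⟩
  refine ⟨⌊|θ| / Real.pi + 1 / 2⌋₊, σ, hσ, ?_, ?_⟩
  · have h1 : (⌊|θ| / Real.pi + 1 / 2⌋₊ : ℝ) ≤ |θ| / Real.pi + 1 / 2 := Nat.floor_le (by positivity)
    set M := ⌊|θ| / Real.pi + 1 / 2⌋₊
    refine lt_of_le_of_ne ?_ fun h2 => ?_
    · rw [← habs, ← le_div_iff₀ hpi]
      linarith
    · rcases hσ with rfl | rfl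
      · exact h (M - 1) (by push_cast; linarith)
      · exact h (-M) (by push_cast; linarith)
  · rw [← habs, ← div_lt_iff₀ hpi]
    linarith [Nat.lt_floor_add_one (|θ| / Real.pi + 1 / 2)]

theorem exists_stokes (k : ℤ) : ∃ (M : ℕ) (σ : ℝ), (σ = 1 ∧ ((k : ℝ) + 1 / 2) = (M : ℝ) + 1 / 2) ∨
    (σ = -1 ∧ ((k : ℝ) + 1 / 2) = -((M : ℝ) + 1 / 2)) := by
  rcases le_or_gt 0 k with h | h
  · lift k to ℕ using h
    exact ⟨k, 1, Or.inl ⟨rfl, by simp⟩⟩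
  · obtain ⟨n, hn⟩ := Int.eq_ofNat_of_zero_le (show 0 ≤ -k - 1 by omega)
    refine ⟨n, -1, Or.inr ⟨rfl, ?_⟩⟩
    have : k = -n - 1 := by omega
    rw [this]
    push_cast
    ring

theorem logGammaSurface_mean_sign (M : ℕ) {σ r : ℝ} (hσ : σ = 1 ∨ σ = -1) (hr : 0 < r) :
    ∃ a b : ℂ,
      Tendsto (fun t => logGammaSurface r (σ * t)) (𝓝[<] (((M : ℝ) + 1 / 2) * Real.pi)) (𝓝 a) ∧
      Tendsto (fun t => logGammaSurface r (σ * t)) (𝓝[>] (((M : ℝ) + 1 / 2) * Real.pi)) (𝓝 b) ∧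
      logGammaSurface r (σ * (((M : ℝ) + 1 / 2) * Real.pi)) = (a + b) / 2 := by
  obtain ⟨a, b, h1, h2, h3⟩ := exists_mean M hσ hr
  have hσσ : ∀ t, σ * (σ * t) = t := fun t => by rcases hσ with rfl | rfl <;> ring
  refine ⟨a, b, h1.congr' ?_, h2.congr' ?_, ?_⟩
  · have h : ((M : ℝ) - 1 / 2) * Real.pi < ((M : ℝ) + 1 / 2) * Real.pi := by
      nlinarith [Real.pi_pos]
    filter_upwards [Ioo_mem_nhdsLT h] with t ht
    rw [logGammaSurface_sector hσ r (by rw [hσσ]; exact ht.1) (by rw [hσσ]; exact ht.2)]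
  · have h : ((M : ℝ) + 1 / 2) * Real.pi < (((M + 1 : ℕ) : ℝ) + 1 / 2) * Real.pi := by
      push_cast; nlinarith [Real.pi_pos]
    filter_upwards [Ioo_mem_nhdsGT h] with t ht
    rw [logGammaSurface_sector (M := M + 1) hσ r
      (by rw [hσσ]; push_cast; linarith [ht.1]) (by rw [hσσ]; exact ht.2)]
  · rw [logGammaSurface_line M hσ, h3]

theorem logGammaSurface_mean (r : ℝ) (k : ℤ) (hr : 0 < r) : ∃ a b : ℂ,
    Tendsto (fun t => logGammaSurface r t) (𝓝[<] (((k : ℝ) + 1 / 2) * Real.pi)) (𝓝 a) ∧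
    Tendsto (fun t => logGammaSurface r t) (𝓝[>] (((k : ℝ) + 1 / 2) * Real.pi)) (𝓝 b) ∧
    logGammaSurface r (((k : ℝ) + 1 / 2) * Real.pi) = (a + b) / 2 := by
  obtain ⟨M, σ, ⟨rfl, hk⟩ | ⟨rfl, hk⟩⟩ := exists_stokes k
  · rw [hk]
    simpa using logGammaSurface_mean_sign M (Or.inl rfl) hr
  · obtain ⟨a, b, h1, h2, h3⟩ := logGammaSurface_mean_sign M (Or.inr rfl) hr
    rw [hk, neg_mul]
    -- Reflection θ ↦ −θ exchanges the two one-sided limits.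
    refine ⟨b, a, ?_, ?_, ?_⟩
    · have := h2.comp (tendsto_neg_nhdsLT_neg (a := ((M : ℝ) + 1 / 2) * Real.pi))
      simpa [Function.comp_def] using this
    · have := h1.comp (tendsto_neg_nhdsGT_neg (a := ((M : ℝ) + 1 / 2) * Real.pi))
      simpa [Function.comp_def] using this
    · rw [add_comm b a, ← h3, neg_one_mul]

theorem logGammaSurface_off_lines {r θ : ℝ} (hr : 0 < r) (h1 : -Real.pi < θ) (h2 : θ ≤ Real.pi)
    (h3 : θ ≠ Real.pi / 2) (h4 : θ ≠ -(Real.pi / 2)) (hnp : NotPole (pt r θ)) :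
    logGammaSurface r θ = logGamma (pt r θ) := by
  have hpi := Real.pi_pos
  rcases lt_or_gt_of_ne h4 with h5 | h5
  · rw [logGammaSurface_sector (M := 1) (σ := -1) (Or.inr rfl) r (by norm_num; linarith)
      (by norm_num; linarith), sectorValue, logGamma_third_quadrant hr h1 h5]
    simp [sectorDisc]
    ring
  rcases lt_or_gt_of_ne h3 with h6 | h6
  · rw [logGammaSurface_sector (M := 0) (σ := 1) (Or.inl rfl) r (by norm_num; linarith)
      (by norm_num; linarith), sectorValue, logGamma_right hr h5 h6, sectorDisc_zero, add_zero]
  · rw [logGammaSurface_sector (M := 1) (σ := 1) (Or.inl rfl) r (by norm_num; linarith)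
      (by norm_num; linarith), sectorValue, logGamma_second_quadrant hr h6 h2 hnp]
    simp [sectorDisc]
    ring

/-- The principal branch is continuous across the imaginary axis, so the two limits agree with it
and so does their mean. -/
theorem logGammaSurface_principal_line {r θ : ℝ} (hr : 0 < r)
    (hθ : θ = Real.pi / 2 ∨ θ = -(Real.pi / 2)) :
    logGammaSurface r θ = logGamma (pt r θ) := by
  have hpi := Real.pi_pos
  obtain ⟨k, hk⟩ : ∃ k : ℤ, θ = ((k : ℝ) + 1 / 2) * Real.pi := by
    rcases hθ with rfl | rfl
    · exact ⟨0, by push_cast; ring⟩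
    · exact ⟨-1, by push_cast; ring⟩
  obtain ⟨a, b, h1, h2, h3⟩ := logGammaSurface_mean r k hr
  rw [← hk] at h1 h2 h3
  have him : (pt r θ).im ≠ 0 := by
    rw [pt_im]
    rcases hθ with rfl | rfl
    · simpa using hr.ne'
    · simpa using hr.ne'
  have hcont : Tendsto (fun t => logGamma (pt r t)) (𝓝 θ) (𝓝 (logGamma (pt r θ))) :=
    (continuousAt_logGamma (Complex.mem_slitPlane_iff.2 (Or.inr him))).comp
      (continuous_pt r).continuousAt
  have hev : ∀ᶠ t in 𝓝[≠] θ, logGamma (pt r t) = logGammaSurface r t := by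
    have hnp : ∀ᶠ t in 𝓝 θ, (pt r t).im ≠ 0 :=
      ((Complex.continuous_im.comp (continuous_pt r)).continuousAt).eventually_ne him
    have hne : ∀ᶠ t in 𝓝 θ, t ≠ -θ := continuousAt_id.eventually_ne (by
      rcases hθ with rfl | rfl <;> intro h <;> simp only [id] at h <;> linarith)
    have hlt : -Real.pi < θ ∧ θ < Real.pi := by
      rcases hθ with rfl | rfl <;> constructor <;> linarith
    filter_upwards [self_mem_nhdsWithin, nhdsWithin_le_nhds hnp, nhdsWithin_le_nhds hne,
      nhdsWithin_le_nhds (Ioo_mem_nhds hlt.1 hlt.2)] with t ht1 ht2 ht3 ht4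
    have ht5 : t ≠ θ := ht1
    refine (logGammaSurface_off_lines hr ht4.1 ht4.2.le ?_ ?_ (notPole_of_im_ne_zero ht2)).symm
    · rcases hθ with rfl | rfl
      · exact ht5
      · simpa using ht3
    · rcases hθ with rfl | rfl
      · exact ht3
      · exact ht5
  have h4 : a = logGamma (pt r θ) := tendsto_nhds_unique h1
    ((hcont.mono_left nhdsWithin_le_nhds).congr' (hev.filter_mono (nhdsLT_le_nhdsNE θ)))
  have h5 : b = logGamma (pt r θ) := tendsto_nhds_unique h2
    ((hcont.mono_left nhdsWithin_le_nhds).congr' (hev.filter_mono (nhdsGT_le_nhdsNE θ)))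
  rw [h3, h4, h5]
  ring

theorem isLogGammaDetermination_logGammaSurface : IsLogGammaDetermination logGammaSurface where
  principal r θ hr h1 h2 hnp := by
    by_cases hθ : θ = Real.pi / 2 ∨ θ = -(Real.pi / 2)
    · exact logGammaSurface_principal_line hr hθ
    · rw [not_or] at hθ
      exact logGammaSurface_off_lines hr h1 h2 hθ.1 hθ.2 hnp
  exp_eq r θ hr h hnp := by
    obtain ⟨M, σ, hσ, h1, h2⟩ := exists_sector h
    rw [logGammaSurface_sector hσ r h1 h2, exp_sectorValue M hσ hr h1 h2 hnp]
  mean r k hr := logGammaSurface_mean r k hr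

end StirlingExact

end

/-! ### The theorem -/

theorem theorem2p1 :
    ∃ L : ℝ → ℝ → ℂ, StirlingExact.IsLogGammaDetermination L ∧
      ∀ N : ℕ, 1 ≤ N → ∀ (M : ℕ) (σ : ℝ), σ = 1 ∨ σ = -1 → ∀ r : ℝ, 0 < r →
        -- the Stokes sectors
        (∀ θ : ℝ, ((M : ℝ) - 1 / 2) * Real.pi < σ * θ → σ * θ < ((M : ℝ) + 1 / 2) * Real.pi →
          (∀ y : ℝ, 0 < y → Summable (StirlingExact.sectorTerm N (StirlingExact.pt r θ) y)) ∧
          MeasureTheory.IntegrableOn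
            (StirlingExact.sectorIntegrand N (StirlingExact.pt r θ)) (Set.Ioi 0) ∧
          (StirlingExact.NotPole (StirlingExact.pt r θ) →
            L r θ = StirlingExact.leading r θ
              + StirlingExact.truncatedSeries N (StirlingExact.pt r θ)
              + StirlingExact.sectorRemainder N (StirlingExact.pt r θ)
              + StirlingExact.sectorDisc M σ (StirlingExact.pt r θ))) ∧
        -- the Stokes lines
        (∀ θ : ℝ, θ = σ * (((M : ℝ) + 1 / 2) * Real.pi) →
          (∀ y : ℝ, 0 < y → y ∉ StirlingExact.linePoles r →
            Summable (StirlingExact.lineTerm N r y)) ∧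
          ∃ P : ℝ,
            StirlingExact.HasPrincipalValue (StirlingExact.lineIntegrand N r)
              (StirlingExact.linePoles r) P ∧
            L r θ = StirlingExact.leading r θ
              + StirlingExact.truncatedSeries N (StirlingExact.pt r θ)
              + 2 * StirlingExact.pt r θ / (2 * (Real.pi : ℂ) * (r : ℂ)) ^ (2 * N - 2) * (P : ℂ)
              + (StirlingExact.lineDisc M r : ℂ)) := by
  refine ⟨StirlingExact.logGammaSurface, StirlingExact.isLogGammaDetermination_logGammaSurface, ?_⟩
  intro N hN M σ hσ r hr
  obtain ⟨m, rfl⟩ : ∃ m, N = m + 1 := ⟨N - 1, by omega⟩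
  refine ⟨fun θ h1 h2 => ?_, ?_⟩
  · have hre : (StirlingExact.pt r θ).re ≠ 0 := by
      intro h0
      have := StirlingExact.neg_one_pow_mul_pt_re_pos hσ hr h1 h2
      rw [h0, mul_zero] at this
      exact lt_irrefl _ this
    refine ⟨fun y _ => StirlingExact.summable_sectorTerm (m + 1) hre y,
      StirlingExact.integrableOn_sectorIntegrand (m + 1) hre, fun _ => ?_⟩
    have h := StirlingExact.truncatedSeries_add_sectorRemainder m hre
    rw [StirlingExact.sectorRemainder_one hre] at h
    rw [StirlingExact.logGammaSurface_sector hσ r h1 h2, StirlingExact.sectorValue, ← h]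
    ring
  · rintro θ rfl
    refine ⟨fun y _ _ => StirlingExact.summable_lineTerm (m + 1) hr y, ?_⟩
    -- The identity that comes with P reduces the claim for this N to the closed form, which
    -- contains `linePV` only.
    obtain ⟨P, hP, h⟩ := StirlingExact.exists_hasPrincipalValue m hr
      (StirlingExact.pt_stokes_sq hσ r M)
    refine ⟨P, hP, ?_⟩
    rw [StirlingExact.logGammaSurface_line M hσ, StirlingExact.lineValue, ← h]
    ring
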